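/- Let $N\ge 2$, $n\ge 2$, and let $\Omega\subset\mathbb{R}^N$ be a smooth ($C^\infty$) bounded domain (open and connected) with boundary $\Gamma=\partial\Omega$. Let $a_1,\dots,a_n\in\Gamma$ be pairwise distinct points and set $$V(x)=\sum_{1\le i<j\le n}\frac{|a_i-a_j|^2}{|x-a_i|^2\,|x-a_j|^2},\qquad \mu^\star(\Omega)=\inf_{u\in H^1_0(\Omega)\setminus\{0\}}\frac{\int_\Omega|\nabla u|^2\,dx}{\int_\Omega V u^2\,dx}.$$ Then: (i) $\displaystyle \frac{(N-2)^2}{n^2}<\mu^\star(\Omega)\le\frac{N^2}{4n-4}.$ (ii) For every real $\mu<\frac{N^2}{4n-4}$ there is a constant $c_\mu\in\mathbb{R}$, depending on $\Omega$ and $a_1,\dots,a_n$ (and $\mu$), such that $$c_\mu\int_\Omega u^2\,dx+\int_\Omega|\nabla u|^2\,dx\ge\mu\int_\Omega V u^2\,dx\qquad\text{for all }u\in C_0^\infty(\Omega).$$ (iii) For every $\mu>\frac{N^2}{4n-4}$ and every $\lambda\in\mathbb{R}$ there is $u_{\lambda,\mu}\in C_0^\infty(\Omega)$ such that $$\lambda\int_\Omega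 u_{\lambda,\mu}^2\,dx+\int_\Omega|\nabla u_{\lambda,\mu}|^2\,dx<\mu\int_\Omega V u_{\lambda,\mu}^2\,dx.$$ (iv) If $\mu^\star(\Omega)<\frac{N^2}{4n-4}$, then $\mu^\star(\Omega)$ is attained in $H^1_0(\Omega)$, i.e. the infimum is attained by some $u\in H^1_0(\Omega)\setminus\{0\}$. -/

import Mathlib

open MeasureTheory Filter Topology
open scoped ENNReal ContDiff

noncomputable section

namespace MultipolarHardy

/-- `ℝ^N` with its Euclidean norm and Lebesgue measure. -/
abbrev E (N : ℕ) : Type := EuclideanSpace ℝ (Fin N)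

/-- A smooth bounded domain: a bounded, open, connected, nonempty set which near every boundary
point is the positivity set of a `C^∞` function that vanishes at that point and whose derivative
does not vanish there (so the boundary is a smooth hypersurface with the set on one side). -/
structure IsSmoothBoundedDomain {N : ℕ} (Ω : Set (E N)) : Prop where
  isOpen : IsOpen Ω
  isConnected : IsConnected Ω
  isBounded : Bornology.IsBounded Ω
  smooth_boundary : ∀ p ∈ frontier Ω, ∃ (U : Set (E N)) (ρ : E N → ℝ),
    IsOpen U ∧ p ∈ U ∧ ContDiffOn ℝ ∞ ρ U ∧ ρ p = 0 ∧ fderiv ℝ ρ p ≠ 0 ∧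
      ∀ x ∈ U, (x ∈ Ω ↔ 0 < ρ x)

/-- `u ∈ C_0^∞(Ω)`: smooth with compact support contained in `Ω` (extended by zero to `ℝ^N`). -/
structure IsTestFunction {N : ℕ} (Ω : Set (E N)) (u : E N → ℝ) : Prop where
  contDiff : ContDiff ℝ ∞ u
  hasCompactSupport : HasCompactSupport u
  tsupport_subset : tsupport u ⊆ Ω

/-- The multipolar potential `V(x) = ∑_{i<j} |a_i - a_j|² / (|x - a_i|² |x - a_j|²)`. -/
def V {N n : ℕ} (a : Fin n → E N) (x : E N) : ℝ :=
  ∑ i : Fin n, ∑ j ∈ Finset.Ioi i, ‖a i - a j‖ ^ 2 / (‖x - a i‖ ^ 2 * ‖x - a j‖ ^ 2)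

/-- `G` is the weak (distributional) gradient of `u` in `Ω`. -/
def HasWeakGradient {N : ℕ} (Ω : Set (E N)) (u : E N → ℝ) (G : E N → E N) : Prop :=
  ∀ φ : E N → ℝ, IsTestFunction Ω φ →
    ∫ x in Ω, u x • gradient φ x = - ∫ x in Ω, φ x • G x

/-- `u ∈ H¹₀(Ω)` with weak gradient `G`: `u` and `G` are square integrable on `Ω`, `G` is the weak
gradient of `u`, and `u` is the limit in `H¹(Ω)` of functions of `C_0^∞(Ω)`. -/
structure MemH10 {N : ℕ} (Ω : Set (E N)) (u : E N → ℝ) (G : E N → E N) : Prop where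
  memLp : MemLp u 2 (volume.restrict Ω)
  memLp_grad : MemLp G 2 (volume.restrict Ω)
  weakGradient : HasWeakGradient Ω u G
  approx : ∃ φ : ℕ → E N → ℝ, (∀ k, IsTestFunction Ω (φ k)) ∧
    Tendsto (fun k => eLpNorm (fun x => φ k x - u x) 2 (volume.restrict Ω)) atTop (𝓝 0) ∧
    Tendsto (fun k => eLpNorm (fun x => gradient (φ k) x - G x) 2 (volume.restrict Ω))
      atTop (𝓝 0)

/-- The quotient `∫_Ω |∇u|² / ∫_Ω V u²`, with `G` in the place of `∇u`, in `[0, ∞]`. -/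
def hardyQuotient {N n : ℕ} (Ω : Set (E N)) (a : Fin n → E N)
    (u : E N → ℝ) (G : E N → E N) : ℝ≥0∞ :=
  (∫⁻ x in Ω, ENNReal.ofReal (‖G x‖ ^ 2)) / (∫⁻ x in Ω, ENNReal.ofReal (V a x * u x ^ 2))

/-- `u` (with weak gradient `G`) is a nonzero element of `H¹₀(Ω)`. -/
def Admissible {N : ℕ} (Ω : Set (E N)) (u : E N → ℝ) (G : E N → E N) : Prop :=
  MemH10 Ω u G ∧ ¬ (u =ᵐ[volume.restrict Ω] 0)

/-- The Hardy constant `μ*(Ω; a_1, …, a_n)`: the infimum of the quotient over the nonzero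
elements of `H¹₀(Ω)`. -/
def hardyConst {N n : ℕ} (Ω : Set (E N)) (a : Fin n → E N) : ℝ≥0∞ :=
  ⨅ (u : E N → ℝ) (G : E N → E N) (_ : Admissible Ω u G), hardyQuotient Ω a u G

end MultipolarHardy

end

/-! Everything rests on one identity for a test function u and a C¹ vector field F on an open set:
∫|∇u - uF|² = ∫|∇u|² + ∫(div F + |F|²)u². For F = ∇φ/φ the weight -(div F + |F|²) is -Δφ/φ, so a
positive supersolution φ yields a Hardy inequality, and the discarded square is ∫φ²|∇(u/φ)|².

The lower bound in (i) comes from φ = ∏|x - a_i|^{-(N-2)/n}. With v_i = ∇log|x - a_i| one has V =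
∑_{i<j}|v_i - v_j|², which makes -Δφ/φ equal to (N-2)²/n² times V. The discarded square, estimated
by Poincaré, leaves a positive remainder (`exists_multipolar_hardy_remainder`).

The critical value is local. Near a pole, V behaves like (n-1)/|x - a_k|² (`tendsto_V`), and Ω looks
like a half-space with the singularity on its boundary, where the best Hardy constant is N²/4 with
virtual ground state ⟨ν, x⟩|x|^{-N/2}. Replacing ⟨ν, x⟩ by a concave function of a defining function
gives the local inequality up to ε (`eventually_boundary_hardy`), and cutoffs at the poles give (ii)
(`exists_hardy_subcritical`). Truncating the ground state and shrinking it towards a pole gives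
(iii) (`exists_hardy_supercritical`), hence the upper bound in (i).

For (iv), take a minimizing sequence of test functions, Cauchy in L² by Rellich's theorem. Below the
critical value, (ii) with a constant μ > μ* combines with the parallelogram law for the nonnegative
form ∫|∇u|² - μ*∫Vu² to make the sequence Cauchy in H¹ and in L²(V dx) as well, so its limit is a
minimizer (`exists_minimizer`). The strict inequality in (i) follows: either a minimizer exists and
its remainder is positive, or μ* is at least the critical value, which exceeds (N-2)²/n². -/

noncomputable section

namespace MultipolarHardy

open scoped RealInnerProductSpace

variable {N n : ℕ}

/-! ### Traces, divergence and the divergence theorem -/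

/-- The divergence of a vector field on `ℝ^N`. -/
def divergence (F : E N → E N) (x : E N) : ℝ :=
  LinearMap.trace ℝ (E N) (fderiv ℝ F x : E N →ₗ[ℝ] E N)

lemma trace_eq_sum_inner (L : E N →L[ℝ] E N) :
    LinearMap.trace ℝ (E N) (L : E N →ₗ[ℝ] E N) =
      ∑ i, ⟪EuclideanSpace.basisFun (Fin N) ℝ i, L (EuclideanSpace.basisFun (Fin N) ℝ i)⟫ := by
  rw [LinearMap.trace_eq_sum_inner _ (EuclideanSpace.basisFun (Fin N) ℝ)]
  rfl

lemma trace_id : LinearMap.trace ℝ (E N) (ContinuousLinearMap.id ℝ (E N) : E N →ₗ[ℝ] E N) = N := by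
  simp

lemma trace_smulRight_innerSL (v w : E N) :
    LinearMap.trace ℝ (E N) (((innerSL ℝ v).smulRight w : E N →L[ℝ] E N) : E N →ₗ[ℝ] E N)
      = ⟪v, w⟫ := by
  rw [trace_eq_sum_inner]
  simp only [ContinuousLinearMap.smulRight_apply, innerSL_apply_apply, real_inner_smul_right]
  exact OrthonormalBasis.sum_inner_mul_inner (EuclideanSpace.basisFun (Fin N) ℝ) v w

/-- Integration by parts against the constant function 1. -/
lemma integral_fderiv_apply_eq_zero {f : E N → ℝ} (hf : ContDiff ℝ 1 f)
    (hc : HasCompactSupport f) (v : E N) : ∫ x, fderiv ℝ f x v = 0 := by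
  have hcf : Continuous fun x => fderiv ℝ f x v :=
    (hf.continuous_fderiv one_ne_zero).clm_apply continuous_const
  have hsf : HasCompactSupport fun x => fderiv ℝ f x v := hc.fderiv_apply ℝ v
  have h := integral_smul_fderiv_eq_neg_fderiv_smul_of_integrable (μ := (volume : Measure (E N)))
    (f := fun _ : E N => (1 : ℝ)) (g := f) (v := v) (by simp)
    (by simpa using hcf.integrable_of_hasCompactSupport hsf)
    (by simpa using hf.continuous.integrable_of_hasCompactSupport hc)
    (fun x _ => differentiableAt_const _) (fun x _ => hf.differentiable one_ne_zero x)
  simpa using h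

/-- The divergence theorem for compactly supported vector fields. -/
lemma integral_divergence_eq_zero {X : E N → E N} (hX : ContDiff ℝ 1 X)
    (hc : HasCompactSupport X) : ∫ x, divergence X x = 0 := by
  have hcf : ∀ v : E N, Continuous fun x => fderiv ℝ X x v := fun v =>
    (hX.continuous_fderiv one_ne_zero).clm_apply continuous_const
  simp only [divergence, trace_eq_sum_inner]
  rw [integral_finsetSum]
  · refine Finset.sum_eq_zero fun i _ => ?_
    set e := EuclideanSpace.basisFun (Fin N) ℝ i
    have h := integral_fderiv_apply_eq_zero (f := fun x => ⟪e, X x⟫)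
      (contDiff_const.inner ℝ hX) (hc.comp_left (g := fun y => ⟪e, y⟫) (by simp)) e
    rw [← h]
    refine integral_congr_ae (Eventually.of_forall fun x => ?_)
    have hd := (innerSL ℝ e).hasFDerivAt.comp x (hX.differentiable one_ne_zero x).hasFDerivAt
    have : fderiv ℝ (fun x => ⟪e, X x⟫) x = (innerSL ℝ e).comp (fderiv ℝ X x) := hd.fderiv
    simp [this]
  · intro i _
    refine Continuous.integrable_of_hasCompactSupport (continuous_const.inner (hcf _)) ?_
    exact (hc.fderiv_apply ℝ _).comp_left (g := fun y => ⟪_, y⟫) (by simp)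

/-! ### Gradients and the algebra of test functions -/

lemma inner_gradient {u : E N → ℝ} {x v : E N} : ⟪gradient u x, v⟫ = fderiv ℝ u x v := by
  rw [gradient, InnerProductSpace.toDual_symm_apply]

lemma norm_gradient (u : E N → ℝ) (x : E N) : ‖gradient u x‖ = ‖fderiv ℝ u x‖ := by
  simp [gradient]

lemma contDiffAt_gradient {u : E N → ℝ} {x : E N} {m : ℕ∞} {k : ℕ∞}
    (h : ContDiffAt ℝ m u x) (hk : k + 1 ≤ m) : ContDiffAt ℝ k (gradient u) x := by
  have : ContDiffAt ℝ k (fderiv ℝ u) x := h.fderiv_right (by exact_mod_cast hk)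
  exact (InnerProductSpace.toDual ℝ (E N)).symm.contDiff.contDiffAt.comp x this

namespace IsTestFunction

variable {Ω : Set (E N)} {u v : E N → ℝ}

lemma continuous_gradient (hu : IsTestFunction Ω u) : Continuous (gradient u) :=
  (InnerProductSpace.toDual ℝ (E N)).symm.continuous.comp (hu.contDiff.continuous_fderiv (by simp))

lemma differentiable (hu : IsTestFunction Ω u) : Differentiable ℝ u :=
  hu.contDiff.differentiable (by simp)

lemma hasGradientAt (hu : IsTestFunction Ω u) (x : E N) : HasGradientAt u (gradient u x) x :=
  (hu.differentiable x).hasGradientAt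

lemma eq_zero (_ : IsTestFunction Ω u) {x : E N} (hx : x ∉ tsupport u) : u x = 0 :=
  image_eq_zero_of_notMem_tsupport hx

lemma gradient_eq_zero (_ : IsTestFunction Ω u) {x : E N} (hx : x ∉ tsupport u) :
    gradient u x = 0 := by
  have : fderiv ℝ u x = 0 := by
    by_contra h
    exact hx (support_fderiv_subset ℝ h)
  simp [gradient, this]

lemma eq_zero_of_notMem (hu : IsTestFunction Ω u) {x : E N} (hx : x ∉ Ω) : u x = 0 :=
  hu.eq_zero fun h => hx (hu.tsupport_subset h)

lemma gradient_eq_zero_of_notMem (hu : IsTestFunction Ω u) {x : E N} (hx : x ∉ Ω) :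
    gradient u x = 0 :=
  hu.gradient_eq_zero fun h => hx (hu.tsupport_subset h)

lemma hasCompactSupport_gradient (hu : IsTestFunction Ω u) : HasCompactSupport (gradient u) :=
  hu.hasCompactSupport.mono' fun x hx => by
    by_contra h
    exact hx (hu.gradient_eq_zero h)

lemma mono {Ω' : Set (E N)} (hu : IsTestFunction Ω u) (h : Ω ⊆ Ω') : IsTestFunction Ω' u :=
  ⟨hu.contDiff, hu.hasCompactSupport, hu.tsupport_subset.trans h⟩

lemma sub (hu : IsTestFunction Ω u) (hv : IsTestFunction Ω v) :
    IsTestFunction Ω (fun x => u x - v x) :=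
  ⟨hu.contDiff.sub hv.contDiff, hu.hasCompactSupport.sub hv.hasCompactSupport,
    (tsupport_sub u v).trans (Set.union_subset hu.tsupport_subset hv.tsupport_subset)⟩

lemma add (hu : IsTestFunction Ω u) (hv : IsTestFunction Ω v) :
    IsTestFunction Ω (fun x => u x + v x) :=
  ⟨hu.contDiff.add hv.contDiff, hu.hasCompactSupport.add hv.hasCompactSupport,
    (tsupport_add u v).trans (Set.union_subset hu.tsupport_subset hv.tsupport_subset)⟩

lemma const_mul (hu : IsTestFunction Ω u) (c : ℝ) : IsTestFunction Ω (fun x => c * u x) :=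
  ⟨contDiff_const.mul hu.contDiff, hu.hasCompactSupport.mul_left,
    (tsupport_mul_subset_right).trans hu.tsupport_subset⟩

lemma gradient_sub (hu : IsTestFunction Ω u) (hv : IsTestFunction Ω v) (x : E N) :
    gradient (fun x => u x - v x) x = gradient u x - gradient v x := by
  simp [gradient, fderiv_fun_sub (hu.differentiable x) (hv.differentiable x)]

lemma gradient_add (hu : IsTestFunction Ω u) (hv : IsTestFunction Ω v) (x : E N) :
    gradient (fun x => u x + v x) x = gradient u x + gradient v x := by
  simp [gradient, fderiv_fun_add (hu.differentiable x) (hv.differentiable x)]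

lemma gradient_const_mul (hu : IsTestFunction Ω u) (c : ℝ) (x : E N) :
    gradient (fun x => c * u x) x = c • gradient u x := by
  simp [gradient, fderiv_const_mul (hu.differentiable x) c]

/-- The product of a test function on an open set with a function that is smooth there. -/
lemma mul_contDiffOn (hΩ : IsOpen Ω) (hu : IsTestFunction Ω u) {g : E N → ℝ}
    (hg : ContDiffOn ℝ ∞ g Ω) : IsTestFunction Ω (fun x => u x * g x) := by
  refine ⟨contDiff_iff_contDiffAt.2 fun x => ?_, hu.hasCompactSupport.mul_right,
    (tsupport_mul_subset_left).trans hu.tsupport_subset⟩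
  by_cases hx : x ∈ tsupport u
  · exact hu.contDiff.contDiffAt.mul (hg.contDiffAt (hΩ.mem_nhds (hu.tsupport_subset hx)))
  · have : (fun x => u x * g x) =ᶠ[𝓝 x] fun _ => 0 := by
      filter_upwards [(isClosed_tsupport u).isOpen_compl.mem_nhds hx] with y hy
      simp [hu.eq_zero hy]
    exact contDiffAt_const.congr_of_eventuallyEq this

/-- A function that is continuous on `Ω`, weighted by something supported in a test function's
support, is integrable. -/
lemma integrable_of_continuousOn (hΩ : IsOpen Ω) (hu : IsTestFunction Ω u)
    {f : E N → ℝ} (hf : ContinuousOn f Ω) (h0 : ∀ x ∉ tsupport u, f x = 0) : Integrable f := by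
  refine Continuous.integrable_of_hasCompactSupport (continuous_iff_continuousAt.2 fun x => ?_)
    (HasCompactSupport.intro hu.hasCompactSupport fun x hx => h0 x hx)
  by_cases hx : x ∈ tsupport u
  · exact hf.continuousAt (hΩ.mem_nhds (hu.tsupport_subset hx))
  · have : f =ᶠ[𝓝 x] fun _ => 0 := by
      filter_upwards [(isClosed_tsupport u).isOpen_compl.mem_nhds hx] with y hy
      exact h0 y hy
    exact continuousAt_const.congr this.symm

lemma integrable_mul_sq (hΩ : IsOpen Ω) (hu : IsTestFunction Ω u)
    {f : E N → ℝ} (hf : ContinuousOn f Ω) : Integrable fun x => f x * u x ^ 2 :=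
  hu.integrable_of_continuousOn hΩ (hf.mul (hu.contDiff.continuous.pow 2).continuousOn)
    fun x hx => by simp [hu.eq_zero hx]

lemma integrable_sq (hu : IsTestFunction Ω u) : Integrable fun x => u x ^ 2 :=
  have hc := hu.contDiff.continuous
  Continuous.integrable_of_hasCompactSupport (by fun_prop)
    (HasCompactSupport.intro hu.hasCompactSupport fun x hx => by simp [hu.eq_zero hx])

lemma integrable_norm_gradient_sq (hu : IsTestFunction Ω u) :
    Integrable fun x => ‖gradient u x‖ ^ 2 :=
  have hc := hu.continuous_gradient
  Continuous.integrable_of_hasCompactSupport (by fun_prop)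
    (HasCompactSupport.intro hu.hasCompactSupport fun x hx => by simp [hu.gradient_eq_zero hx])

lemma setIntegral_mul_sq (hu : IsTestFunction Ω u) (f : E N → ℝ) :
    ∫ x in Ω, f x * u x ^ 2 = ∫ x, f x * u x ^ 2 :=
  setIntegral_eq_integral_of_forall_compl_eq_zero fun x hx => by simp [hu.eq_zero_of_notMem hx]

lemma setIntegral_sq (hu : IsTestFunction Ω u) : ∫ x in Ω, u x ^ 2 = ∫ x, u x ^ 2 :=
  setIntegral_eq_integral_of_forall_compl_eq_zero fun x hx => by simp [hu.eq_zero_of_notMem hx]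

lemma setIntegral_norm_gradient_sq (hu : IsTestFunction Ω u) :
    ∫ x in Ω, ‖gradient u x‖ ^ 2 = ∫ x, ‖gradient u x‖ ^ 2 :=
  setIntegral_eq_integral_of_forall_compl_eq_zero fun x hx => by
    simp [hu.gradient_eq_zero_of_notMem hx]

end IsTestFunction

/-! ### The vector field identity and Poincaré's inequality -/

lemma contDiffOn_continuousOn_divergence {Ω : Set (E N)} (hΩ : IsOpen Ω) {F : E N → E N}
    (hF : ContDiffOn ℝ 1 F Ω) : ContinuousOn (divergence F) Ω := by
  have h : ContinuousOn (fderiv ℝ F) Ω := hF.continuousOn_fderiv_of_isOpen hΩ le_rfl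
  have : divergence F = fun x => ∑ i, ⟪EuclideanSpace.basisFun (Fin N) ℝ i,
      fderiv ℝ F x (EuclideanSpace.basisFun (Fin N) ℝ i)⟫ := by
    ext x; exact trace_eq_sum_inner _
  rw [this]
  exact continuousOn_finsetSum _ fun i _ => continuousOn_const.inner (h.clm_apply continuousOn_const)

/-- The vector field identity behind Hardy type inequalities. -/
lemma integral_norm_gradient_sub_smul_sq {Ω : Set (E N)} (hΩ : IsOpen Ω) {u : E N → ℝ}
    (hu : IsTestFunction Ω u) {F : E N → E N} (hF : ContDiffOn ℝ 1 F Ω) :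
    ∫ x, ‖gradient u x - u x • F x‖ ^ 2 =
      (∫ x, ‖gradient u x‖ ^ 2) + ∫ x, (divergence F x + ‖F x‖ ^ 2) * u x ^ 2 := by
  -- F is controlled only on Ω, but u²F extends by zero to a compactly supported C¹ field. Its
  -- divergence 2u⟨∇u, F⟩ + u² div F integrates to zero, which evaluates the cross term of the
  -- square.
  have hX1 : ContDiff ℝ 1 fun x => u x ^ 2 • F x := by
    refine contDiff_iff_contDiffAt.2 fun x => ?_
    by_cases hx : x ∈ tsupport u
    · exact ((hu.contDiff.of_le (by simp)).pow 2).contDiffAt.smul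
        (hF.contDiffAt (hΩ.mem_nhds (hu.tsupport_subset hx)))
    · have : (fun x => u x ^ 2 • F x) =ᶠ[𝓝 x] fun _ => 0 := by
        filter_upwards [(isClosed_tsupport u).isOpen_compl.mem_nhds hx] with y hy
        simp [hu.eq_zero hy]
      exact contDiffAt_const.congr_of_eventuallyEq this
  have hXc : HasCompactSupport fun x => u x ^ 2 • F x :=
    HasCompactSupport.intro hu.hasCompactSupport fun x hx => by simp [hu.eq_zero hx]
  have hdiv : ∀ x, divergence (fun x => u x ^ 2 • F x) x
      = 2 * u x * ⟪gradient u x, F x⟫ + divergence F x * u x ^ 2 := by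
    intro x
    by_cases hx : x ∈ Ω
    · have hFx : HasFDerivAt F (fderiv ℝ F x) x :=
        ((hF.contDiffAt (hΩ.mem_nhds hx)).differentiableAt one_ne_zero).hasFDerivAt
      have h := ((hu.differentiable x).hasFDerivAt.pow 2).fun_smul hFx
      have h2 : fderiv ℝ u x = innerSL ℝ (gradient u x) := by
        ext v; simp
      rw [divergence, h.fderiv, h2, divergence]
      have : (((2 • u x ^ (2 - 1)) • innerSL ℝ (gradient u x)).smulRight (F x) : E N →L[ℝ] E N)
          = (2 * u x) • (innerSL ℝ (gradient u x)).smulRight (F x) := by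
        ext v; simp [mul_smul]
      rw [this]
      simp only [ContinuousLinearMap.toLinearMap_add, ContinuousLinearMap.toLinearMap_smul, map_add, map_smul,
        trace_smulRight_innerSL, smul_eq_mul]
      ring
    · have : (fun x => u x ^ 2 • F x) =ᶠ[𝓝 x] fun _ => 0 := by
        have hx' : x ∉ tsupport u := fun h => hx (hu.tsupport_subset h)
        filter_upwards [(isClosed_tsupport u).isOpen_compl.mem_nhds hx'] with y hy
        simp [hu.eq_zero hy]
      rw [divergence, this.fderiv_eq]
      simp [hu.eq_zero_of_notMem hx]
  have h0 := integral_divergence_eq_zero hX1 hXc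
  have hFc := hF.continuousOn
  have hi1 : Integrable fun x => 2 * u x * ⟪gradient u x, F x⟫ :=
    hu.integrable_of_continuousOn hΩ ((continuousOn_const.mul hu.contDiff.continuous.continuousOn).mul
      (hu.continuous_gradient.continuousOn.inner hFc)) fun x hx => by simp [hu.eq_zero hx]
  have hi2 := hu.integrable_mul_sq hΩ (contDiffOn_continuousOn_divergence hΩ hF)
  have hi3 := hu.integrable_mul_sq hΩ (f := fun x => ‖F x‖ ^ 2) (hFc.norm.pow 2)
  simp only [hdiv] at h0
  rw [integral_add hi1 hi2] at h0
  have e1 : ∀ x, ‖gradient u x - u x • F x‖ ^ 2 =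
      ‖gradient u x‖ ^ 2 - 2 * u x * ⟪gradient u x, F x⟫ + ‖F x‖ ^ 2 * u x ^ 2 := by
    intro x
    rw [norm_sub_sq_real, real_inner_smul_right, norm_smul, mul_pow, Real.norm_eq_abs, sq_abs]
    ring
  simp only [e1, add_mul]
  rw [integral_add (by exact hu.integrable_norm_gradient_sq.sub hi1) hi3,
    integral_sub hu.integrable_norm_gradient_sq hi1, integral_add hi2 hi3]
  linarith

/-- A lower bound for `-div F - |F|²` gives a Hardy type inequality. -/
lemma integral_mul_sq_le_of_divergence {Ω : Set (E N)} (hΩ : IsOpen Ω) {u : E N → ℝ}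
    (hu : IsTestFunction Ω u) {F : E N → E N} (hF : ContDiffOn ℝ 1 F Ω) {W : E N → ℝ}
    (hWc : ContinuousOn W Ω) (hW : ∀ x ∈ Ω, W x ≤ -(divergence F x + ‖F x‖ ^ 2)) :
    ∫ x, W x * u x ^ 2 ≤ ∫ x, ‖gradient u x‖ ^ 2 := by
  have h := integral_norm_gradient_sub_smul_sq hΩ hu hF
  have h1 : 0 ≤ ∫ x, ‖gradient u x - u x • F x‖ ^ 2 := integral_nonneg fun x => by positivity
  have hc := (contDiffOn_continuousOn_divergence hΩ hF).add (hF.continuousOn.norm.pow 2)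
  have h2 : ∫ x, W x * u x ^ 2 ≤ ∫ x, -((divergence F x + ‖F x‖ ^ 2) * u x ^ 2) := by
    refine integral_mono (hu.integrable_mul_sq hΩ hWc) (hu.integrable_mul_sq hΩ hc).neg fun x => ?_
    by_cases hx : x ∈ Ω
    · have := mul_le_mul_of_nonneg_right (hW x hx) (sq_nonneg (u x))
      linarith
    · simp [hu.eq_zero_of_notMem hx]
  rw [integral_neg] at h2
  linarith

lemma divergence_smul_id (c : ℝ) (x : E N) : divergence (fun x : E N => c • x) x = c * N := by
  have : HasFDerivAt (fun x : E N => c • x) (c • ContinuousLinearMap.id ℝ (E N)) x :=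
    (hasFDerivAt_id x).const_smul c
  rw [divergence, this.fderiv, ContinuousLinearMap.toLinearMap_smul, map_smul, trace_id, smul_eq_mul]

/-- The Poincaré inequality for test functions on a bounded set. -/
lemma poincare (hN : 2 ≤ N) {Ω : Set (E N)} {R : ℝ} (hR : 0 < R)
    (hΩR : ∀ x ∈ Ω, ‖x‖ ≤ R) {u : E N → ℝ} (hu : IsTestFunction Ω u) :
    ∫ x, u x ^ 2 ≤ R ^ 2 * ∫ x, ‖gradient u x‖ ^ 2 := by
  have hu' : IsTestFunction Set.univ u := hu.mono (Set.subset_univ _)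
  -- For F = -x/R², div F + |F|² = -N/R² + |x|²/R⁴ ≤ (1 - N)/R² on Ω, and N ≥ 2 makes this at most
  -- -1/R².
  have h := integral_norm_gradient_sub_smul_sq isOpen_univ hu'
    (F := fun x => (-(R ^ 2)⁻¹) • x) (by fun_prop)
  have h1 : 0 ≤ ∫ x, ‖gradient u x - u x • ((-(R ^ 2)⁻¹) • x)‖ ^ 2 :=
    integral_nonneg fun x => by positivity
  have h2 : ∫ x, (divergence (fun x : E N => (-(R ^ 2)⁻¹) • x) x + ‖(-(R ^ 2)⁻¹) • x‖ ^ 2) * u x ^ 2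
      ≤ ∫ x, (-(R ^ 2)⁻¹) * u x ^ 2 := by
    refine integral_mono (hu'.integrable_mul_sq isOpen_univ ?_) (hu.integrable_sq.const_mul _)
      fun x => ?_
    · simp only [divergence_smul_id]; fun_prop
    · by_cases hx : x ∈ Ω
      · refine mul_le_mul_of_nonneg_right ?_ (sq_nonneg _)
        rw [divergence_smul_id, norm_smul, mul_pow, norm_neg, Real.norm_eq_abs, sq_abs]
        have h3 : ‖x‖ ^ 2 ≤ R ^ 2 := by gcongr; exact hΩR x hx
        have h4 : (R ^ 2)⁻¹ ^ 2 * ‖x‖ ^ 2 ≤ (R ^ 2)⁻¹ ^ 2 * R ^ 2 := by gcongr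
        have h5 : (R ^ 2)⁻¹ ^ 2 * R ^ 2 = (R ^ 2)⁻¹ := by field_simp
        have h6 : (2 : ℝ) ≤ N := by exact_mod_cast hN
        have h7 : 0 < (R ^ 2)⁻¹ := by positivity
        nlinarith
      · simp [hu.eq_zero_of_notMem hx]
  rw [integral_const_mul] at h2
  have h3 : (R ^ 2)⁻¹ * ∫ x, u x ^ 2 ≤ ∫ x, ‖gradient u x‖ ^ 2 := by linarith
  rwa [inv_mul_le_iff₀ (by positivity)] at h3

/-! ### Translation estimates and Rellich's theorem -/

/-- Cauchy–Schwarz on [0, 1], read off from the nonnegative variance ∫(f - c)². -/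
lemma sq_intervalIntegral_le {f : ℝ → ℝ} (hf : Continuous f) :
    (∫ t in (0 : ℝ)..1, f t) ^ 2 ≤ ∫ t in (0 : ℝ)..1, f t ^ 2 := by
  set c := ∫ t in (0 : ℝ)..1, f t with hc
  have h : 0 ≤ ∫ t in (0 : ℝ)..1, (f t - c) ^ 2 :=
    intervalIntegral.integral_nonneg zero_le_one fun t _ => sq_nonneg _
  have e : ∀ t, (f t - c) ^ 2 = f t ^ 2 - (2 * c) * f t + c ^ 2 := fun t => by ring
  simp only [e] at h
  rw [intervalIntegral.integral_add (Continuous.intervalIntegrable (by fun_prop) _ _)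
      (Continuous.intervalIntegrable (by fun_prop) _ _),
    intervalIntegral.integral_sub (Continuous.intervalIntegrable (by fun_prop) _ _)
      (Continuous.intervalIntegrable (by fun_prop) _ _),
    intervalIntegral.integral_const_mul, ← hc] at h
  simp at h
  nlinarith

/-- The fundamental theorem of calculus along the segment from x to x + h, followed by
Cauchy–Schwarz. -/
lemma sq_sub_le_integral_gradient {Ω : Set (E N)} {u : E N → ℝ} (hu : IsTestFunction Ω u)
    (x h : E N) :
    (u (x + h) - u x) ^ 2 ≤ ∫ t in Set.Icc (0 : ℝ) 1, ‖h‖ ^ 2 * ‖gradient u (x + t • h)‖ ^ 2 := by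
  have hg := hu.continuous_gradient
  have hd : ∀ t : ℝ, HasDerivAt (fun t : ℝ => u (x + t • h)) ⟪gradient u (x + t • h), h⟫ t := by
    intro t
    have h1 : HasDerivAt (fun t : ℝ => x + t • h) h t := by
      simpa using ((hasDerivAt_id t).smul_const h).const_add x
    have h2 := (hu.differentiable (x + t • h)).hasFDerivAt.comp_hasDerivAt t h1
    rw [inner_gradient]; exact h2
  have hc : Continuous fun t : ℝ => ⟪gradient u (x + t • h), h⟫ := by fun_prop
  have hi := intervalIntegral.integral_eq_sub_of_hasDerivAt (a := 0) (b := 1)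
    (fun t _ => hd t) (hc.intervalIntegrable _ _)
  simp only [one_smul, zero_smul, add_zero] at hi
  rw [← hi]
  refine (sq_intervalIntegral_le hc).trans ?_
  rw [integral_Icc_eq_integral_Ioc, ← intervalIntegral.integral_of_le zero_le_one]
  refine intervalIntegral.integral_mono_on zero_le_one
    (Continuous.intervalIntegrable (by fun_prop) _ _)
    (Continuous.intervalIntegrable (by fun_prop) _ _) fun t _ => ?_
  rw [← mul_pow, ← sq_abs]
  gcongr
  rw [mul_comm]
  exact abs_real_inner_le_norm _ _

/-- Translations move a test function in `L²` by at most `|h| ‖∇u‖`. -/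
lemma lintegral_sq_translate_sub_le {Ω : Set (E N)} {u : E N → ℝ} (hu : IsTestFunction Ω u)
    (h : E N) :
    ∫⁻ x, ENNReal.ofReal ((u (x + h) - u x) ^ 2) ≤
      ENNReal.ofReal (‖h‖ ^ 2 * ∫ x, ‖gradient u x‖ ^ 2) := by
  have hg := hu.continuous_gradient
  -- With lower integrals Tonelli swaps segment and space without integrability on the product;
  -- translation invariance then removes the shift t h.
  calc ∫⁻ x, ENNReal.ofReal ((u (x + h) - u x) ^ 2)
      ≤ ∫⁻ x, ∫⁻ t in Set.Icc (0 : ℝ) 1,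
          ENNReal.ofReal (‖h‖ ^ 2 * ‖gradient u (x + t • h)‖ ^ 2) := by
        refine lintegral_mono fun x => ?_
        rw [← ofReal_integral_eq_lintegral_ofReal]
        · exact ENNReal.ofReal_le_ofReal (sq_sub_le_integral_gradient hu x h)
        · exact Continuous.integrableOn_Icc (by fun_prop)
        · exact Eventually.of_forall fun t => by positivity
    _ = ∫⁻ t in Set.Icc (0 : ℝ) 1, ∫⁻ x,
          ENNReal.ofReal (‖h‖ ^ 2 * ‖gradient u (x + t • h)‖ ^ 2) := by
        refine lintegral_lintegral_swap ?_
        refine Measurable.aemeasurable (Continuous.measurable (ENNReal.continuous_ofReal.comp ?_))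
        fun_prop
    _ = ∫⁻ t in Set.Icc (0 : ℝ) 1, ENNReal.ofReal (‖h‖ ^ 2 * ∫ x, ‖gradient u x‖ ^ 2) := by
        refine lintegral_congr fun t => ?_
        rw [lintegral_add_right_eq_self
          (fun x => ENNReal.ofReal (‖h‖ ^ 2 * ‖gradient u x‖ ^ 2)) (t • h),
          ← ofReal_integral_eq_lintegral_ofReal (hu.integrable_norm_gradient_sq.const_mul _)
            (Eventually.of_forall fun t => by positivity), integral_const_mul]
    _ = _ := by simp

/-- The half-open cube of side `ε` at the lattice point `ε k`. -/
def cell (ε : ℝ) (k : Fin N → ℤ) : Set (E N) := {x | ∀ i, ε * k i ≤ x i ∧ x i < ε * (k i + 1)}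

lemma cell_eq_preimage (ε : ℝ) (k : Fin N → ℤ) :
    cell ε k = (WithLp.ofLp : E N → Fin N → ℝ) ⁻¹'
      Set.pi Set.univ fun i => Set.Ico (ε * k i) (ε * (k i + 1)) := by
  ext x; simp [cell, Set.mem_pi]

lemma measurableSet_cell (ε : ℝ) (k : Fin N → ℤ) : MeasurableSet (cell ε k : Set (E N)) := by
  rw [cell_eq_preimage]
  exact (PiLp.volume_preserving_ofLp (Fin N)).measurable
    (MeasurableSet.univ_pi fun i => measurableSet_Ico)

lemma volume_cell {ε : ℝ} (hε : 0 < ε) (k : Fin N → ℤ) :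
    volume (cell ε k : Set (E N)) = ENNReal.ofReal (ε ^ N) := by
  rw [cell_eq_preimage, (PiLp.volume_preserving_ofLp (Fin N)).measure_preimage
    (MeasurableSet.univ_pi fun i => measurableSet_Ico).nullMeasurableSet, Real.volume_pi_Ico]
  have : ∀ i, ε * ((k i : ℝ) + 1) - ε * k i = ε := fun i => by ring
  simp [this, ENNReal.ofReal_pow hε.le]

lemma mem_cell_floor {ε : ℝ} (hε : 0 < ε) (x : E N) : x ∈ cell ε fun i => ⌊x i / ε⌋ := by
  intro i
  have h1 := Int.floor_le (x i / ε)
  have h2 := Int.lt_floor_add_one (x i / ε)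
  rw [le_div_iff₀ hε] at h1
  rw [div_lt_iff₀ hε] at h2
  constructor <;> linarith

lemma eq_floor_of_mem_cell {ε : ℝ} (hε : 0 < ε) {x : E N} {k : Fin N → ℤ} (hx : x ∈ cell ε k) :
    k = fun i => ⌊x i / ε⌋ := by
  ext i
  symm
  rw [Int.floor_eq_iff, le_div_iff₀ hε, div_lt_iff₀ hε]
  have := hx i
  constructor <;> linarith

lemma pairwise_disjoint_cell {ε : ℝ} (hε : 0 < ε) :
    Pairwise (Function.onFun Disjoint (cell ε : (Fin N → ℤ) → Set (E N))) := by
  intro k l hkl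
  refine Set.disjoint_left.2 fun x hk hl => hkl ?_
  rw [eq_floor_of_mem_cell hε hk, eq_floor_of_mem_cell hε hl]

/-- The closed cube of side `2 ε` centred at the origin. -/
def centeredCube (N : ℕ) (ε : ℝ) : Set (E N) := {h | ∀ i, -ε ≤ h i ∧ h i ≤ ε}

lemma centeredCube_eq_preimage (ε : ℝ) :
    centeredCube N ε = (WithLp.ofLp : E N → Fin N → ℝ) ⁻¹'
      Set.pi Set.univ fun _ => Set.Icc (-ε) ε := by
  ext x; simp [centeredCube, Pi.le_def, forall_and]

lemma measurableSet_centeredCube (ε : ℝ) : MeasurableSet (centeredCube N ε) := by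
  rw [centeredCube_eq_preimage]
  exact (PiLp.volume_preserving_ofLp (Fin N)).measurable
    (MeasurableSet.univ_pi fun i => measurableSet_Icc)

lemma volume_centeredCube {ε : ℝ} (hε : 0 < ε) :
    volume (centeredCube N ε) = ENNReal.ofReal ((2 * ε) ^ N) := by
  rw [centeredCube_eq_preimage, (PiLp.volume_preserving_ofLp (Fin N)).measure_preimage
    (MeasurableSet.univ_pi fun i => measurableSet_Icc).nullMeasurableSet, volume_pi_pi]
  have : ε - -ε = 2 * ε := by ring
  simp [this, ENNReal.ofReal_pow (show 0 ≤ 2 * ε by positivity)]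

lemma norm_sq_le_of_mem_centeredCube {ε : ℝ} {h : E N} (hh : h ∈ centeredCube N ε) :
    ‖h‖ ^ 2 ≤ N * ε ^ 2 := by
  rw [EuclideanSpace.norm_sq_eq]
  calc ∑ i, ‖h i‖ ^ 2 ≤ ∑ _i : Fin N, ε ^ 2 := by
        refine Finset.sum_le_sum fun i _ => ?_
        rw [Real.norm_eq_abs]
        gcongr
        exact abs_le.2 (hh i)
    _ = N * ε ^ 2 := by simp

/-- Expanding the square, the double integral equals 2m∫w² - 2(∫w)²; the bound follows from (∫w)² ≤
m∫w², giving away a factor 2 in the last term. -/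
lemma setIntegral_sq_le_of_mean {Q : Set (E N)} {m : ℝ} (hm : 0 < m)
    (hvol : volume Q = ENNReal.ofReal m) {w : E N → ℝ} (hw : Integrable w)
    (hw2 : Integrable fun x => w x ^ 2) :
    ∫ x in Q, w x ^ 2 ≤ m⁻¹ * (∫ x in Q, w x) ^ 2 +
      m⁻¹ * ∫ x in Q, ∫ y in Q, (w y - w x) ^ 2 := by
  have hfin : IsFiniteMeasure (volume.restrict Q) := ⟨by simp [hvol]⟩
  have hr : (volume.restrict Q).real Set.univ = m := by
    simp [Measure.real, hvol, hm.le]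
  set A := ∫ x in Q, w x
  set B := ∫ x in Q, w x ^ 2
  have hw' := hw.integrableOn (s := Q)
  have hw2' := hw2.integrableOn (s := Q)
  have e : ∀ x, ∫ y in Q, (w y - w x) ^ 2 = B - 2 * A * w x + m * w x ^ 2 := by
    intro x
    have : ∀ y, (w y - w x) ^ 2 = w y ^ 2 - (2 * w x) * w y + w x ^ 2 := fun y => by ring
    simp only [this]
    rw [integral_add (by exact hw2'.sub (hw'.const_mul _)) (integrable_const _),
      integral_sub hw2' (by exact hw'.const_mul _), integral_const_mul, integral_const, hr]
    simp only [smul_eq_mul]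
    ring
  simp only [e]
  rw [integral_add (by exact (integrable_const _).sub (hw'.const_mul _)) (by exact hw2'.const_mul _),
    integral_sub (integrable_const _) (by exact hw'.const_mul _), integral_const_mul,
    integral_const_mul, integral_const, hr]
  have hB : 0 ≤ B := integral_nonneg fun x => sq_nonneg _
  have hAB : A ^ 2 ≤ m * B := by
    have h : 0 ≤ ∫ y in Q, (m * w y - A) ^ 2 := integral_nonneg fun x => sq_nonneg _
    have : ∀ y, (m * w y - A) ^ 2 = m ^ 2 * w y ^ 2 - (2 * m * A) * w y + A ^ 2 := fun y => by ring
    simp only [this] at h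
    rw [integral_add (by exact (hw2'.const_mul _).sub (hw'.const_mul _)) (integrable_const _),
      integral_sub (by exact hw2'.const_mul _) (by exact hw'.const_mul _), integral_const_mul,
      integral_const_mul, integral_const, hr] at h
    simp only [smul_eq_mul] at h
    change 0 ≤ m ^ 2 * B - 2 * m * A * A + m * A ^ 2 at h
    have : 0 ≤ m * (m * B - A ^ 2) := by nlinarith
    nlinarith [(mul_nonneg_iff_of_pos_left hm).1 this]
  change B ≤ m⁻¹ * A ^ 2 + m⁻¹ * (m • B - 2 * A * A + m * B)
  rw [← mul_add, ← div_eq_inv_mul, le_div_iff₀ hm]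
  simp only [smul_eq_mul]
  nlinarith

/-- No integrability is required: the Bochner integral of a non-integrable function is 0. -/
lemma ofReal_integral_le_lintegral {α : Type*} [MeasurableSpace α] {μ : Measure α} {f : α → ℝ}
    (hf : ∀ x, 0 ≤ f x) : ENNReal.ofReal (∫ x, f x ∂μ) ≤ ∫⁻ x, ENNReal.ofReal (f x) ∂μ := by
  have h := enorm_integral_le_lintegral_enorm (μ := μ) f
  rw [Real.enorm_of_nonneg (integral_nonneg hf)] at h
  exact h.trans_eq (lintegral_congr fun x => Real.enorm_of_nonneg (hf x))

/-- Two points of one cell differ by a vector of `centeredCube`. Substituting y = x + h and letting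
h range over that whole cube gives a domain independent of the cell, so the bounds can be summed
over cells and the translation estimate applied for each fixed h. -/
lemma ofReal_setIntegral_cell_le {ε : ℝ} (hε : 0 < ε) (k : Fin N → ℤ)
    {Ω : Set (E N)} {w : E N → ℝ} (hw : IsTestFunction Ω w) :
    ENNReal.ofReal (∫ x in cell ε k, w x ^ 2) ≤
      ENNReal.ofReal ((ε ^ N)⁻¹ * (∫ x in cell ε k, w x) ^ 2) + ENNReal.ofReal ((ε ^ N)⁻¹) *
        ∫⁻ x in cell ε k, ∫⁻ h in centeredCube N ε, ENNReal.ofReal ((w (x + h) - w x) ^ 2) := by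
  have hc := hw.contDiff.continuous
  have hwi : Integrable w := hc.integrable_of_hasCompactSupport hw.hasCompactSupport
  have hfin : IsFiniteMeasure (volume.restrict (cell ε k : Set (E N))) :=
    ⟨by simp [volume_cell hε]⟩
  refine (ENNReal.ofReal_le_ofReal (setIntegral_sq_le_of_mean (by positivity) (volume_cell hε k)
    hwi hw.integrable_sq)).trans ?_
  rw [ENNReal.ofReal_add (by positivity) (by positivity)]
  gcongr
  rw [ENNReal.ofReal_mul (by positivity)]
  gcongr
  refine (ofReal_integral_le_lintegral fun x => by positivity).trans ?_
  refine setLIntegral_mono' (measurableSet_cell ε k) fun x hx => ?_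
  refine (ofReal_integral_le_lintegral fun y => sq_nonneg _).trans ?_
  rw [← lintegral_indicator (measurableSet_cell ε k),
    ← lintegral_indicator (measurableSet_centeredCube ε),
    ← lintegral_add_left_eq_self _ x]
  refine lintegral_mono fun h => ?_
  by_cases hh : x + h ∈ cell ε k
  · have h' : h ∈ centeredCube N ε := fun i => by
      have h1 := hx i
      have h2 := hh i
      simp only [PiLp.add_apply] at h2
      constructor <;> linarith
    simp [hh, h']
  · simp [hh]

/-- A Poincaré inequality modulo the means over the finitely many cells that meet the domain. -/
lemma exists_integral_sq_le_sum_cell {Ω : Set (E N)} (hΩ : Bornology.IsBounded Ω)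
    {ε : ℝ} (hε : 0 < ε) : ∃ S : Finset (Fin N → ℤ), ∀ w : E N → ℝ, IsTestFunction Ω w →
      ∫ x, w x ^ 2 ≤ (∑ k ∈ S, (ε ^ N)⁻¹ * (∫ x in cell ε k, w x) ^ 2) +
        2 ^ N * N * ε ^ 2 * ∫ x, ‖gradient w x‖ ^ 2 := by
  obtain ⟨R, hR⟩ := hΩ.exists_norm_le
  -- On Ω each |x_i| is at most R, so the lattice coordinates ⌊x_i/ε⌋ lie in [-M, M]: finitely many
  -- cells cover Ω.
  obtain ⟨M, hM⟩ := exists_nat_gt (R / ε + 1)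
  refine ⟨Fintype.piFinset fun _ => Finset.Icc (-(M : ℤ)) M, fun w hw => ?_⟩
  set S : Finset (Fin N → ℤ) := Fintype.piFinset fun _ => Finset.Icc (-(M : ℤ)) M
  have hc := hw.contDiff.continuous
  have hcover : Ω ⊆ ⋃ k ∈ S, cell ε k := by
    intro x hx
    refine Set.mem_biUnion (x := fun i => ⌊x i / ε⌋) ?_ (mem_cell_floor hε x)
    simp only [S, Finset.mem_coe, Fintype.mem_piFinset, Finset.mem_Icc]
    intro i
    have h1 : |x i| ≤ R := (PiLp.norm_apply_le x i).trans (hR x hx)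
    have h2 : |x i / ε| ≤ R / ε := by rw [abs_div, abs_of_pos hε]; gcongr
    rw [abs_le] at h2
    constructor
    · rw [Int.le_floor]; push_cast; linarith
    · have := Int.floor_le (x i / ε)
      exact_mod_cast (show ((⌊x i / ε⌋ : ℤ) : ℝ) ≤ (M : ℝ) by linarith)
  have hdis : Set.PairwiseDisjoint (S : Set (Fin N → ℤ)) (cell ε : _ → Set (E N)) :=
    fun k _ l _ hkl => pairwise_disjoint_cell hε hkl
  have hsum : ∫ x, w x ^ 2 = ∑ k ∈ S, ∫ x in cell ε k, w x ^ 2 := by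
    rw [← integral_biUnion_finset S (fun k _ => measurableSet_cell ε k) hdis
      fun k _ => hw.integrable_sq.integrableOn]
    refine (setIntegral_eq_integral_of_forall_compl_eq_zero fun x hx => ?_).symm
    simp [hw.eq_zero_of_notMem fun h => hx (hcover h)]
  set D := ∫ x, ‖gradient w x‖ ^ 2
  have hD : 0 ≤ D := integral_nonneg fun x => by positivity
  -- Each shift h in the cube costs at most |h|²D ≤ Nε²D, and the cube has volume (2ε)^N. Division
  -- by the cell volume ε^N later leaves 2^N N ε² D.
  have hκ : ∫⁻ x, ∫⁻ h in centeredCube N ε, ENNReal.ofReal ((w (x + h) - w x) ^ 2) ≤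
      ENNReal.ofReal (N * ε ^ 2 * D * (2 * ε) ^ N) := by
    rw [lintegral_lintegral_swap]
    · calc _ ≤ ∫⁻ h in centeredCube N ε, ENNReal.ofReal (N * ε ^ 2 * D) := by
            refine setLIntegral_mono' (measurableSet_centeredCube ε) fun h hh => ?_
            refine (lintegral_sq_translate_sub_le hw h).trans (ENNReal.ofReal_le_ofReal ?_)
            gcongr
            exact norm_sq_le_of_mem_centeredCube hh
        _ = _ := by
            rw [setLIntegral_const, volume_centeredCube hε, ← ENNReal.ofReal_mul (by positivity)]
    · refine Measurable.aemeasurable (Continuous.measurable (ENNReal.continuous_ofReal.comp ?_))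
      fun_prop
  have key : ENNReal.ofReal (∫ x, w x ^ 2) ≤ ENNReal.ofReal
      ((∑ k ∈ S, (ε ^ N)⁻¹ * (∫ x in cell ε k, w x) ^ 2) + 2 ^ N * N * ε ^ 2 * D) := by
    rw [hsum, ENNReal.ofReal_sum_of_nonneg fun k _ => integral_nonneg fun x => sq_nonneg _]
    refine (Finset.sum_le_sum fun k _ => ofReal_setIntegral_cell_le hε k hw).trans ?_
    rw [Finset.sum_add_distrib, ENNReal.ofReal_add (Finset.sum_nonneg fun k _ => by positivity)
      (by positivity), ENNReal.ofReal_sum_of_nonneg fun k _ => by positivity, ← Finset.mul_sum,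
      ← lintegral_biUnion_finset hdis fun k _ => measurableSet_cell ε k]
    gcongr
    calc _ ≤ ENNReal.ofReal ((ε ^ N)⁻¹) * ENNReal.ofReal (N * ε ^ 2 * D * (2 * ε) ^ N) := by
          gcongr
          exact (setLIntegral_le_lintegral _ _).trans hκ
      _ = _ := by
          rw [← ENNReal.ofReal_mul (by positivity)]
          congr 1
          rw [mul_pow]
          field_simp
  exact (ENNReal.ofReal_le_ofReal_iff (add_nonneg (Finset.sum_nonneg fun k _ => by positivity)
    (by positivity))).1 key

/-- Rellich's theorem: a sequence of test functions that is bounded in `H¹` has a subsequence that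
is Cauchy in `L²`. -/
lemma exists_subseq_cauchy {Ω : Set (E N)} (hΩ : Bornology.IsBounded Ω) {φ : ℕ → E N → ℝ}
    (hφ : ∀ k, IsTestFunction Ω (φ k)) {A : ℝ} (h0 : ∀ k, ∫ x, φ k x ^ 2 ≤ A)
    (h1 : ∀ k, ∫ x, ‖gradient (φ k) x‖ ^ 2 ≤ A) :
    ∃ s : ℕ → ℕ, StrictMono s ∧ ∀ ε : ℝ, 0 < ε → ∀ᶠ p : ℕ × ℕ in atTop,
      ∫ x, (φ (s p.1) x - φ (s p.2) x) ^ 2 < ε := by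
  have h_int : ∀ k, Integrable (φ k) := fun k =>
    (hφ k).contDiff.continuous.integrable_of_hasCompactSupport (hφ k).hasCompactSupport
  let e : ℕ → ℝ := fun j => 1 / ((j : ℝ) + 1)
  have he : ∀ j, 0 < e j := fun j => by positivity
  -- The cell integrals at all scales 1/(j + 1) are recorded together. They lie in a countable
  -- product of compact intervals, so one subsequence makes all of them converge and no diagonal
  -- argument is needed.
  let l : ℕ → ℕ × (Fin N → ℤ) → ℝ := fun k q => ∫ x in cell (e q.1) q.2, φ k x
  have hbd : ∀ k q, l k q ∈ Set.Icc (-(e q.1 ^ N + A)) (e q.1 ^ N + A) := by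
    intro k q
    rw [Set.mem_Icc, ← abs_le]
    have hfin : IsFiniteMeasure (volume.restrict (cell (e q.1) q.2 : Set (E N))) :=
      ⟨by simp [volume_cell (he q.1)]⟩
    have hi2 := (hφ k).integrable_sq
    calc |l k q| ≤ ∫ x in cell (e q.1) q.2, |φ k x| := abs_integral_le_integral_abs
      _ ≤ ∫ x in cell (e q.1) q.2, (1 + φ k x ^ 2) := by
          refine integral_mono (h_int k).abs.integrableOn
            ((integrable_const _).add hi2.integrableOn) fun x => ?_
          simp only
          nlinarith [sq_nonneg (|φ k x| - 1), sq_abs (φ k x), abs_nonneg (φ k x)]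
      _ = e q.1 ^ N + ∫ x in cell (e q.1) q.2, φ k x ^ 2 := by
          rw [integral_add (integrable_const _) hi2.integrableOn, integral_const]
          simp [Measure.real, volume_cell (he q.1), (pow_pos (he q.1) N).le]
      _ ≤ e q.1 ^ N + A := by
          gcongr
          exact (setIntegral_le_integral hi2 (Eventually.of_forall fun x => sq_nonneg _)).trans (h0 k)
  obtain ⟨L, -, s, hs, hL⟩ := (isCompact_univ_pi fun q : ℕ × (Fin N → ℤ) =>
    isCompact_Icc (a := -(e q.1 ^ N + A)) (b := e q.1 ^ N + A)).isSeqCompact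
      (x := l) fun k q _ => hbd k q
  refine ⟨s, hs, fun ε hε => ?_⟩
  have hA : 0 ≤ A := (integral_nonneg fun x => by positivity).trans (h1 0)
  -- The scale is fixed so that the gradient term stays below ε/2, where 4A bounds the Dirichlet
  -- integral of a difference; what remains is a finite sum of convergent cell integrals.
  obtain ⟨j, hj⟩ : ∃ j, 2 ^ N * N * e j ^ 2 * (4 * A) < ε / 2 := by
    have h := tendsto_one_div_add_atTop_nhds_zero_nat (𝕜 := ℝ)
    have h2 : Tendsto (fun j : ℕ => 2 ^ N * N * e j ^ 2 * (4 * A)) atTop (𝓝 0) := by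
      simpa [e] using ((h.pow 2).const_mul (2 ^ N * (N : ℝ))).mul_const (4 * A)
    exact (h2.eventually (gt_mem_nhds (half_pos hε))).exists
  obtain ⟨S, hS⟩ := exists_integral_sq_le_sum_cell hΩ (he j)
  have hlim : Tendsto (fun p : ℕ × ℕ => ∑ k ∈ S, (e j ^ N)⁻¹ *
      (l (s p.1) (j, k) - l (s p.2) (j, k)) ^ 2) atTop (𝓝 0) := by
    rw [← prod_atTop_atTop_eq]
    have : ∀ k, Tendsto (fun p : ℕ × ℕ => (e j ^ N)⁻¹ *
        (l (s p.1) (j, k) - l (s p.2) (j, k)) ^ 2) (atTop ×ˢ atTop) (𝓝 0) := by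
      intro k
      have hk : Tendsto (fun i => l (s i) (j, k)) atTop (𝓝 (L (j, k))) :=
        (tendsto_pi_nhds.1 hL) (j, k)
      simpa using (((hk.comp tendsto_fst).sub (hk.comp tendsto_snd)).pow 2).const_mul (e j ^ N)⁻¹
    simpa using tendsto_finsetSum S fun k _ => this k
  filter_upwards [hlim.eventually (gt_mem_nhds (half_pos hε))] with p hp
  refine (hS _ ((hφ _).sub (hφ _))).trans_lt ?_
  have hgrad : ∫ x, ‖gradient (fun x => φ (s p.1) x - φ (s p.2) x) x‖ ^ 2 ≤ 4 * A := by
    have h2 : ∫ x, ‖gradient (fun x => φ (s p.1) x - φ (s p.2) x) x‖ ^ 2 ≤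
        ∫ x, (2 * ‖gradient (φ (s p.1)) x‖ ^ 2 + 2 * ‖gradient (φ (s p.2)) x‖ ^ 2) := by
      refine integral_mono ((hφ _).sub (hφ _)).integrable_norm_gradient_sq
        (((hφ _).integrable_norm_gradient_sq.const_mul 2).add
          ((hφ _).integrable_norm_gradient_sq.const_mul 2)) fun x => ?_
      simp only
      rw [(hφ _).gradient_sub (hφ _)]
      have := parallelogram_law_with_norm ℝ (gradient (φ (s p.1)) x) (gradient (φ (s p.2)) x)
      nlinarith [mul_self_nonneg ‖gradient (φ (s p.1)) x + gradient (φ (s p.2)) x‖]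
    rw [integral_add ((hφ _).integrable_norm_gradient_sq.const_mul 2)
      ((hφ _).integrable_norm_gradient_sq.const_mul 2), integral_const_mul, integral_const_mul] at h2
    linarith [h1 (s p.1), h1 (s p.2)]
  have hl : ∀ k, ∫ x in cell (e j) k, (φ (s p.1) x - φ (s p.2) x) =
      l (s p.1) (j, k) - l (s p.2) (j, k) := fun k =>
    integral_sub (h_int _).integrableOn (h_int _).integrableOn
  simp only [hl]
  have : 2 ^ N * N * e j ^ 2 * ∫ x, ‖gradient (fun x => φ (s p.1) x - φ (s p.2) x) x‖ ^ 2 ≤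
      2 ^ N * N * e j ^ 2 * (4 * A) := by gcongr
  linarith

/-! ### Calculus of gradients and divergences -/

lemma fderiv_eq_innerSL_gradient (u : E N → ℝ) (x : E N) :
    fderiv ℝ u x = innerSL ℝ (gradient u x) := by
  ext v; simp

lemma hasGradientAt_iff_innerSL {u : E N → ℝ} {g x : E N} :
    HasGradientAt u g x ↔ HasFDerivAt u (innerSL ℝ g) x := Iff.rfl

lemma _root_.HasGradientAt.comp_real {u : E N → ℝ} {g x : E N} {f : ℝ → ℝ} {f' : ℝ}
    (hf : HasDerivAt f f' (u x)) (hu : HasGradientAt u g x) :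
    HasGradientAt (fun y => f (u y)) (f' • g) x := by
  rw [hasGradientAt_iff_innerSL] at *
  have h := hf.comp_hasFDerivAt x hu
  rw [map_smul]
  exact h

lemma _root_.HasGradientAt.mul_real {u v : E N → ℝ} {g g' x : E N}
    (hu : HasGradientAt u g x) (hv : HasGradientAt v g' x) :
    HasGradientAt (fun y => u y * v y) (u x • g' + v x • g) x := by
  rw [hasGradientAt_iff_innerSL] at *
  rw [map_add, map_smul, map_smul]
  exact hu.mul hv

lemma hasGradientAt_inner_left (ν x : E N) : HasGradientAt (fun y => ⟪ν, y⟫) ν x :=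
  (innerSL ℝ ν).hasFDerivAt

lemma hasGradientAt_norm_sub_sq (a x : E N) :
    HasGradientAt (fun y => ‖y - a‖ ^ 2) ((2 : ℝ) • (x - a)) x := by
  rw [hasGradientAt_iff_innerSL, map_smul]
  have h := ((hasFDerivAt_id x).sub_const a).norm_sq
  refine h.congr_fderiv ?_
  ext v
  simp [two_smul]

lemma divergence_smul {g : E N → ℝ} {F : E N → E N} {g' x : E N}
    (hg : HasGradientAt g g' x) (hF : DifferentiableAt ℝ F x) :
    divergence (fun y => g y • F y) x = ⟪g', F x⟫ + g x * divergence F x := by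
  have h := (hasGradientAt_iff_innerSL.1 hg).fun_smul hF.hasFDerivAt
  rw [divergence, h.fderiv, divergence]
  simp only [ContinuousLinearMap.toLinearMap_add, ContinuousLinearMap.toLinearMap_smul, map_add,
    map_smul, trace_smulRight_innerSL, smul_eq_mul]
  ring

lemma divergence_add {F G : E N → E N} {x : E N} (hF : DifferentiableAt ℝ F x)
    (hG : DifferentiableAt ℝ G x) :
    divergence (fun y => F y + G y) x = divergence F x + divergence G x := by
  rw [divergence, fderiv_fun_add hF hG]
  simp [divergence]

lemma divergence_const_smul {F : E N → E N} {x : E N} (hF : DifferentiableAt ℝ F x) (c : ℝ) :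
    divergence (fun y => c • F y) x = c * divergence F x := by
  rw [divergence, fderiv_fun_const_smul hF]
  simp [divergence]

lemma divergence_sum {ι : Type*} (s : Finset ι) {F : ι → E N → E N} {x : E N}
    (hF : ∀ i ∈ s, DifferentiableAt ℝ (F i) x) :
    divergence (fun y => ∑ i ∈ s, F i y) x = ∑ i ∈ s, divergence (F i) x := by
  rw [divergence, fderiv_fun_sum hF]
  simp [divergence]

lemma divergence_sub_const (a x : E N) : divergence (fun y : E N => y - a) x = N := by
  have h : HasFDerivAt (fun y : E N => y - a) (ContinuousLinearMap.id ℝ (E N)) x :=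
    (hasFDerivAt_id x).sub_const a
  rw [divergence, h.fderiv, trace_id]

/-! ### The fields ∇log|x - a| -/

/-- The gradient of `log |x - a|`. -/
def logGrad (a x : E N) : E N := (‖x - a‖ ^ 2)⁻¹ • (x - a)

lemma norm_sub_sq_pos {a x : E N} (h : x ≠ a) : 0 < ‖x - a‖ ^ 2 := by
  have := norm_pos_iff.2 (sub_ne_zero.2 h)
  positivity

lemma contDiffAt_norm_sub_sq (a x : E N) : ContDiffAt ℝ ∞ (fun y : E N => ‖y - a‖ ^ 2) x :=
  (contDiffAt_id.sub contDiffAt_const).norm_sq ℝ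

lemma contDiffAt_logGrad {a x : E N} (h : x ≠ a) : ContDiffAt ℝ ∞ (logGrad a) x :=
  ((contDiffAt_norm_sub_sq a x).inv (norm_sub_sq_pos h).ne').smul
    (contDiffAt_id.sub contDiffAt_const)

/-- The squared norm is smooth everywhere while the norm is not, so the logarithm is differentiated
in this form. -/
lemma log_norm_eq (x a : E N) : Real.log ‖x - a‖ = 2⁻¹ * Real.log (‖x - a‖ ^ 2) := by
  rw [Real.log_pow]; push_cast; ring

lemma contDiffAt_log_norm {a x : E N} (h : x ≠ a) :
    ContDiffAt ℝ ∞ (fun y => Real.log ‖y - a‖) x := by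
  simp only [log_norm_eq]
  exact contDiffAt_const.mul ((contDiffAt_norm_sub_sq a x).log (norm_sub_sq_pos h).ne')

lemma hasGradientAt_log_norm {a x : E N} (h : x ≠ a) :
    HasGradientAt (fun y => Real.log ‖y - a‖) (logGrad a x) x := by
  simp only [log_norm_eq]
  have h1 := (hasGradientAt_norm_sub_sq a x).comp_real
    ((Real.hasDerivAt_log (norm_sub_sq_pos h).ne').const_mul 2⁻¹)
  convert h1 using 1
  rw [logGrad, smul_smul]
  congr 1
  ring

lemma norm_logGrad_sq {a x : E N} (h : x ≠ a) : ‖logGrad a x‖ ^ 2 = (‖x - a‖ ^ 2)⁻¹ := by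
  have := norm_sub_sq_pos h
  rw [logGrad, norm_smul, mul_pow, Real.norm_eq_abs, sq_abs]
  field_simp

lemma divergence_logGrad {a x : E N} (h : x ≠ a) :
    divergence (logGrad a) x = (N - 2) * (‖x - a‖ ^ 2)⁻¹ := by
  have h0 := norm_sub_sq_pos h
  have h1 : HasGradientAt (fun y => (‖y - a‖ ^ 2)⁻¹)
      (-((‖x - a‖ ^ 2) ^ 2)⁻¹ • (2 : ℝ) • (x - a)) x :=
    (hasGradientAt_norm_sub_sq a x).comp_real (hasDerivAt_inv h0.ne')
  have h2 := divergence_smul h1 (differentiableAt_id.sub_const a)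
  simp only [id] at h2
  change divergence (fun y => (‖y - a‖ ^ 2)⁻¹ • (y - a)) x = _
  rw [h2, divergence_sub_const, real_inner_smul_left, real_inner_smul_left, real_inner_self_eq_norm_sq]
  field_simp
  ring

/-- `logGrad a x` is the inversion of x - a in the unit sphere, and inversion distorts distances by
exactly this factor. Each summand of V is therefore the squared distance of two such fields. -/
lemma norm_logGrad_sub_sq {a b x : E N} (ha : x ≠ a) (hb : x ≠ b) :
    ‖logGrad a x - logGrad b x‖ ^ 2 = ‖a - b‖ ^ 2 / (‖x - a‖ ^ 2 * ‖x - b‖ ^ 2) := by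
  have h1 := norm_pos_iff.2 (sub_ne_zero.2 ha)
  have h2 := norm_pos_iff.2 (sub_ne_zero.2 hb)
  have e : a - b = (x - b) - (x - a) := by abel
  rw [norm_sub_sq_real, norm_logGrad_sq ha, norm_logGrad_sq hb, e, norm_sub_sq_real (x - b),
    logGrad, logGrad, real_inner_smul_left, real_inner_smul_right, real_inner_comm (x - b)]
  field_simp

/-! ### The multipolar potential -/

lemma sum_sum_eq_two_mul {f : Fin n → Fin n → ℝ} (hs : ∀ i j, f i j = f j i)
    (h0 : ∀ i, f i i = 0) :
    ∑ i, ∑ j, f i j = 2 * ∑ i, ∑ j ∈ Finset.Ioi i, f i j := by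
  have h1 : ∀ i, ∑ j, f i j = ∑ j ∈ Finset.Ioi i, f i j + ∑ j ∈ Finset.Iio i, f i j := by
    intro i
    rw [← Finset.sum_union (Finset.disjoint_left.2 fun j hj hj' => by
      simp only [Finset.mem_Ioi, Finset.mem_Iio] at hj hj'; exact absurd hj hj'.not_gt)]
    refine (Finset.sum_subset (Finset.subset_univ _) fun j _ hj => ?_).symm
    simp only [Finset.mem_union, Finset.mem_Ioi, Finset.mem_Iio, not_or, not_lt] at hj
    rw [le_antisymm hj.1 hj.2, h0]
  have h2 : ∑ i, ∑ j ∈ Finset.Iio i, f i j = ∑ i, ∑ j ∈ Finset.Ioi i, f i j := by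
    rw [Finset.sum_comm' (t' := Finset.univ) (s' := fun j => Finset.Ioi j) (by simp)]
    exact Finset.sum_congr rfl fun i _ => Finset.sum_congr rfl fun j _ => hs j i
  simp only [h1, Finset.sum_add_distrib, h2]
  ring

/-- Ordered pairs are easier to sum than pairs with i < j; the diagonal contributes nothing. -/
lemma two_mul_V (a : Fin n → E N) (x : E N) :
    2 * V a x = ∑ i, ∑ j, ‖a i - a j‖ ^ 2 / (‖x - a i‖ ^ 2 * ‖x - a j‖ ^ 2) := by
  rw [sum_sum_eq_two_mul (fun i j => by rw [norm_sub_rev, mul_comm]) (by simp), V]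

lemma V_nonneg (a : Fin n → E N) (x : E N) : 0 ≤ V a x :=
  Finset.sum_nonneg fun i _ => Finset.sum_nonneg fun j _ => by positivity

lemma V_pos (hn : 2 ≤ n) {a : Fin n → E N} (ha : Function.Injective a) {x : E N}
    (hx : ∀ i, x ≠ a i) : 0 < V a x := by
  have h : 0 < 2 * V a x := by
    rw [two_mul_V]
    refine Finset.sum_pos' (fun i _ => Finset.sum_nonneg fun j _ => by positivity)
      ⟨⟨0, by omega⟩, Finset.mem_univ _, ?_⟩
    refine Finset.sum_pos' (fun j _ => by positivity) ⟨⟨1, by omega⟩, Finset.mem_univ _, ?_⟩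
    have h1 : a ⟨0, by omega⟩ ≠ a ⟨1, by omega⟩ := ha.ne (by simp)
    exact div_pos (norm_sub_sq_pos h1) (mul_pos (norm_sub_sq_pos (hx _)) (norm_sub_sq_pos (hx _)))
  linarith

lemma continuousOn_V {a : Fin n → E N} {Ω : Set (E N)} (h : ∀ x ∈ Ω, ∀ i, x ≠ a i) :
    ContinuousOn (V a) Ω := by
  unfold V
  refine continuousOn_finsetSum _ fun i _ => continuousOn_finsetSum _ fun j _ => ?_
  refine ContinuousOn.div (by fun_prop) (by fun_prop) fun x hx => ?_
  exact (mul_pos (norm_sub_sq_pos (h x hx i)) (norm_sub_sq_pos (h x hx j))).ne'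

lemma measurable_V (a : Fin n → E N) : Measurable (V a) := by
  unfold V
  fun_prop

/-- With v_i = `logGrad (a i) x` this is ∑_{i<j}|v_i - v_j|² = n∑|v_i|² - |∑v_i|². The first sum
matches the divergence of ∑v_i and the second term its squared length, which is why a multiple of
∑v_i is the right field for V. -/
lemma V_eq {a : Fin n → E N} {x : E N} (hx : ∀ i, x ≠ a i) :
    V a x = n * ∑ i, (‖x - a i‖ ^ 2)⁻¹ - ‖∑ i, logGrad (a i) x‖ ^ 2 := by
  have h : 2 * V a x = 2 * (n * ∑ i, (‖x - a i‖ ^ 2)⁻¹ - ‖∑ i, logGrad (a i) x‖ ^ 2) := by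
    rw [two_mul_V]
    have e : ∀ i j, ‖a i - a j‖ ^ 2 / (‖x - a i‖ ^ 2 * ‖x - a j‖ ^ 2) =
        (‖x - a i‖ ^ 2)⁻¹ + (‖x - a j‖ ^ 2)⁻¹ - 2 * ⟪logGrad (a i) x, logGrad (a j) x⟫ := by
      intro i j
      rw [← norm_logGrad_sub_sq (hx i) (hx j), norm_sub_sq_real, norm_logGrad_sq (hx i),
        norm_logGrad_sq (hx j)]
      ring
    simp only [e, Finset.sum_sub_distrib, Finset.sum_add_distrib, Finset.sum_const, ← Finset.mul_sum,
      ← inner_sum, ← sum_inner, Finset.card_univ, Fintype.card_fin, nsmul_eq_mul,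
      real_inner_self_eq_norm_sq]
    ring
  linarith

/-- Away from the poles the potential is bounded. -/
lemma exists_V_le (a : Fin n → E N) {r : ℝ} (hr : 0 < r) :
    ∃ C : ℝ, 0 ≤ C ∧ ∀ x, (∀ i, r ≤ ‖x - a i‖) → V a x ≤ C := by
  refine ⟨∑ i, ∑ j ∈ Finset.Ioi i, ‖a i - a j‖ ^ 2 / (r ^ 2 * r ^ 2),
    Finset.sum_nonneg fun i _ => Finset.sum_nonneg fun j _ => by positivity, fun x hx => ?_⟩
  unfold V
  gcongr
  · exact hx _
  · exact hx _

/-- The behaviour of the potential at a pole. -/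
lemma tendsto_V {a : Fin n → E N} (ha : Function.Injective a) (k : Fin n) :
    Tendsto (fun x => ‖x - a k‖ ^ 2 * V a x) (𝓝[≠] (a k)) (𝓝 (n - 1)) := by
  -- In the double sum for 2V, after multiplication by |x - a_k|², only the terms with exactly one
  -- index equal to k survive, each tending to 1; there are 2(n - 1) of them.
  have hterm : ∀ i j, Tendsto (fun x => ‖x - a k‖ ^ 2 *
      (‖a i - a j‖ ^ 2 / (‖x - a i‖ ^ 2 * ‖x - a j‖ ^ 2))) (𝓝[≠] (a k))
      (𝓝 ((if i = k then (if j = k then 0 else 1) else 0) +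
        (if i = k then 0 else if j = k then 1 else 0))) := by
    have hside : ∀ j, j ≠ k → Tendsto (fun x => ‖a k - a j‖ ^ 2 / ‖x - a j‖ ^ 2) (𝓝[≠] (a k))
        (𝓝 1) := by
      intro j hj
      have h0 : ‖a k - a j‖ ^ 2 ≠ 0 := (norm_sub_sq_pos (ha.ne hj.symm)).ne'
      have : ContinuousAt (fun x => ‖a k - a j‖ ^ 2 / ‖x - a j‖ ^ 2) (a k) :=
        ContinuousAt.div (by fun_prop) (by fun_prop) h0
      have h := this.tendsto
      rw [div_self h0] at h
      exact h.mono_left nhdsWithin_le_nhds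
    have hne : ∀ᶠ x in 𝓝[≠] (a k), x ≠ a k := eventually_mem_nhdsWithin
    intro i j
    by_cases hi : i = k
    · subst hi
      by_cases hj : j = i
      · subst hj; simpa using tendsto_const_nhds
      · simp only [hj, if_true, if_false, add_zero]
        refine (hside j hj).congr' ?_
        filter_upwards [hne] with x hx
        have := norm_pos_iff.2 (sub_ne_zero.2 hx)
        field_simp
    · by_cases hj : j = k
      · subst hj
        simp only [hi, if_true, if_false, zero_add]
        refine (hside i hi).congr' ?_
        filter_upwards [hne] with x hx
        have := norm_pos_iff.2 (sub_ne_zero.2 hx)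
        rw [norm_sub_rev (a j)]
        field_simp
      · simp only [hi, hj, if_false, add_zero]
        have h1 := (norm_sub_sq_pos (ha.ne (Ne.symm hi))).ne'
        have h2 := (norm_sub_sq_pos (ha.ne (Ne.symm hj))).ne'
        have : ContinuousAt (fun x => ‖x - a k‖ ^ 2 *
            (‖a i - a j‖ ^ 2 / (‖x - a i‖ ^ 2 * ‖x - a j‖ ^ 2))) (a k) :=
          ContinuousAt.mul (by fun_prop) (ContinuousAt.div (by fun_prop) (by fun_prop)
            (mul_ne_zero h1 h2))
        have h := this.tendsto
        simp only [sub_self, norm_zero, ne_eq, OfNat.ofNat_ne_zero, not_false_eq_true, zero_pow,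
          zero_mul] at h
        exact h.mono_left nhdsWithin_le_nhds
  have hsum := tendsto_finsetSum Finset.univ fun i _ =>
    tendsto_finsetSum (Finset.univ : Finset (Fin n)) fun j _ => hterm i j
  have h2 := hsum.const_mul 2⁻¹
  have e1 : (2⁻¹ : ℝ) * ∑ i : Fin n, ∑ j : Fin n, ((if i = k then (if j = k then (0 : ℝ) else 1) else 0) +
        (if i = k then 0 else if j = k then 1 else 0)) = n - 1 := by
    have hn1 : 1 ≤ n := Nat.one_le_iff_ne_zero.2 (by rintro rfl; exact k.elim0)
    have hfil : ((Finset.univ.filter fun j : Fin n => ¬ j = k).card : ℝ) = n - 1 := by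
      rw [Finset.filter_ne', Finset.card_erase_of_mem (Finset.mem_univ _), Finset.card_univ,
        Fintype.card_fin]
      push_cast [hn1]; ring
    have s1 : ∑ i : Fin n, ∑ j : Fin n, (if i = k then (if j = k then (0 : ℝ) else 1) else 0)
        = n - 1 := by
      have : ∀ i : Fin n, ∑ j : Fin n, (if i = k then (if j = k then (0 : ℝ) else 1) else 0)
          = if i = k then ((n : ℝ) - 1) else 0 := by
        intro i
        by_cases hi : i = k
        · simp only [hi, if_true]
          rw [← hfil, Finset.card_filter]
          push_cast
          exact Finset.sum_congr rfl fun j _ => by by_cases h : j = k <;> simp [h]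
        · simp [hi]
      simp [this]
    have s2 : ∑ i : Fin n, ∑ j : Fin n, (if i = k then (0 : ℝ) else if j = k then 1 else 0)
        = n - 1 := by
      have : ∀ i : Fin n, ∑ j : Fin n, (if i = k then (0 : ℝ) else if j = k then 1 else 0)
          = if i = k then 0 else 1 := by
        intro i
        by_cases hi : i = k <;> simp [hi]
      simp only [this]
      rw [← hfil, Finset.card_filter]
      push_cast
      exact Finset.sum_congr rfl fun j _ => by by_cases h : j = k <;> simp [h]
    simp only [Finset.sum_add_distrib, s1, s2]
    ring
  rw [e1] at h2
  refine h2.congr fun x => ?_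
  simp only [← Finset.mul_sum]
  rw [← two_mul_V]
  ring

/-! ### The multipolar Hardy inequality with remainder -/

/-- The multipolar Hardy inequality with constant `(N - 2)² / n²` and a positive remainder term. -/
lemma exists_multipolar_hardy_remainder (hN : 2 ≤ N) (hn : 2 ≤ n) {Ω : Set (E N)} (hΩ : IsOpen Ω)
    (hb : Bornology.IsBounded Ω) {a : Fin n → E N} (haΩ : ∀ i, a i ∉ Ω) :
    ∃ w : E N → ℝ, ContinuousOn w Ω ∧ (∀ x ∈ Ω, 0 < w x) ∧
      ∀ u : E N → ℝ, IsTestFunction Ω u →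
        (((N : ℝ) - 2) ^ 2 / (n : ℝ) ^ 2) * (∫ x, V a x * u x ^ 2) + ∫ x, w x * u x ^ 2 ≤
          ∫ x, ‖gradient u x‖ ^ 2 := by
  obtain ⟨R, hR0, hR⟩ := hb.exists_pos_norm_le
  have hne : ∀ x ∈ Ω, ∀ i, x ≠ a i := fun x hx i h => haΩ i (h ▸ hx)
  have hn0 : (0 : ℝ) < n := by positivity
  -- By `V_eq`, div F + |F|² = (nβ² - (N - 2)β)∑|x - a_i|⁻² - β²V for the field F below; this β
  -- kills the first term.
  set β : ℝ := ((N : ℝ) - 2) / n with hβ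
  have hβ0 : 0 ≤ β := div_nonneg (sub_nonneg.2 (by exact_mod_cast hN)) hn0.le
  -- ψ = ∏|x - a_i|^β is the inverse of the ground state and F = -∇ψ/ψ, so that ∇(uψ) = ψ(∇u - uF).
  let ψ : E N → ℝ := fun x => Real.exp (β * ∑ i, Real.log ‖x - a i‖)
  let F : E N → E N := fun x => (-β) • ∑ i, logGrad (a i) x
  have hψC : ContDiffOn ℝ ∞ ψ Ω := fun x hx =>
    ((contDiffAt_const.mul (ContDiffAt.sum fun i _ => contDiffAt_log_norm (hne x hx i))).exp).contDiffWithinAt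
  have hFC : ContDiffOn ℝ ∞ F Ω := fun x hx =>
    ContDiffAt.contDiffWithinAt (.const_smul (-β) (.sum fun i _ => contDiffAt_logGrad (hne x hx i)))
  have hψg : ∀ x ∈ Ω, HasGradientAt ψ (-(ψ x • F x)) x := by
    intro x hx
    have h1 : HasGradientAt (fun y => ∑ i, Real.log ‖y - a i‖) (∑ i, logGrad (a i) x) x := by
      rw [hasGradientAt_iff_innerSL, map_sum]
      exact HasFDerivAt.fun_sum fun i _ => hasGradientAt_log_norm (hne x hx i)
    have h2 := h1.comp_real (((hasDerivAt_id _).const_mul β).exp)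
    have e : -(ψ x • F x) = (ψ x * (β * 1)) • ∑ i, logGrad (a i) x := by
      simp only [F, smul_smul, ← neg_smul]
      congr 1
      ring
    rw [e]
    exact h2
  have hVF : ∀ x ∈ Ω, divergence F x + ‖F x‖ ^ 2 = -(β ^ 2 * V a x) := by
    intro x hx
    have hd : ∀ i, DifferentiableAt ℝ (logGrad (a i)) x := fun i =>
      (contDiffAt_logGrad (hne x hx i)).differentiableAt (by simp)
    have h1 : divergence F x = -β * ((N - 2) * ∑ i, (‖x - a i‖ ^ 2)⁻¹) := by
      rw [divergence_const_smul (DifferentiableAt.fun_sum fun i _ => hd i),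
        divergence_sum _ fun i _ => hd i, Finset.mul_sum (a := (N : ℝ) - 2)]
      congr 1
      exact Finset.sum_congr rfl fun i _ => divergence_logGrad (hne x hx i)
    rw [h1, V_eq (hne x hx)]
    simp only [F, norm_smul, mul_pow, norm_neg, Real.norm_eq_abs, sq_abs]
    have : (N : ℝ) - 2 = β * n := by rw [hβ]; field_simp
    rw [this]
    ring
  have hbound : ∀ x ∈ Ω, ψ x ≤ Real.exp (β * ∑ i, Real.log (R + ‖a i‖)) := by
    intro x hx
    refine Real.exp_le_exp.2 (mul_le_mul_of_nonneg_left (Finset.sum_le_sum fun i _ => ?_) hβ0)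
    refine Real.log_le_log (norm_pos_iff.2 (sub_ne_zero.2 (hne x hx i))) ?_
    exact (norm_sub_le _ _).trans (by gcongr; exact hR x hx)
  set M := Real.exp (β * ∑ i, Real.log (R + ‖a i‖))
  have hM : 0 < M := Real.exp_pos _
  -- Since ψ ≤ M on Ω, Poincaré for uψ gives ∫u²ψ² ≤ R²M²∫|∇u - uF|². The square in the vector field
  -- identity thus yields the weight ψ²/(R²M²).
  refine ⟨fun x => (R ^ 2 * M ^ 2)⁻¹ * ψ x ^ 2, continuousOn_const.mul (hψC.continuousOn.pow 2),
    fun x _ => by positivity, fun u hu => ?_⟩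
  have hv := hu.mul_contDiffOn hΩ hψC
  have hvg : ∀ x, ‖gradient (fun x => u x * ψ x) x‖ ^ 2 ≤ M ^ 2 * ‖gradient u x - u x • F x‖ ^ 2 := by
    intro x
    by_cases hx : x ∈ Ω
    · have h := ((hu.hasGradientAt x).mul_real (hψg x hx)).gradient
      have e : gradient (fun x => u x * ψ x) x = ψ x • (gradient u x - u x • F x) := by
        rw [h, smul_neg, smul_sub, smul_comm]; abel
      rw [e, norm_smul, mul_pow, Real.norm_eq_abs, sq_abs]
      have := hbound x hx
      have : 0 ≤ ψ x := (Real.exp_pos _).le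
      gcongr
    · rw [hv.gradient_eq_zero_of_notMem hx]
      simp; positivity
  have hid := integral_norm_gradient_sub_smul_sq hΩ hu (hFC.of_le (by simp))
  have e1 : ∫ x, (divergence F x + ‖F x‖ ^ 2) * u x ^ 2 = -(β ^ 2 * ∫ x, V a x * u x ^ 2) := by
    rw [← integral_const_mul, ← integral_neg]
    refine integral_congr_ae (Eventually.of_forall fun x => ?_)
    by_cases hx : x ∈ Ω
    · simp only [hVF x hx]; ring
    · simp [hu.eq_zero_of_notMem hx]
  have h_int : Integrable fun x => ‖gradient u x - u x • F x‖ ^ 2 := by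
    have hg := hu.continuous_gradient
    have hc := hu.contDiff.continuous
    refine hu.integrable_of_continuousOn hΩ
      ((hg.continuousOn.sub (hc.continuousOn.smul hFC.continuousOn)).norm.pow 2) fun x hx => ?_
    simp [hu.eq_zero hx, hu.gradient_eq_zero hx]
  have h2 : ∫ x, ‖gradient (fun x => u x * ψ x) x‖ ^ 2 ≤
      M ^ 2 * ∫ x, ‖gradient u x - u x • F x‖ ^ 2 := by
    rw [← integral_const_mul]
    exact integral_mono hv.integrable_norm_gradient_sq (h_int.const_mul _) hvg
  have h3 := poincare hN hR0 hR hv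
  have h4 : ∫ x, (R ^ 2 * M ^ 2)⁻¹ * ψ x ^ 2 * u x ^ 2 =
      (R ^ 2 * M ^ 2)⁻¹ * ∫ x, (u x * ψ x) ^ 2 := by
    rw [← integral_const_mul]
    congr 1; ext x; ring
  have h5 : (R ^ 2 * M ^ 2)⁻¹ * ∫ x, (u x * ψ x) ^ 2 ≤ ∫ x, ‖gradient u x - u x • F x‖ ^ 2 := by
    rw [inv_mul_le_iff₀ (by positivity), mul_assoc]
    refine h3.trans ?_
    gcongr
  rw [h4, ← div_pow, ← hβ]
  linarith

/-! ### Hardy's inequality with a singularity on the boundary -/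

/-- Second order information on a defining function at a boundary point. -/
lemma eventually_definingFunction {p : E N} {U : Set (E N)} {ρ : E N → ℝ} (hU : IsOpen U)
    (hp : p ∈ U) (hρ : ContDiffOn ℝ ∞ ρ U) (hρp : ρ p = 0) (hdρ : fderiv ℝ ρ p ≠ 0) :
    ∃ c K L : ℝ, 0 < c ∧ 0 ≤ K ∧ 0 ≤ L ∧ ∀ᶠ x in 𝓝 p, x ∈ U ∧ c ≤ ‖gradient ρ x‖ ^ 2 ∧
      |divergence (gradient ρ) x| ≤ K ∧ |⟪gradient ρ x, x - p⟫ - ρ x| ≤ K * ‖x - p‖ ^ 2 ∧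
      |ρ x| ≤ L * ‖x - p‖ := by
  have hρp' : ContDiffAt ℝ ∞ ρ p := hρ.contDiffAt (hU.mem_nhds hp)
  have hgp : gradient ρ p ≠ 0 := by
    intro h
    apply hdρ
    rw [fderiv_eq_innerSL_gradient, h, map_zero]
  have hgC : ContDiffOn ℝ ∞ (gradient ρ) U := fun x hx =>
    (contDiffAt_gradient (m := ⊤) (k := ⊤) (hρ.contDiffAt (hU.mem_nhds hx)) (by simp)).contDiffWithinAt
  have hgc : ContinuousAt (gradient ρ) p := hgC.continuousOn.continuousAt (hU.mem_nhds hp)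
  have hdiv : ContinuousAt (divergence (gradient ρ)) p :=
    (contDiffOn_continuousOn_divergence hU (hgC.of_le (by simp))).continuousAt (hU.mem_nhds hp)
  have hfd : ContDiffAt ℝ 1 (fderiv ℝ ρ) p := hρp'.fderiv_right (by norm_cast)
  obtain ⟨K₁, t, ht, hlip⟩ := hfd.exists_lipschitzOnWith
  obtain ⟨L, t', ht', hlip'⟩ := (hρp'.of_le (by simp) : ContDiffAt ℝ 1 ρ p).exists_lipschitzOnWith
  have hpos : 0 < ‖gradient ρ p‖ ^ 2 := by have := norm_pos_iff.2 hgp; positivity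
  refine ⟨‖gradient ρ p‖ ^ 2 / 2, max (|divergence (gradient ρ) p| + 1) (2 * K₁), L, by positivity,
    by positivity, L.2, ?_⟩
  obtain ⟨r, hr, hrt⟩ := Metric.mem_nhds_iff.1 (inter_mem ht (inter_mem ht' (hU.mem_nhds hp)))
  filter_upwards [hU.mem_nhds hp, (hgc.norm.pow 2).eventually (lt_mem_nhds (half_lt_self hpos)),
    hdiv.abs.eventually (gt_mem_nhds (lt_add_one _)), Metric.ball_mem_nhds p hr]
    with x hxU hx1 hx2 hxr
  have hpr : p ∈ Metric.ball p r := Metric.mem_ball_self hr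
  refine ⟨hxU, hx1.le, hx2.le.trans (le_max_left _ _), ?_, ?_⟩
  · have hsub : Metric.closedBall p ‖x - p‖ ⊆ Metric.ball p r := by
      refine Metric.closedBall_subset_ball ?_
      rwa [Metric.mem_ball, dist_eq_norm] at hxr
    -- Taylor's formula is based at x rather than at p because ∇ρ(x) enters the vector field. The
    -- ball about p is convex and contains both points, and its points lie within 2|x - p| of x,
    -- whence the constant 2K₁.
    have key := (convex_closedBall p ‖x - p‖).norm_image_sub_le_of_norm_hasFDerivWithin_le'
      (f := ρ) (f' := fderiv ℝ ρ) (φ := fderiv ℝ ρ x) (C := K₁ * (2 * ‖x - p‖)) (x := x) (y := p)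
      (fun z hz => by
        have hzU := (hrt (hsub hz)).2.2
        exact ((hρ.contDiffAt (hU.mem_nhds hzU)).differentiableAt (by simp)).hasFDerivAt.hasFDerivWithinAt)
      (fun z hz => by
        have h := hlip.dist_le_mul z (hrt (hsub hz)).1 x (hrt hxr).1
        rw [dist_eq_norm] at h
        refine h.trans ?_
        gcongr
        calc dist z x ≤ dist z p + dist x p := dist_triangle_right _ _ _
          _ ≤ ‖x - p‖ + ‖x - p‖ := add_le_add (Metric.mem_closedBall.1 hz) (dist_eq_norm _ _).le
          _ = 2 * ‖x - p‖ := by ring)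
      (by simp [dist_eq_norm]) (by simp)
    rw [hρp, ← inner_gradient, Real.norm_eq_abs, norm_sub_rev p x] at key
    have e : 0 - ρ x - ⟪gradient ρ x, p - x⟫ = ⟪gradient ρ x, x - p⟫ - ρ x := by
      rw [← neg_sub x p, inner_neg_right]; ring
    rw [e] at key
    refine key.trans ?_
    calc K₁ * (2 * ‖x - p‖) * ‖x - p‖ = (2 * K₁) * ‖x - p‖ ^ 2 := by ring
      _ ≤ _ := by gcongr; exact le_max_right _ _
  · have h := hlip'.dist_le_mul x (hrt hxr).2.1 p (hrt hpr).2.1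
    rwa [Real.dist_eq, hρp, sub_zero, dist_eq_norm] at h

/-- Here t = ρ, q = |∇ρ|², d = Δρ, m = ⟨∇ρ, x - p⟩, s = |x - p|² and ν = N; the right side is -Δφ/φ
for φ = σ|x - p|^{-N/2} with σ = ρ - Mρ². In the flat case M = 0, d = 0, m = t it is exactly
(ν²/4)/s. Curvature enters through d and m - t, with errors of order 1/σ. The concave correction
-Mρ² contributes 2Mq/σ, which dominates them by `hMc`, and the new error νMρ²/(σs) it causes is at
most ε/s by `ht2`. -/
lemma boundary_hardy_algebra {t M c K q d m s ε ν : ℝ} (ht : 0 < t) (hM : 0 ≤ M) (hs : 0 < s)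
    (hν : 0 ≤ ν) (hc : c ≤ q) (hd : |d| ≤ K) (hm : |m - t| ≤ K * s)
    (hMc : K + ν * K ≤ 2 * M * c) (ht1 : 2 * M * t ≤ 1) (ht2 : ν * M * t ≤ ε / 2) (hε : 0 ≤ ε) :
    (ν ^ 2 / 4 - ε) * s⁻¹ ≤
      -((((-2 * M) * (t - M * t ^ 2) - (1 - 2 * M * t) * (1 - 2 * M * t)) / (t - M * t ^ 2) ^ 2 * q
          + (1 - 2 * M * t) / (t - M * t ^ 2) * d - ν / 2 * ((ν - 2) * s⁻¹)) +
        (((1 - 2 * M * t) / (t - M * t ^ 2)) ^ 2 * q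
          - ν * ((1 - 2 * M * t) / (t - M * t ^ 2)) * m * s⁻¹ + ν ^ 2 / 4 * s⁻¹)) := by
  have hσ : t / 2 ≤ t - M * t ^ 2 := by nlinarith
  have hσ0 : 0 < t - M * t ^ 2 := by linarith
  rw [← sub_nonneg]
  set σ := t - M * t ^ 2 with hσd
  have e : -((((-2 * M) * σ - (1 - 2 * M * t) * (1 - 2 * M * t)) / σ ^ 2 * q
          + (1 - 2 * M * t) / σ * d - ν / 2 * ((ν - 2) * s⁻¹)) +
        (((1 - 2 * M * t) / σ) ^ 2 * q
          - ν * ((1 - 2 * M * t) / σ) * m * s⁻¹ + ν ^ 2 / 4 * s⁻¹)) - (ν ^ 2 / 4 - ε) * s⁻¹ =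
      (s * (2 * M * q - (1 - 2 * M * t) * d) + ν * ((1 - 2 * M * t) * m - σ) + ε * σ) / (σ * s) := by
    field_simp
    ring
  rw [e]
  refine div_nonneg ?_ (by positivity)
  rw [abs_le] at hd hm
  have hg0 : 0 ≤ 1 - 2 * M * t := by linarith
  have hg1 : 1 - 2 * M * t ≤ 1 := by nlinarith
  have hK : 0 ≤ K := by linarith
  have a1 : (1 - 2 * M * t) * d ≤ K :=
    (mul_le_mul_of_nonneg_left hd.2 hg0).trans (by nlinarith)
  have a2 : -(K * s) ≤ (1 - 2 * M * t) * (m - t) := by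
    have h1 := mul_le_mul_of_nonneg_left hm.1 hg0
    have h2 : (1 - 2 * M * t) * (K * s) ≤ 1 * (K * s) :=
      mul_le_mul_of_nonneg_right hg1 (by positivity)
    linarith
  have a3 : (1 - 2 * M * t) * m - σ = (1 - 2 * M * t) * (m - t) - M * t ^ 2 := by
    rw [hσd]; ring
  have a4 : 2 * M * c ≤ 2 * M * q := by gcongr
  have a5 : s * (ν * K) ≤ s * (2 * M * q - (1 - 2 * M * t) * d) :=
    mul_le_mul_of_nonneg_left (by linarith) hs.le
  have a6 : ν * (-(K * s)) ≤ ν * ((1 - 2 * M * t) * (m - t)) := mul_le_mul_of_nonneg_left a2 hν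
  have a7 : ε * (t / 2) ≤ ε * σ := mul_le_mul_of_nonneg_left hσ hε
  have a8 : ν * M * t * t ≤ ε / 2 * t := mul_le_mul_of_nonneg_right ht2 ht.le
  rw [a3]
  nlinarith

/-- The Hardy inequality with a singularity at a smooth boundary point. -/
lemma eventually_boundary_hardy {Ω : Set (E N)} (hΩ : IsSmoothBoundedDomain Ω) {p : E N}
    (hp : p ∈ frontier Ω) {ε : ℝ} (hε : 0 < ε) :
    ∀ᶠ r in 𝓝[>] (0 : ℝ), ∀ u : E N → ℝ, IsTestFunction (Ω ∩ Metric.ball p r) u →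
      ((N : ℝ) ^ 2 / 4 - ε) * ∫ x, (‖x - p‖ ^ 2)⁻¹ * u x ^ 2 ≤ ∫ x, ‖gradient u x‖ ^ 2 := by
  obtain ⟨U, ρ, hU, hpU, hρ, hρp, hdρ, hρΩ⟩ := hΩ.smooth_boundary p hp
  obtain ⟨c, K, L, hc, hK, hL, hev⟩ := eventually_definingFunction hU hpU hρ hρp hdρ
  have hpΩ : p ∉ Ω := by
    rw [hΩ.isOpen.frontier_eq] at hp; exact hp.2
  -- This gives 2Mc = K + NK, the balance needed in `boundary_hardy_algebra`.
  set M : ℝ := (K + N * K) / (2 * c) with hM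
  have hM0 : 0 ≤ M := by positivity
  have hsm : ∀ᶠ x in 𝓝 p, 2 * M * (L * ‖x - p‖) < 1 ∧ N * M * (L * ‖x - p‖) < ε / 2 := by
    have h1 : Tendsto (fun x => 2 * M * (L * ‖x - p‖)) (𝓝 p) (𝓝 (2 * M * (L * ‖p - p‖))) :=
      ContinuousAt.tendsto (by fun_prop)
    have h2 : Tendsto (fun x => N * M * (L * ‖x - p‖)) (𝓝 p) (𝓝 (N * M * (L * ‖p - p‖))) :=
      ContinuousAt.tendsto (by fun_prop)
    simp only [sub_self, norm_zero, mul_zero] at h1 h2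
    exact (h1.eventually (gt_mem_nhds one_pos)).and (h2.eventually (gt_mem_nhds (half_pos hε)))
  obtain ⟨r₀, hr₀, hball⟩ := Metric.eventually_nhds_iff_ball.1 (hev.and hsm)
  filter_upwards [Ioo_mem_nhdsGT hr₀] with r hr u hu
  set O := Ω ∩ Metric.ball p r with hO
  have hOo : IsOpen O := hΩ.isOpen.inter Metric.isOpen_ball
  have hOne : ∀ x ∈ O, x ≠ p := fun x hx h => hpΩ (h ▸ hx.1)
  have hfacts : ∀ x ∈ O, _ := fun x hx => hball x (Metric.ball_subset_ball hr.2.le hx.2)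
  have hpos : ∀ x ∈ O, 0 < ρ x := fun x hx => (hρΩ x (hfacts x hx).1.1).1 hx.1
  have ht : ∀ x ∈ O, 2 * M * ρ x ≤ 1 ∧ N * M * ρ x ≤ ε / 2 := by
    intro x hx
    obtain ⟨⟨-, -, -, -, h5⟩, h6, h7⟩ := hfacts x hx
    have h8 := (le_abs_self _).trans h5
    constructor
    · exact (mul_le_mul_of_nonneg_left h8 (by positivity)).trans h6.le
    · exact (mul_le_mul_of_nonneg_left h8 (by positivity)).trans h7.le
  have hσ : ∀ x ∈ O, ρ x - M * ρ x ^ 2 ≠ 0 := by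
    intro x hx
    have h1 := hpos x hx
    have h2 := (ht x hx).1
    have : 0 < ρ x - M * ρ x ^ 2 := by nlinarith
    exact this.ne'
  have hρC : ∀ x ∈ O, ContDiffAt ℝ ∞ ρ x := fun x hx =>
    hρ.contDiffAt (hU.mem_nhds (hfacts x hx).1.1)
  have hgC : ∀ x ∈ O, ContDiffAt ℝ ∞ (gradient ρ) x := fun x hx =>
    contDiffAt_gradient (m := ⊤) (k := ⊤) (hρC x hx) (by simp)
  -- F is the logarithmic gradient of (ρ - Mρ²)|x - p|^{-N/2}.
  let g : E N → ℝ := fun x => (1 - 2 * M * ρ x) / (ρ x - M * ρ x ^ 2)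
  let F : E N → E N := fun x => g x • gradient ρ x + (-((N : ℝ) / 2)) • logGrad p x
  have hgC' : ∀ x ∈ O, ContDiffAt ℝ ∞ g x := fun x hx =>
    (contDiffAt_const.sub (contDiffAt_const.mul (hρC x hx))).div
      ((hρC x hx).sub (contDiffAt_const.mul ((hρC x hx).pow 2))) (hσ x hx)
  have hFC : ContDiffOn ℝ 1 F O := fun x hx => by
    have h1 : ContDiffAt ℝ ∞ F x := ((hgC' x hx).smul (hgC x hx)).add
      (.const_smul (-((N : ℝ) / 2)) (contDiffAt_logGrad (hOne x hx)))
    exact (h1.of_le (by simp)).contDiffWithinAt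
  have hWc : ContinuousOn (fun x => ((N : ℝ) ^ 2 / 4 - ε) * (‖x - p‖ ^ 2)⁻¹) O :=
    continuousOn_const.mul (ContinuousOn.inv₀ (by fun_prop) fun x hx =>
      (norm_sub_sq_pos (hOne x hx)).ne')
  have := integral_mul_sq_le_of_divergence hOo hu hFC hWc fun x hx => ?_
  · rw [← integral_const_mul]
    simpa only [mul_assoc] using this
  obtain ⟨⟨-, h2, h3, h4, -⟩, -⟩ := hfacts x hx
  have hs := norm_sub_sq_pos (hOne x hx)
  have hgg : HasGradientAt g ((((-2 * M) * (ρ x - M * ρ x ^ 2) - (1 - 2 * M * ρ x) *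
      (1 - 2 * M * ρ x)) / (ρ x - M * ρ x ^ 2) ^ 2) • gradient ρ x) x := by
    have h1 : HasDerivAt (fun t => 1 - 2 * M * t) (-2 * M) (ρ x) := by
      simpa using ((hasDerivAt_id (ρ x)).const_mul (2 * M)).const_sub 1
    have h2 : HasDerivAt (fun t => t - M * t ^ 2) (1 - 2 * M * ρ x) (ρ x) := by
      have := (hasDerivAt_id (ρ x)).sub (((hasDerivAt_id (ρ x)).pow 2).const_mul M)
      refine this.congr_deriv ?_
      simp; ring
    exact ((hρC x hx).differentiableAt (by simp)).hasGradientAt.comp_real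
      (f := fun t => (1 - 2 * M * t) / (t - M * t ^ 2)) (h1.div h2 (hσ x hx))
  have hdP : DifferentiableAt ℝ (gradient ρ) x := (hgC x hx).differentiableAt (by simp)
  have hdl : DifferentiableAt ℝ (logGrad p) x :=
    (contDiffAt_logGrad (hOne x hx)).differentiableAt (by simp)
  have hdivF : divergence F x = ((-2 * M) * (ρ x - M * ρ x ^ 2) - (1 - 2 * M * ρ x) *
      (1 - 2 * M * ρ x)) / (ρ x - M * ρ x ^ 2) ^ 2 * ‖gradient ρ x‖ ^ 2
      + (1 - 2 * M * ρ x) / (ρ x - M * ρ x ^ 2) * divergence (gradient ρ) x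
      - N / 2 * ((N - 2) * (‖x - p‖ ^ 2)⁻¹) := by
    rw [divergence_add (hgg.differentiableAt.fun_smul hdP) (hdl.fun_const_smul _),
      divergence_smul hgg hdP, divergence_const_smul hdl, divergence_logGrad (hOne x hx),
      real_inner_smul_left, real_inner_self_eq_norm_sq]
    ring
  have hnormF : ‖F x‖ ^ 2 = ((1 - 2 * M * ρ x) / (ρ x - M * ρ x ^ 2)) ^ 2 * ‖gradient ρ x‖ ^ 2
      - N * ((1 - 2 * M * ρ x) / (ρ x - M * ρ x ^ 2)) * ⟪gradient ρ x, x - p⟫ * (‖x - p‖ ^ 2)⁻¹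
      + N ^ 2 / 4 * (‖x - p‖ ^ 2)⁻¹ := by
    simp only [F]
    rw [norm_add_sq_real, norm_smul, norm_smul, mul_pow, mul_pow, norm_logGrad_sq (hOne x hx),
      real_inner_smul_left, real_inner_smul_right, logGrad, real_inner_smul_right]
    simp only [Real.norm_eq_abs, sq_abs, g]
    ring
  rw [hdivF, hnormF]
  refine boundary_hardy_algebra (hpos x hx) hM0 hs (Nat.cast_nonneg N) h2 h3 h4 ?_ (ht x hx).1
    (ht x hx).2 hε.le
  rw [hM]
  field_simp
  rfl

/-! ### The inequality below the critical constant -/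

/-- Young's inequality for the cross term. -/
lemma norm_add_sq_le_of_pos {F : Type*} [NormedAddCommGroup F] [InnerProductSpace ℝ F] {ε : ℝ}
    (hε : 0 < ε) (x y : F) : ‖x + y‖ ^ 2 ≤ (1 + ε) * ‖x‖ ^ 2 + (1 + ε⁻¹) * ‖y‖ ^ 2 := by
  have h1 : ‖x + y‖ ^ 2 ≤ (‖x‖ + ‖y‖) ^ 2 := by gcongr; exact norm_add_le x y
  have h2 : 2 * ‖x‖ * ‖y‖ ≤ ε * ‖x‖ ^ 2 + ε⁻¹ * ‖y‖ ^ 2 := by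
    have h3 : 0 ≤ ε⁻¹ * (ε * ‖x‖ - ‖y‖) ^ 2 := by positivity
    have h4 : ε⁻¹ * (ε * ‖x‖ - ‖y‖) ^ 2 = ε * ‖x‖ ^ 2 + ε⁻¹ * ‖y‖ ^ 2 - 2 * ‖x‖ * ‖y‖ := by
      field_simp; ring
    linarith
  nlinarith

lemma notMem_of_mem_frontier {Ω : Set (E N)} (hΩ : IsOpen Ω) {p : E N} (hp : p ∈ frontier Ω) :
    p ∉ Ω := by
  rw [hΩ.frontier_eq] at hp; exact hp.2

/-- The Hardy inequality below the critical constant, up to an `L²` term. -/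
lemma exists_hardy_subcritical (hn : 2 ≤ n) {Ω : Set (E N)} (hΩ : IsSmoothBoundedDomain Ω)
    {a : Fin n → E N} (ha : Function.Injective a) (haΩ : ∀ i, a i ∈ frontier Ω) {μ : ℝ}
    (hμ : μ < (N : ℝ) ^ 2 / (4 * (n : ℝ) - 4)) :
    ∃ c : ℝ, 0 ≤ c ∧ ∀ u : E N → ℝ, IsTestFunction Ω u →
      μ * (∫ x, V a x * u x ^ 2) ≤ c * (∫ x, u x ^ 2) + ∫ x, ‖gradient u x‖ ^ 2 := by
  have hn1 : (2 : ℝ) ≤ n := by exact_mod_cast hn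
  have hne : ∀ x ∈ Ω, ∀ i, x ≠ a i := fun x hx i h =>
    notMem_of_mem_frontier hΩ.isOpen (haΩ i) (h ▸ hx)
  have hVc := continuousOn_V hne
  rcases le_or_gt μ 0 with hμ0 | hμ0
  · refine ⟨0, le_rfl, fun u hu => ?_⟩
    have h1 : 0 ≤ ∫ x, V a x * u x ^ 2 :=
      integral_nonneg fun x => mul_nonneg (V_nonneg a x) (sq_nonneg _)
    have h2 : 0 ≤ ∫ x, ‖gradient u x‖ ^ 2 := integral_nonneg fun x => by positivity
    nlinarith
  have hμ' : μ * (n - 1) < (N : ℝ) ^ 2 / 4 := by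
    rw [lt_div_iff₀ (by linarith)] at hμ
    linarith
  -- ε absorbs three losses: the excess of |x - a_i|²V over n - 1, the factor 1 + ε produced by the
  -- cutoffs, and the loss in the boundary Hardy inequality.
  obtain ⟨ε, hε, hεμ⟩ : ∃ ε : ℝ, 0 < ε ∧ μ * (n - 1 + ε) * (1 + ε) < (N : ℝ) ^ 2 / 4 - ε := by
    have h : Tendsto (fun ε : ℝ => μ * (n - 1 + ε) * (1 + ε) - ((N : ℝ) ^ 2 / 4 - ε)) (𝓝[>] 0)
        (𝓝 (μ * (n - 1 + 0) * (1 + 0) - ((N : ℝ) ^ 2 / 4 - 0))) :=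
      (ContinuousAt.tendsto (by fun_prop)).mono_left nhdsWithin_le_nhds
    have h0 : μ * (n - 1 + 0) * (1 + 0) - ((N : ℝ) ^ 2 / 4 - 0) < 0 := by linarith
    obtain ⟨ε, h1, h2⟩ := ((h.eventually (gt_mem_nhds h0)).and eventually_mem_nhdsWithin).exists
    exact ⟨ε, h2, by linarith⟩
  have hloc : ∀ᶠ r in 𝓝[>] (0 : ℝ), ∀ i, ∀ x, x ≠ a i → ‖x - a i‖ < r →
      ‖x - a i‖ ^ 2 * V a x ≤ n - 1 + ε := by
    refine eventually_all.2 fun i => ?_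
    have h := (tendsto_V ha i).eventually (gt_mem_nhds (show (n : ℝ) - 1 < n - 1 + ε by linarith))
    obtain ⟨r₀, hr₀, h⟩ := Metric.eventually_nhds_iff.1 (eventually_nhdsWithin_iff.1 h)
    filter_upwards [Ioo_mem_nhdsGT hr₀] with r hr x hx hxr
    exact (h (by rw [dist_eq_norm]; exact hxr.trans hr.2) hx).le
  have hsep : ∀ᶠ r in 𝓝[>] (0 : ℝ), ∀ i j, i ≠ j → r ≤ ‖a i - a j‖ := by
    refine eventually_all.2 fun i => eventually_all.2 fun j => ?_
    by_cases hij : i = j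
    · simp [hij]
    · filter_upwards [Ioo_mem_nhdsGT (norm_pos_iff.2 (sub_ne_zero.2 (ha.ne hij)))] with r hr _
      exact hr.2.le
  have hhardy := eventually_all.2 fun i => eventually_boundary_hardy hΩ (haΩ i) hε
  obtain ⟨r, hr0, hrloc, hrsep, hrh⟩ :=
    (eventually_mem_nhdsWithin.and (hloc.and (hsep.and hhardy))).exists
  have hr0 : 0 < r := hr0
  -- The poles are at least r apart, so outer radius r/2 makes the supports disjoint and ∑η_i² ≤ 1;
  -- inside radius r/3 the cutoff is 1, and outside all these balls V is bounded.
  let η : ∀ i, ContDiffBump (a i) := fun i => ⟨r / 3, r / 2, by positivity, by linarith⟩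
  have hηC : ∀ i, ContDiff ℝ ∞ (η i) := fun i => (η i).contDiff
  have hη0 : ∀ i x, 0 ≤ η i x := fun i x => (η i).nonneg
  have hη1 : ∀ i x, η i x ≤ 1 := fun i x => (η i).le_one
  have hηsum : ∀ x, ∑ i, η i x ^ 2 ≤ 1 := by
    intro x
    by_cases h : ∃ i, η i x ≠ 0
    · obtain ⟨i, hi⟩ := h
      rw [Finset.sum_eq_single i]
      · exact pow_le_one₀ (hη0 i x) (hη1 i x)
      · intro j _ hji
        by_contra hj
        have hj' : η j x ≠ 0 := fun h => hj (by simp [h])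
        have h1 : x ∈ Metric.ball (a i) (r / 2) := by
          have := (η i).support_eq (E := E N); rw [Set.ext_iff] at this; exact (this x).1 hi
        have h2 : x ∈ Metric.ball (a j) (r / 2) := by
          have := (η j).support_eq (E := E N); rw [Set.ext_iff] at this; exact (this x).1 hj'
        have h3 := hrsep i j (Ne.symm hji)
        rw [← dist_eq_norm] at h3
        have h4 := dist_triangle_left (a i) (a j) x
        rw [Metric.mem_ball] at h1 h2
        linarith
      · simp
    · push Not at h
      simp [h]
  have hgb : ∃ C : ℝ, ∀ i x, ‖gradient (η i) x‖ ≤ C := by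
    have h1 : ∀ i, ∃ C : ℝ, ∀ x, ‖gradient (η i) x‖ ≤ C := by
      intro i
      obtain ⟨C, hC⟩ := ((η i).hasCompactSupport.fderiv ℝ).exists_bound_of_continuous
        ((hηC i).continuous_fderiv (by simp))
      exact ⟨C, fun x => by rw [norm_gradient]; exact hC x⟩
    choose C hC using h1
    exact ⟨∑ i, |C i|, fun i x => (hC i x).trans ((le_abs_self _).trans
      (Finset.single_le_sum (f := fun i => |C i|) (fun j _ => abs_nonneg _) (Finset.mem_univ i)))⟩
  obtain ⟨C₁, hC₁⟩ := hgb
  obtain ⟨C₂, hC₂0, hC₂⟩ := exists_V_le a (show 0 < r / 3 by positivity)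
  set C₃ : ℝ := n * ((1 + ε⁻¹) * C₁ ^ 2)
  -- C₃ pays for the gradients of the cutoffs and C₂ for V away from the poles; dividing by 1 + ε
  -- restores coefficient 1 in front of ∫|∇u|².
  refine ⟨(C₃ + μ * (1 + ε) * C₂) / (1 + ε), by positivity, fun u hu => ?_⟩
  let v : Fin n → E N → ℝ := fun i x => u x * η i x
  have hv : ∀ i, IsTestFunction Ω (v i) := fun i => hu.mul_contDiffOn hΩ.isOpen (hηC i).contDiffOn
  have hv' : ∀ i, IsTestFunction (Ω ∩ Metric.ball (a i) r) (v i) := fun i =>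
    ⟨(hv i).contDiff, (hv i).hasCompactSupport, Set.subset_inter (hv i).tsupport_subset
      (((tsupport_mul_subset_right).trans (η i).tsupport_eq.subset).trans
        (Metric.closedBall_subset_ball (by simp only [η]; linarith)))⟩
  have hA : ∀ i, μ * (1 + ε) * ∫ x, V a x * v i x ^ 2 ≤ ∫ x, ‖gradient (v i) x‖ ^ 2 := by
    intro i
    have hsc : ContinuousOn (fun x => (‖x - a i‖ ^ 2)⁻¹) Ω := ContinuousOn.inv₀ (by fun_prop)
      fun x hx => (norm_sub_sq_pos (hne x hx i)).ne'
    have h1 : ∫ x, V a x * v i x ^ 2 ≤ (n - 1 + ε) * ∫ x, (‖x - a i‖ ^ 2)⁻¹ * v i x ^ 2 := by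
      rw [← integral_const_mul]
      refine integral_mono ((hv i).integrable_mul_sq hΩ.isOpen hVc)
        (((hv i).integrable_mul_sq hΩ.isOpen hsc).const_mul _) fun x => ?_
      by_cases hx : x ∈ Ω ∩ Metric.ball (a i) r
      · have h2 := hrloc i x (hne x hx.1 i) (by rw [← dist_eq_norm]; exact hx.2)
        have h3 := norm_sub_sq_pos (hne x hx.1 i)
        have h4 : V a x ≤ (n - 1 + ε) * (‖x - a i‖ ^ 2)⁻¹ := by
          rw [← div_eq_mul_inv, le_div_iff₀ h3]; linarith
        simp only [← mul_assoc]
        exact mul_le_mul_of_nonneg_right h4 (sq_nonneg _)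
      · simp [(hv' i).eq_zero_of_notMem hx]
    have h2 : 0 ≤ ∫ x, (‖x - a i‖ ^ 2)⁻¹ * v i x ^ 2 := integral_nonneg fun x => by positivity
    calc μ * (1 + ε) * ∫ x, V a x * v i x ^ 2
        ≤ μ * (1 + ε) * ((n - 1 + ε) * ∫ x, (‖x - a i‖ ^ 2)⁻¹ * v i x ^ 2) := by gcongr
      _ = (μ * (n - 1 + ε) * (1 + ε)) * ∫ x, (‖x - a i‖ ^ 2)⁻¹ * v i x ^ 2 := by ring
      _ ≤ ((N : ℝ) ^ 2 / 4 - ε) * ∫ x, (‖x - a i‖ ^ 2)⁻¹ * v i x ^ 2 := by gcongr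
      _ ≤ _ := hrh i _ (hv' i)
  have hB : ∫ x, V a x * u x ^ 2 ≤ (∑ i, ∫ x, V a x * v i x ^ 2) + C₂ * ∫ x, u x ^ 2 := by
    rw [← integral_finsetSum _ fun i _ => (hv i).integrable_mul_sq hΩ.isOpen hVc,
      ← integral_const_mul, ← integral_add
        (integrable_finsetSum _ fun i _ => (hv i).integrable_mul_sq hΩ.isOpen hVc)
        (hu.integrable_sq.const_mul _)]
    refine integral_mono (hu.integrable_mul_sq hΩ.isOpen hVc)
      ((integrable_finsetSum _ fun i _ => (hv i).integrable_mul_sq hΩ.isOpen hVc).add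
        (hu.integrable_sq.const_mul _)) fun x => ?_
    simp only
    by_cases h : ∃ i, ‖x - a i‖ < r / 3
    · obtain ⟨i, hi⟩ := h
      have h1 : η i x = 1 := (η i).one_of_mem_closedBall (by
        rw [mem_closedBall_iff_norm]; exact hi.le)
      have h2 : V a x * v i x ^ 2 ≤ ∑ i, V a x * v i x ^ 2 :=
        Finset.single_le_sum (f := fun i => V a x * v i x ^ 2)
          (fun j _ => mul_nonneg (V_nonneg a x) (sq_nonneg _)) (Finset.mem_univ i)
      have h3 : v i x = u x := by simp [v, h1]
      rw [h3] at h2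
      nlinarith [mul_nonneg hC₂0 (sq_nonneg (u x))]
    · push Not at h
      have h2 : 0 ≤ ∑ i, V a x * v i x ^ 2 :=
        Finset.sum_nonneg fun j _ => mul_nonneg (V_nonneg a x) (sq_nonneg _)
      nlinarith [mul_le_mul_of_nonneg_right (hC₂ x h) (sq_nonneg (u x))]
  have hD : ∑ i, ∫ x, ‖gradient (v i) x‖ ^ 2 ≤
      (1 + ε) * (∫ x, ‖gradient u x‖ ^ 2) + C₃ * ∫ x, u x ^ 2 := by
    rw [← integral_finsetSum _ fun i _ => (hv i).integrable_norm_gradient_sq,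
      ← integral_const_mul, ← integral_const_mul, ← integral_add
        (hu.integrable_norm_gradient_sq.const_mul _) (hu.integrable_sq.const_mul _)]
    refine integral_mono (integrable_finsetSum _ fun i _ => (hv i).integrable_norm_gradient_sq)
      ((hu.integrable_norm_gradient_sq.const_mul _).add (hu.integrable_sq.const_mul _)) fun x => ?_
    simp only
    have h1 : ∀ i, ‖gradient (v i) x‖ ^ 2 ≤
        (1 + ε) * ‖gradient u x‖ ^ 2 * η i x ^ 2 + (1 + ε⁻¹) * C₁ ^ 2 * u x ^ 2 := by
      intro i
      have hg : gradient (v i) x = η i x • gradient u x + u x • gradient (η i) x := by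
        rw [add_comm]
        exact ((hu.hasGradientAt x).mul_real
          ((hηC i).differentiable (by simp) x).hasGradientAt).gradient
      rw [hg]
      refine (norm_add_sq_le_of_pos hε _ _).trans ?_
      rw [norm_smul, norm_smul, mul_pow, mul_pow, Real.norm_eq_abs, sq_abs, Real.norm_eq_abs, sq_abs]
      have : u x ^ 2 * ‖gradient (η i) x‖ ^ 2 ≤ u x ^ 2 * C₁ ^ 2 := by gcongr; exact hC₁ i x
      have := mul_le_mul_of_nonneg_left this (show 0 ≤ 1 + ε⁻¹ by positivity)
      linarith
    refine (Finset.sum_le_sum fun i _ => h1 i).trans ?_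
    rw [Finset.sum_add_distrib, ← Finset.mul_sum]
    have h2 := mul_le_mul_of_nonneg_left (hηsum x) (show 0 ≤ (1 + ε) * ‖gradient u x‖ ^ 2 by positivity)
    simp only [Finset.sum_const, Finset.card_univ, Fintype.card_fin, nsmul_eq_mul, C₃]
    linarith
  have hS := Finset.sum_le_sum fun i (_ : i ∈ Finset.univ) => hA i
  rw [← Finset.mul_sum] at hS
  have hB' := mul_le_mul_of_nonneg_left hB (show 0 ≤ μ * (1 + ε) by positivity)
  have hfin : (1 + ε) * (μ * ∫ x, V a x * u x ^ 2) ≤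
      (1 + ε) * ((C₃ + μ * (1 + ε) * C₂) / (1 + ε) * (∫ x, u x ^ 2) + ∫ x, ‖gradient u x‖ ^ 2) := by
    have e : (1 + ε) * ((C₃ + μ * (1 + ε) * C₂) / (1 + ε) * (∫ x, u x ^ 2) + ∫ x, ‖gradient u x‖ ^ 2)
        = (C₃ + μ * (1 + ε) * C₂) * (∫ x, u x ^ 2) + (1 + ε) * ∫ x, ‖gradient u x‖ ^ 2 := by
      field_simp
    rw [e]
    linarith
  exact le_of_mul_le_mul_left hfin (by positivity)

/-! ### Polar coordinates and spherical cutoffs -/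

lemma integral_Ioi_inv_mul_comp_log (g : ℝ → ℝ) :
    ∫ r in Set.Ioi (0 : ℝ), r⁻¹ * g (Real.log r) = ∫ s, g s := by
  have h := integral_image_eq_integral_abs_deriv_smul (s := Set.univ) (f := Real.exp)
    (f' := Real.exp) MeasurableSet.univ (fun x _ => (Real.hasDerivAt_exp x).hasDerivWithinAt)
    Real.exp_injective.injOn (fun r => r⁻¹ * g (Real.log r))
  rw [Set.image_univ, Real.range_exp, setIntegral_univ] at h
  rw [h]
  refine integral_congr_ae (Eventually.of_forall fun s => ?_)
  simp only [abs_of_pos (Real.exp_pos s), Real.log_exp, smul_eq_mul]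
  rw [← mul_assoc, mul_inv_cancel₀ (Real.exp_pos s).ne', one_mul]

/-- Integration in polar coordinates, with the scale invariant measure `|x|^{-N} dx`. -/
lemma integral_polar (hN : 1 ≤ N) (ν : E N) (g k : ℝ → ℝ) :
    ∫ x : E N, Real.exp (-N * Real.log ‖x‖) *
        (g (Real.log ‖x‖) * k (⟪ν, x⟫ * Real.exp (-Real.log ‖x‖))) =
      (∫ θ : Metric.sphere (0 : E N) 1, k ⟪ν, (θ : E N)⟫ ∂(volume : Measure (E N)).toSphere) *
        ∫ s, g s := by
  have : Nonempty (Fin N) := ⟨⟨0, hN⟩⟩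
  have : Nontrivial (E N) := by infer_instance
  set μ : Measure (E N) := volume
  -- The factor |x|^{-N} turns the Jacobian r^{N-1} dr into dr/r, which is ds for s = log r.
  let f : ℝ → ℝ := fun r => Real.exp (-N * Real.log r) * g (Real.log r)
  have hdim : Module.finrank ℝ (E N) = N := by simp
  calc _ = ∫ x : ({(0)}ᶜ : Set (E N)), Real.exp (-N * Real.log ‖x.1‖) *
        (g (Real.log ‖x.1‖) * k (⟪ν, x.1⟫ * Real.exp (-Real.log ‖x.1‖))) ∂(μ.comap (↑)) := by
        rw [integral_subtype_comap (measurableSet_singleton _).compl fun x : E N =>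
          Real.exp (-N * Real.log ‖x‖) *
            (g (Real.log ‖x‖) * k (⟪ν, x⟫ * Real.exp (-Real.log ‖x‖))),
          restrict_compl_singleton]
    _ = ∫ z, k ⟪ν, (z.1 : E N)⟫ * f z.2 ∂μ.toSphere.prod (.volumeIoiPow (Module.finrank ℝ (E N) - 1)) := by
        rw [← μ.measurePreserving_homeomorphUnitSphereProd.integral_comp
          (Homeomorph.measurableEmbedding _) (fun z => k ⟪ν, (z.1 : E N)⟫ * f z.2)]
        refine integral_congr_ae (Eventually.of_forall fun x => ?_)
        have hx : 0 < ‖x.1‖ := norm_pos_iff.2 x.2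
        simp only [homeomorphUnitSphereProd_apply_snd_coe, homeomorphUnitSphereProd_apply_fst_coe,
          f, Real.exp_neg, Real.exp_log hx, real_inner_smul_right]
        rw [mul_comm ⟪ν, x.1⟫]
        ring
    _ = (∫ θ, k ⟪ν, (θ : E N)⟫ ∂μ.toSphere) *
        ∫ r : Set.Ioi (0 : ℝ), f r ∂.volumeIoiPow (Module.finrank ℝ (E N) - 1) :=
        integral_prod_mul (fun θ : Metric.sphere (0 : E N) 1 => k ⟪ν, (θ : E N)⟫)
          (fun r : Set.Ioi (0 : ℝ) => f r)
    _ = _ := by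
        congr 1
        rw [← integral_Ioi_inv_mul_comp_log]
        simp only [Measure.volumeIoiPow, ENNReal.ofReal]
        rw [integral_withDensity_eq_integral_smul,
          integral_subtype_comap measurableSet_Ioi
            fun r : ℝ => Real.toNNReal (r ^ (Module.finrank ℝ (E N) - 1)) • f r]
        · refine setIntegral_congr_fun measurableSet_Ioi fun r hr => ?_
          have hr : 0 < r := hr
          simp only [NNReal.smul_def, Real.coe_toNNReal _ (pow_nonneg hr.le _), f, hdim, smul_eq_mul]
          rw [neg_mul, Real.exp_neg, ← Real.log_pow, Real.exp_log (by positivity), ← mul_assoc]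
          congr 1
          obtain ⟨m, rfl⟩ : ∃ m, N = m + 1 := ⟨N - 1, by omega⟩
          simp only [Nat.add_sub_cancel]
          field_simp
          ring
        · exact (measurable_subtype_coe.pow_const _).real_toNNReal

/-- Such points are global minima, so the endpoint 0 needs no separate computation. -/
lemma deriv_smoothTransition_of_nonpos {x : ℝ} (hx : x ≤ 0) : deriv Real.smoothTransition x = 0 := by
  refine IsLocalMin.deriv_eq_zero (Eventually.of_forall fun y => ?_)
  rw [Real.smoothTransition.zero_of_nonpos hx]
  exact Real.smoothTransition.nonneg y

lemma deriv_smoothTransition_of_one_le {x : ℝ} (hx : 1 ≤ x) : deriv Real.smoothTransition x = 0 := by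
  refine IsLocalMax.deriv_eq_zero (Eventually.of_forall fun y => ?_)
  rw [Real.smoothTransition.one_of_one_le hx]
  exact Real.smoothTransition.le_one y

lemma continuous_deriv_smoothTransition : Continuous (deriv Real.smoothTransition) :=
  (Real.smoothTransition.contDiff (n := 1)).continuous_deriv le_rfl

lemma exists_abs_deriv_smoothTransition_le : ∃ C : ℝ, ∀ x, |deriv Real.smoothTransition x| ≤ C := by
  have hc : HasCompactSupport (deriv Real.smoothTransition) :=
    HasCompactSupport.intro (isCompact_Icc (a := 0) (b := 1)) fun x hx => by
      rw [Set.mem_Icc, not_and_or, not_le, not_le] at hx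
      rcases hx with h | h
      · exact deriv_smoothTransition_of_nonpos h.le
      · exact deriv_smoothTransition_of_one_le h.le
  exact hc.exists_bound_of_continuous continuous_deriv_smoothTransition

/-- The cutoffs near the equator of the half-sphere have small weighted energy. -/
lemma exists_spherical_cutoff {ν : E N} (hν : ν ≠ 0) {ε : ℝ} (hε : 0 < ε) :
    ∃ δ : ℝ, 0 < δ ∧
      0 < ∫ θ : Metric.sphere (0 : E N) 1, ⟪ν, (θ : E N)⟫ ^ 2 *
        Real.smoothTransition (⟪ν, (θ : E N)⟫ / δ - 1) ^ 2 ∂(volume : Measure (E N)).toSphere ∧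
      ∫ θ : Metric.sphere (0 : E N) 1, ⟪ν, (θ : E N)⟫ ^ 2 *
          (deriv Real.smoothTransition (⟪ν, (θ : E N)⟫ / δ - 1) / δ) ^ 2
            ∂(volume : Measure (E N)).toSphere <
        ε * ∫ θ : Metric.sphere (0 : E N) 1, ⟪ν, (θ : E N)⟫ ^ 2 *
          Real.smoothTransition (⟪ν, (θ : E N)⟫ / δ - 1) ^ 2 ∂(volume : Measure (E N)).toSphere := by
  set σ := (volume : Measure (E N)).toSphere
  have hcs := Real.smoothTransition.continuous
  have hcd := continuous_deriv_smoothTransition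
  obtain ⟨C, hC⟩ := exists_abs_deriv_smoothTransition_le
  have hpos : 0 < ∫ θ : Metric.sphere (0 : E N) 1, (max ⟪ν, (θ : E N)⟫ 0) ^ 2 ∂σ := by
    have hν' : 0 < ‖ν‖ := norm_pos_iff.2 hν
    refine Continuous.integral_pos_of_hasCompactSupport_nonneg_nonzero
      (x := (⟨‖ν‖⁻¹ • ν, by simp [norm_smul, hν'.ne']⟩ : Metric.sphere (0 : E N) 1)) (by fun_prop)
      (HasCompactSupport.of_compactSpace _) (fun θ => by positivity) ?_
    simp only [real_inner_smul_right, real_inner_self_eq_norm_sq]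
    have : 0 < ‖ν‖⁻¹ * ‖ν‖ ^ 2 := by positivity
    rw [max_eq_left this.le]
    positivity
  have hA : Tendsto (fun δ : ℝ => ∫ θ : Metric.sphere (0 : E N) 1, ⟪ν, (θ : E N)⟫ ^ 2 *
        Real.smoothTransition (⟪ν, (θ : E N)⟫ / δ - 1) ^ 2 ∂σ) (𝓝[>] 0)
      (𝓝 (∫ θ : Metric.sphere (0 : E N) 1, (max ⟪ν, (θ : E N)⟫ 0) ^ 2 ∂σ)) := by
    refine tendsto_integral_filter_of_dominated_convergence (fun _ => ‖ν‖ ^ 2)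
      (Eventually.of_forall fun δ => (Continuous.aestronglyMeasurable (by fun_prop)))
      (Eventually.of_forall fun δ => Eventually.of_forall fun θ => ?_) (integrable_const _)
      (Eventually.of_forall fun θ => ?_)
    · rw [Real.norm_of_nonneg (by positivity)]
      have h1 : ⟪ν, (θ : E N)⟫ ^ 2 ≤ ‖ν‖ ^ 2 := by
        rw [← sq_abs]
        gcongr
        refine (abs_real_inner_le_norm _ _).trans ?_
        simp
      have h2 : Real.smoothTransition (⟪ν, (θ : E N)⟫ / δ - 1) ^ 2 ≤ 1 :=
        pow_le_one₀ (Real.smoothTransition.nonneg _) (Real.smoothTransition.le_one _)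
      calc _ ≤ ‖ν‖ ^ 2 * 1 := by gcongr
        _ = _ := mul_one _
    · refine tendsto_const_nhds.congr' ?_
      rcases le_or_gt ⟪ν, (θ : E N)⟫ 0 with h | h
      · filter_upwards [eventually_mem_nhdsWithin] with δ hδ
        have hδ : 0 < δ := hδ
        rw [max_eq_right h, Real.smoothTransition.zero_of_nonpos]
        · simp
        · have := div_nonpos_of_nonpos_of_nonneg h hδ.le
          linarith
      · filter_upwards [Ioo_mem_nhdsGT (half_pos h)] with δ hδ
        rw [max_eq_left h.le, Real.smoothTransition.one_of_one_le]
        · simp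
        · rw [le_sub_iff_add_le, le_div_iff₀ hδ.1]
          linarith [hδ.2]
  -- The derivative can be nonzero only for δ < ⟨ν, θ⟩ < 2δ, where the weight ⟨ν, θ⟩² < 4δ² cancels
  -- δ⁻². Hence the integrand is bounded by 4C² and vanishes pointwise as δ → 0.
  have hB : Tendsto (fun δ : ℝ => ∫ θ : Metric.sphere (0 : E N) 1, ⟪ν, (θ : E N)⟫ ^ 2 *
          (deriv Real.smoothTransition (⟪ν, (θ : E N)⟫ / δ - 1) / δ) ^ 2 ∂σ) (𝓝[>] 0)
      (𝓝 (∫ _ : Metric.sphere (0 : E N) 1, (0 : ℝ) ∂σ)) := by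
    refine tendsto_integral_filter_of_dominated_convergence (fun _ => 4 * C ^ 2)
      (Eventually.of_forall fun δ => (Continuous.aestronglyMeasurable (by fun_prop)))
      ?_ (integrable_const _) (Eventually.of_forall fun θ => ?_)
    · filter_upwards [eventually_mem_nhdsWithin] with δ hδ
      have hδ : 0 < δ := hδ
      refine Eventually.of_forall fun θ => ?_
      rw [Real.norm_of_nonneg (by positivity), ← mul_pow]
      rcases le_or_gt (⟪ν, (θ : E N)⟫ / δ - 1) 0 with h | h
      · rw [deriv_smoothTransition_of_nonpos h]; simp; positivity
      rcases le_or_gt 1 (⟪ν, (θ : E N)⟫ / δ - 1) with h' | h'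
      · rw [deriv_smoothTransition_of_one_le h']; simp; positivity
      have e : ⟪ν, (θ : E N)⟫ * (deriv Real.smoothTransition (⟪ν, (θ : E N)⟫ / δ - 1) / δ) =
          (⟪ν, (θ : E N)⟫ / δ) * deriv Real.smoothTransition (⟪ν, (θ : E N)⟫ / δ - 1) := by ring
      rw [e, mul_pow, ← sq_abs (deriv _ _)]
      have h1 : (⟪ν, (θ : E N)⟫ / δ) ^ 2 ≤ 4 := by nlinarith
      have h2 : |deriv Real.smoothTransition (⟪ν, (θ : E N)⟫ / δ - 1)| ^ 2 ≤ C ^ 2 := by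
        gcongr; exact hC _
      exact mul_le_mul h1 h2 (by positivity) (by norm_num)
    · refine tendsto_const_nhds.congr' ?_
      rcases le_or_gt ⟪ν, (θ : E N)⟫ 0 with h | h
      · filter_upwards [eventually_mem_nhdsWithin] with δ hδ
        have hδ : 0 < δ := hδ
        rw [deriv_smoothTransition_of_nonpos]
        · simp
        · have := div_nonpos_of_nonpos_of_nonneg h hδ.le
          linarith
      · filter_upwards [Ioo_mem_nhdsGT (half_pos h)] with δ hδ
        rw [deriv_smoothTransition_of_one_le]
        · simp
        · rw [le_sub_iff_add_le, le_div_iff₀ hδ.1]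
          linarith [hδ.2]
  rw [integral_zero] at hB
  have hAB := hA.const_mul ε
  obtain ⟨δ, hδ, h1, h2⟩ := (eventually_mem_nhdsWithin.and ((hA.eventually (lt_mem_nhds hpos)).and
    (hB.eventually_lt hAB (by positivity)))).exists
  exact ⟨δ, hδ, h1, h2⟩

/-! ### Near-optimizers on the half-space -/

/-- The cosine-like angular coordinate `⟪ν, x⟫ / |x|`. -/
def angle (ν x : E N) : ℝ := ⟪ν, x⟫ * Real.exp (-Real.log ‖x‖)

lemma hasGradientAt_log_norm_zero {x : E N} (h : x ≠ 0) :
    HasGradientAt (fun y : E N => Real.log ‖y‖) (logGrad 0 x) x := by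
  simpa using hasGradientAt_log_norm h

lemma contDiffAt_log_norm_zero {x : E N} (h : x ≠ 0) :
    ContDiffAt ℝ ∞ (fun y : E N => Real.log ‖y‖) x := by
  simpa using contDiffAt_log_norm h

lemma hasGradientAt_exp_mul_log_norm (c : ℝ) {x : E N} (h : x ≠ 0) :
    HasGradientAt (fun y : E N => Real.exp (c * Real.log ‖y‖))
      ((Real.exp (c * Real.log ‖x‖) * c) • logGrad 0 x) x := by
  have h1 : HasDerivAt (fun t => Real.exp (c * t)) (Real.exp (c * Real.log ‖x‖) * c)
      (Real.log ‖x‖) := by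
    simpa using ((hasDerivAt_id (Real.log ‖x‖)).const_mul c).exp
  exact (hasGradientAt_log_norm_zero h).comp_real (f := fun t => Real.exp (c * t)) h1

lemma hasGradientAt_angle (ν : E N) {x : E N} (h : x ≠ 0) :
    HasGradientAt (angle ν) (Real.exp (-Real.log ‖x‖) • (ν - ⟪ν, x⟫ • logGrad 0 x)) x := by
  have h1 := (hasGradientAt_inner_left ν x).mul_real (hasGradientAt_exp_mul_log_norm (-1) h)
  simp only [neg_mul, one_mul] at h1
  have e : Real.exp (-Real.log ‖x‖) • (ν - ⟪ν, x⟫ • logGrad 0 x) =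
      ⟪ν, x⟫ • (Real.exp (-Real.log ‖x‖) * -1) • logGrad 0 x + Real.exp (-Real.log ‖x‖) • ν := by
    module
  rw [e]
  exact h1

lemma contDiffAt_angle (ν : E N) {x : E N} (h : x ≠ 0) : ContDiffAt ℝ ∞ (angle ν) x :=
  (contDiffAt_const.inner ℝ contDiffAt_id).mul (contDiffAt_log_norm_zero h).neg.exp

lemma norm_gradient_angle_sq_le (ν : E N) {x : E N} (h : x ≠ 0) :
    ‖Real.exp (-Real.log ‖x‖) • (ν - ⟪ν, x⟫ • logGrad 0 x)‖ ^ 2 ≤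
      4 * ‖ν‖ ^ 2 * Real.exp (-Real.log ‖x‖) ^ 2 := by
  have hx : 0 < ‖x‖ := norm_pos_iff.2 h
  have h1 : ‖logGrad 0 x‖ = ‖x‖⁻¹ := by
    rw [logGrad, sub_zero, norm_smul, norm_inv, norm_pow, norm_norm]
    field_simp
  have h2 : ‖⟪ν, x⟫ • logGrad 0 x‖ ≤ ‖ν‖ := by
    rw [norm_smul, h1, ← div_eq_mul_inv, div_le_iff₀ hx]
    exact norm_inner_le_norm ν x
  have h3 : ‖ν - ⟪ν, x⟫ • logGrad 0 x‖ ≤ 2 * ‖ν‖ := (norm_sub_le _ _).trans (by linarith)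
  rw [norm_smul, mul_pow, Real.norm_eq_abs, sq_abs]
  calc _ ≤ Real.exp (-Real.log ‖x‖) ^ 2 * (2 * ‖ν‖) ^ 2 := by gcongr
    _ = _ := by ring

/-- The virtual ground state `⟪ν, x⟫ |x|^{-N/2}` of the half-space. -/
def halfspaceState (ν x : E N) : ℝ := ⟪ν, x⟫ * Real.exp (-(N / 2 : ℝ) * Real.log ‖x‖)

/-- The logarithmic gradient of `halfspaceState`. -/
def halfspaceField (ν x : E N) : E N := ⟪ν, x⟫⁻¹ • ν + (-(N / 2 : ℝ)) • logGrad 0 x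

lemma ne_zero_of_inner_pos {ν x : E N} (h : 0 < ⟪ν, x⟫) : x ≠ 0 := by
  rintro rfl; simp at h

lemma contDiffAt_halfspaceState {ν x : E N} (h : 0 < ⟪ν, x⟫) :
    ContDiffAt ℝ ∞ (halfspaceState ν) x :=
  (contDiffAt_const.inner ℝ contDiffAt_id).mul
    (contDiffAt_const.mul (contDiffAt_log_norm_zero (ne_zero_of_inner_pos h))).exp

lemma hasGradientAt_halfspaceState {ν x : E N} (h : 0 < ⟪ν, x⟫) :
    HasGradientAt (halfspaceState ν) (halfspaceState ν x • halfspaceField ν x) x := by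
  have h1 := (hasGradientAt_inner_left ν x).mul_real
    (hasGradientAt_exp_mul_log_norm (-(N / 2 : ℝ)) (ne_zero_of_inner_pos h))
  have e : halfspaceState ν x • halfspaceField ν x =
      ⟪ν, x⟫ • (Real.exp (-(N / 2 : ℝ) * Real.log ‖x‖) * -(N / 2 : ℝ)) • logGrad 0 x +
        Real.exp (-(N / 2 : ℝ) * Real.log ‖x‖) • ν := by
    simp only [halfspaceState, halfspaceField, smul_add, smul_smul]
    rw [add_comm]
    congr 2
    · ring
    · field_simp
  rw [e]
  exact h1

lemma contDiffOn_halfspaceField (ν : E N) :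
    ContDiffOn ℝ 1 (halfspaceField ν) {x | 0 < ⟪ν, x⟫} := fun x (hx : 0 < ⟪ν, x⟫) => by
  have h1 : ContDiffAt ℝ ∞ (fun x => ⟪ν, x⟫⁻¹) x :=
    (contDiffAt_const.inner ℝ contDiffAt_id).inv hx.ne'
  have h : ContDiffAt ℝ ∞ (halfspaceField ν) x := (h1.smul contDiffAt_const).add
    (.const_smul (-(N / 2 : ℝ)) (contDiffAt_logGrad (ne_zero_of_inner_pos hx)))
  exact (h.of_le (by simp)).contDiffWithinAt

/-- This says -Δφ = (N²/4)|x|⁻²φ for the state φ. The terms ±|ν|²/⟨ν, x⟩² cancel; with exponent α in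
place of N/2 the coefficient of |x|⁻² would be α² - Nα, which is smallest at α = N/2. -/
lemma divergence_halfspaceField {ν x : E N} (hx : 0 < ⟪ν, x⟫) :
    divergence (halfspaceField ν) x + ‖halfspaceField ν x‖ ^ 2 =
      -((N : ℝ) ^ 2 / 4 * (‖x‖ ^ 2)⁻¹) := by
  have hx0 := ne_zero_of_inner_pos hx
  have hxn : 0 < ‖x‖ := norm_pos_iff.2 hx0
  have h1 : HasGradientAt (fun x => ⟪ν, x⟫⁻¹) (-(⟪ν, x⟫ ^ 2)⁻¹ • ν) x :=
    (hasGradientAt_inner_left ν x).comp_real (hasDerivAt_inv hx.ne')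
  have hdl : DifferentiableAt ℝ (logGrad 0) x :=
    (contDiffAt_logGrad hx0).differentiableAt (by simp)
  have hdiv : divergence (halfspaceField ν) x =
      -(⟪ν, x⟫ ^ 2)⁻¹ * ‖ν‖ ^ 2 - (N / 2) * ((N - 2) * (‖x‖ ^ 2)⁻¹) := by
    have h0 : divergence (fun _ : E N => ν) x = 0 := by simp [divergence]
    change divergence (fun x => ⟪ν, x⟫⁻¹ • ν + (-(N / 2 : ℝ)) • logGrad 0 x) x = _
    rw [divergence_add (h1.differentiableAt.fun_smul (differentiableAt_const ν))
        (hdl.fun_const_smul _), divergence_smul h1 (differentiableAt_const ν),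
      divergence_const_smul hdl, divergence_logGrad hx0, h0, real_inner_smul_left,
      real_inner_self_eq_norm_sq, sub_zero]
    ring
  have hn : ‖halfspaceField ν x‖ ^ 2 = (⟪ν, x⟫ ^ 2)⁻¹ * ‖ν‖ ^ 2 - N * (‖x‖ ^ 2)⁻¹ +
      N ^ 2 / 4 * (‖x‖ ^ 2)⁻¹ := by
    rw [halfspaceField, norm_add_sq_real, norm_smul, norm_smul, mul_pow, mul_pow,
      norm_logGrad_sq hx0, real_inner_smul_left, real_inner_smul_right, logGrad,
      real_inner_smul_right, sub_zero]
    simp only [Real.norm_eq_abs, sq_abs]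
    field_simp
    ring
  rw [hdiv, hn]
  ring

/-- Ground state substitution: for u = φw the defect in the vector field identity is φ∇w, so only
the derivatives of the cutoff w cost energy. -/
lemma gradient_sub_smul_halfspaceField {ν x g : E N} {w : E N → ℝ} (hx : 0 < ⟪ν, x⟫)
    (hw : HasGradientAt w g x) :
    gradient (fun y => halfspaceState ν y * w y) x -
      (halfspaceState ν x * w x) • halfspaceField ν x = halfspaceState ν x • g := by
  rw [((hasGradientAt_halfspaceState hx).mul_real hw).gradient, smul_smul, mul_comm (w x)]
  abel

/-- This rewrites φ²|x|⁻² as the scale invariant weight |x|^{-N} times a function of the angle, the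
form that `integral_polar` integrates. -/
lemma halfspaceState_sq_mul {ν x : E N} :
    halfspaceState ν x ^ 2 * Real.exp (-Real.log ‖x‖) ^ 2 =
      Real.exp (-N * Real.log ‖x‖) * angle ν x ^ 2 := by
  have e : Real.exp (-N * Real.log ‖x‖) = Real.exp (-(N / 2 : ℝ) * Real.log ‖x‖) ^ 2 := by
    rw [← Real.exp_nat_mul]; congr 1; push_cast; ring
  rw [halfspaceState, angle, e]
  ring

lemma exp_neg_log_sq {x : E N} (hx : x ≠ 0) : Real.exp (-Real.log ‖x‖) ^ 2 = (‖x‖ ^ 2)⁻¹ := by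
  rw [Real.exp_neg, Real.exp_log (norm_pos_iff.2 hx), inv_pow]

/-- Near optimality of the constant `N² / 4` in the Hardy inequality on a half-space. -/
lemma exists_halfspace_almost_optimal (hN : 1 ≤ N) {ν : E N} (hν : ν ≠ 0) {ε : ℝ} (hε : 0 < ε) :
    ∃ u : E N → ℝ, IsTestFunction {x | 0 < ⟪ν, x⟫} u ∧
      ∫ x, ‖gradient u x‖ ^ 2 < ((N : ℝ) ^ 2 / 4 + ε) * ∫ x, (‖x‖ ^ 2)⁻¹ * u x ^ 2 := by
  have hν' : 0 < ‖ν‖ := norm_pos_iff.2 hν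
  -- The bound 4|ν|²/|x|² for the squared gradient of the angle and a factor 2 from splitting a
  -- square lead to 8|ν|²B; this choice makes it less than εA/2.
  obtain ⟨δ, hδ, hA, hBA⟩ := exists_spherical_cutoff hν
    (show 0 < ε / (16 * ‖ν‖ ^ 2) by positivity)
  set A := ∫ θ : Metric.sphere (0 : E N) 1, ⟪ν, (θ : E N)⟫ ^ 2 *
        Real.smoothTransition (⟪ν, (θ : E N)⟫ / δ - 1) ^ 2 ∂(volume : Measure (E N)).toSphere
  set B := ∫ θ : Metric.sphere (0 : E N) 1, ⟪ν, (θ : E N)⟫ ^ 2 *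
          (deriv Real.smoothTransition (⟪ν, (θ : E N)⟫ / δ - 1) / δ) ^ 2
            ∂(volume : Measure (E N)).toSphere
  let G : ContDiffBump (0 : ℝ) := ⟨1, 2, one_pos, one_lt_two⟩
  have hGC : ContDiff ℝ ∞ G := G.contDiff
  have hGc : Continuous G := hGC.continuous
  have hG'c : Continuous (deriv G) := hGC.continuous_deriv (by simp)
  have hG0 : ∀ s : ℝ, 2 < |s| → G s = 0 ∧ deriv G s = 0 := by
    intro s hs
    have h1 : s ∉ tsupport G := by
      rw [G.tsupport_eq, Metric.mem_closedBall, Real.dist_eq, sub_zero, not_le]; exact hs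
    exact ⟨image_eq_zero_of_notMem_tsupport h1, by
      by_contra h; exact h1 (support_deriv_subset h)⟩
  set I₀ := ∫ s, G s ^ 2
  set I₁ := ∫ s, deriv G s ^ 2
  have hI₀ : 0 < I₀ := by
    refine Continuous.integral_pos_of_hasCompactSupport_nonneg_nonzero (x := (0 : ℝ)) (by fun_prop)
      (G.hasCompactSupport.comp_left (g := fun t : ℝ => t ^ 2) (by simp)) (fun s => sq_nonneg _) ?_
    have : G 0 = 1 := G.one_of_mem_closedBall (by simp [G])
    simp [this]
  have hI₁ : 0 ≤ I₁ := integral_nonneg fun s => sq_nonneg _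
  -- Stretching the radial cutoff by k in the variable log|x| multiplies its mass by k and divides
  -- its energy by k.
  obtain ⟨k, hk, hkε⟩ : ∃ k : ℝ, 0 < k ∧ 2 * I₁ / k ^ 2 < ε / 2 * I₀ := by
    have h : Tendsto (fun k : ℝ => 2 * I₁ / k ^ 2) atTop (𝓝 0) :=
      tendsto_const_nhds.div_atTop (tendsto_pow_atTop two_ne_zero)
    obtain ⟨k, h1, h2⟩ := ((eventually_gt_atTop 0).and
      (h.eventually (gt_mem_nhds (show 0 < ε / 2 * I₀ by positivity)))).exists
    exact ⟨k, h1, h2⟩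
  let f : ℝ → ℝ := fun s => G (s / k)
  let f' : ℝ → ℝ := fun s => deriv G (s / k) / k
  have hf : ∀ s, HasDerivAt f (f' s) s := fun s => by
    have h1 := ((hGC.differentiable (by simp)) (s / k)).hasDerivAt.comp s
      ((hasDerivAt_id s).div_const k)
    exact h1.congr_deriv (by simp [f', div_eq_mul_inv])
  have hfC : ContDiff ℝ ∞ f := hGC.comp (contDiff_id.div_const k)
  let h : ℝ → ℝ := fun t => Real.smoothTransition (t / δ - 1)
  let h' : ℝ → ℝ := fun t => deriv Real.smoothTransition (t / δ - 1) / δ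
  have hh : ∀ t, HasDerivAt h (h' t) t := fun t => by
    have h0 := ((Real.smoothTransition.contDiff (n := 1)).differentiable one_ne_zero
      (t / δ - 1)).hasDerivAt
    have h1 := h0.comp t (((hasDerivAt_id t).div_const δ).sub_const 1)
    exact h1.congr_deriv (by simp [h', div_eq_mul_inv])
  have hhC : ContDiff ℝ ∞ h :=
    (Real.smoothTransition.contDiff (n := ⊤)).comp ((contDiff_id.div_const δ).sub contDiff_const)
  have hh0 : ∀ t, t < δ → h t = 0 ∧ h' t = 0 := by
    intro t ht
    have h1 : t / δ - 1 ≤ 0 := by rw [sub_nonpos, div_le_one hδ]; exact ht.le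
    exact ⟨Real.smoothTransition.zero_of_nonpos h1, by
      simp [h', deriv_smoothTransition_of_nonpos h1]⟩
  let w : E N → ℝ := fun x => f (Real.log ‖x‖) * h (angle ν x)
  let u : E N → ℝ := fun x => halfspaceState ν x * w x
  set H : Set (E N) := {x | 0 < ⟪ν, x⟫} with hH
  have hHo : IsOpen H := isOpen_lt continuous_const (by fun_prop)
  -- The cutoffs confine the support to this truncated cone, a compact subset of the open half-space
  -- that avoids the singularity at the origin.
  let K : Set (E N) := {x | Real.exp (-(2 * k)) ≤ ‖x‖} ∩ (Metric.closedBall 0 (Real.exp (2 * k)) ∩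
    {x | δ * ‖x‖ ≤ ⟪ν, x⟫})
  have hKc : IsCompact K := by
    refine IsCompact.inter_left (IsCompact.inter_right (isCompact_closedBall _ _)
      (isClosed_le (by fun_prop) (by fun_prop))) (isClosed_le (by fun_prop) (by fun_prop))
  have hKH : K ⊆ H := by
    rintro x ⟨h1, -, h3⟩
    have h1' : 0 < ‖x‖ := (Real.exp_pos _).trans_le h1
    exact (mul_pos hδ h1').trans_le h3
  have hK0 : ∀ x ∉ K, (f (Real.log ‖x‖) = 0 ∧ f' (Real.log ‖x‖) = 0) ∨
      (h (angle ν x) = 0 ∧ h' (angle ν x) = 0) := by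
    intro x hx
    by_cases hx0 : x = 0
    · right; subst hx0
      exact hh0 _ (by simp [angle, hδ])
    have hxn : 0 < ‖x‖ := norm_pos_iff.2 hx0
    by_cases h3 : δ * ‖x‖ ≤ ⟪ν, x⟫
    · left
      have h4 : 2 < |Real.log ‖x‖ / k| := by
        rw [abs_div, abs_of_pos hk, lt_div_iff₀ hk]
        by_contra! h5
        rw [abs_le] at h5
        refine hx ⟨?_, ?_, h3⟩
        · rw [Set.mem_ofPred_eq, ← Real.le_log_iff_exp_le hxn]; exact h5.1
        · rw [mem_closedBall_zero_iff, ← Real.log_le_iff_le_exp hxn]; exact h5.2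
      obtain ⟨h5, h6⟩ := hG0 _ h4
      exact ⟨h5, by simp [f', h6]⟩
    · right
      refine hh0 _ ?_
      rw [angle, Real.exp_neg, Real.exp_log hxn, ← div_eq_mul_inv, div_lt_iff₀ hxn]
      exact not_le.1 h3
  have hwC : ∀ x ∈ H, ContDiffAt ℝ ∞ w x := fun x hx =>
    (hfC.contDiffAt.comp x (contDiffAt_log_norm_zero (ne_zero_of_inner_pos hx))).mul
      (hhC.contDiffAt.comp x (contDiffAt_angle ν (ne_zero_of_inner_pos hx)))
  have hu0 : ∀ x ∉ K, u x = 0 := by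
    intro x hx
    rcases hK0 x hx with h1 | h1 <;> simp [u, w, h1.1]
  have htsupp : tsupport u ⊆ K :=
    closure_minimal (fun x hx => by by_contra h; exact hx (hu0 x h)) hKc.isClosed
  have hu : IsTestFunction H u := by
    refine ⟨contDiff_iff_contDiffAt.2 fun x => ?_, hKc.of_isClosed_subset (isClosed_tsupport u) htsupp,
      htsupp.trans hKH⟩
    by_cases hx : x ∈ H
    · exact (contDiffAt_halfspaceState hx).mul (hwC x hx)
    · have : u =ᶠ[𝓝 x] fun _ => 0 := by
        filter_upwards [hKc.isClosed.isOpen_compl.mem_nhds fun h => hx (hKH h)] with y hy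
        exact hu0 y hy
      exact contDiffAt_const.congr_of_eventuallyEq this
  refine ⟨u, hu, ?_⟩
  have hid := integral_norm_gradient_sub_smul_sq hHo hu (contDiffOn_halfspaceField ν)
  have hdivi : ∫ x, (divergence (halfspaceField ν) x + ‖halfspaceField ν x‖ ^ 2) * u x ^ 2 =
      -((N : ℝ) ^ 2 / 4 * ∫ x, (‖x‖ ^ 2)⁻¹ * u x ^ 2) := by
    rw [← integral_const_mul, ← integral_neg]
    refine integral_congr_ae (Eventually.of_forall fun x => ?_)
    by_cases hx : x ∈ H
    · simp only [divergence_halfspaceField hx]; ring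
    · simp [hu.eq_zero_of_notMem hx]
  have hden : ∫ x, (‖x‖ ^ 2)⁻¹ * u x ^ 2 = A * (k * I₀) := by
    have e1 : ∫ x, (‖x‖ ^ 2)⁻¹ * u x ^ 2 = ∫ x : E N, Real.exp (-N * Real.log ‖x‖) *
        ((fun s => f s ^ 2) (Real.log ‖x‖) *
          (fun t => t ^ 2 * h t ^ 2) (⟪ν, x⟫ * Real.exp (-Real.log ‖x‖))) := by
      refine integral_congr_ae (Eventually.of_forall fun x => ?_)
      change (‖x‖ ^ 2)⁻¹ * u x ^ 2 = Real.exp (-N * Real.log ‖x‖) *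
        (f (Real.log ‖x‖) ^ 2 * (angle ν x ^ 2 * h (angle ν x) ^ 2))
      by_cases hx : x = 0
      · subst hx; simp [u, halfspaceState, angle]
      · rw [← exp_neg_log_sq hx]
        simp only [u, w]
        linear_combination (f (Real.log ‖x‖) ^ 2 * h (angle ν x) ^ 2) *
          halfspaceState_sq_mul (ν := ν) (x := x)
    rw [e1]
    refine (integral_polar hN ν (fun s => f s ^ 2) (fun t => t ^ 2 * h t ^ 2)).trans ?_
    congr 1
    have := Measure.integral_comp_div (fun s => G s ^ 2) k
    rw [abs_of_pos hk, smul_eq_mul] at this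
    exact this
  -- Φ₁ and Φ₂ are φ²|x|⁻² times f'²h² and f²h'²: the radial and the angular part of φ²|∇w|², each a
  -- product in polar coordinates.
  let Φ₁ : E N → ℝ := fun x => Real.exp (-N * Real.log ‖x‖) *
        ((fun s => f' s ^ 2) (Real.log ‖x‖) *
          (fun t => t ^ 2 * h t ^ 2) (⟪ν, x⟫ * Real.exp (-Real.log ‖x‖)))
  let Φ₂ : E N → ℝ := fun x => Real.exp (-N * Real.log ‖x‖) *
        ((fun s => f s ^ 2) (Real.log ‖x‖) *
          (fun t => t ^ 2 * h' t ^ 2) (⟪ν, x⟫ * Real.exp (-Real.log ‖x‖)))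
  have hΦ₁ : ∫ x, Φ₁ x = A * (I₁ / k) := by
    refine (integral_polar hN ν (fun s => f' s ^ 2) (fun t => t ^ 2 * h t ^ 2)).trans ?_
    congr 1
    have := Measure.integral_comp_div (fun s => deriv G s ^ 2) k
    rw [abs_of_pos hk, smul_eq_mul] at this
    simp only [f', div_pow]
    rw [integral_div, this]
    field_simp
    rfl
  have hΦ₂ : ∫ x, Φ₂ x = B * (k * I₀) := by
    refine (integral_polar hN ν (fun s => f s ^ 2) (fun t => t ^ 2 * h' t ^ 2)).trans ?_
    congr 1
    have := Measure.integral_comp_div (fun s => G s ^ 2) k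
    rw [abs_of_pos hk, smul_eq_mul] at this
    exact this
  have hlogc : ContinuousOn (fun x : E N => Real.log ‖x‖) H := fun x hx =>
    (contDiffAt_log_norm_zero (ne_zero_of_inner_pos hx)).continuousAt.continuousWithinAt
  have hangc : ContinuousOn (fun x : E N => ⟪ν, x⟫ * Real.exp (-Real.log ‖x‖)) H := fun x hx =>
    (contDiffAt_angle ν (ne_zero_of_inner_pos hx)).continuousAt.continuousWithinAt
  have hexpc : ContinuousOn (fun x : E N => Real.exp (-N * Real.log ‖x‖)) H :=
    Real.continuous_exp.comp_continuousOn (continuousOn_const.mul hlogc)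
  have h_intΦ : ∀ (p q : ℝ → ℝ), Continuous p → Continuous q →
      (∀ x ∉ K, p (Real.log ‖x‖) * q (angle ν x) = 0) →
      Integrable fun x : E N => Real.exp (-N * Real.log ‖x‖) *
        (p (Real.log ‖x‖) * q (⟪ν, x⟫ * Real.exp (-Real.log ‖x‖))) := by
    intro p q hp hq h0
    have hc : ContinuousOn (fun x : E N => Real.exp (-N * Real.log ‖x‖) *
        (p (Real.log ‖x‖) * q (⟪ν, x⟫ * Real.exp (-Real.log ‖x‖)))) K :=
      (hexpc.mul ((hp.comp_continuousOn hlogc).mul (hq.comp_continuousOn hangc))).mono hKH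
    refine (integrableOn_iff_integrable_of_support_subset fun x hx => ?_).1
      (hc.integrableOn_compact hKc)
    by_contra hxK
    exact hx (by simpa [angle] using h0 x hxK)
  have hfc : Continuous f := hfC.continuous
  have hf'c : Continuous f' := by fun_prop
  have hhc : Continuous h := hhC.continuous
  have hh'c : Continuous h' := by
    have := continuous_deriv_smoothTransition
    fun_prop
  have hi₁ : Integrable Φ₁ := h_intΦ (fun s => f' s ^ 2) (fun t => t ^ 2 * h t ^ 2) (by fun_prop)
    (by fun_prop) fun x hx => by rcases hK0 x hx with h1 | h1 <;> simp [h1.1, h1.2]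
  have hi₂ : Integrable Φ₂ := h_intΦ (fun s => f s ^ 2) (fun t => t ^ 2 * h' t ^ 2) (by fun_prop)
    (by fun_prop) fun x hx => by rcases hK0 x hx with h1 | h1 <;> simp [h1.1, h1.2]
  have hnum : ∫ x, ‖gradient u x - u x • halfspaceField ν x‖ ^ 2 ≤
      ∫ x, (2 * Φ₁ x + 8 * ‖ν‖ ^ 2 * Φ₂ x) := by
    refine integral_mono_of_nonneg (Eventually.of_forall fun x => by positivity)
      ((hi₁.const_mul 2).add (hi₂.const_mul _)) (Eventually.of_forall fun x => ?_)
    have hΦ₁0 : 0 ≤ Φ₁ x := by simp only [Φ₁]; positivity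
    have hΦ₂0 : 0 ≤ Φ₂ x := by simp only [Φ₂]; positivity
    by_cases hx : x ∈ H
    · have hx0 := ne_zero_of_inner_pos hx
      have hg1 := (hasGradientAt_log_norm_zero hx0).comp_real (hf (Real.log ‖x‖))
      have hg2 := (hasGradientAt_angle ν hx0).comp_real (hh (angle ν x))
      have hg := gradient_sub_smul_halfspaceField hx (hg1.mul_real hg2)
      change ‖gradient u x - u x • halfspaceField ν x‖ ^ 2 ≤ _
      rw [show gradient u x - u x • halfspaceField ν x = _ from hg, norm_smul, mul_pow,
        Real.norm_eq_abs, sq_abs]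
      set a₁ := Real.exp (-Real.log ‖x‖) • (ν - ⟪ν, x⟫ • logGrad 0 x) with ha₁
      have hb : ∀ y z : E N, ‖y + z‖ ^ 2 ≤ 2 * ‖y‖ ^ 2 + 2 * ‖z‖ ^ 2 := by
        intro y z
        have := norm_add_sq_le_of_pos one_pos y z
        norm_num at this
        exact this
      have hb1 := hb (f (Real.log ‖x‖) • h' (angle ν x) • a₁)
        (h (angle ν x) • f' (Real.log ‖x‖) • logGrad 0 x)
      simp only [norm_smul, mul_pow, norm_logGrad_sq hx0, sub_zero, Real.norm_eq_abs, sq_abs] at hb1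
      rw [← exp_neg_log_sq hx0] at hb1
      have hb2 : f (Real.log ‖x‖) ^ 2 * (h' (angle ν x) ^ 2 * ‖a₁‖ ^ 2) ≤
          f (Real.log ‖x‖) ^ 2 * (h' (angle ν x) ^ 2 *
            (4 * ‖ν‖ ^ 2 * Real.exp (-Real.log ‖x‖) ^ 2)) := by
        gcongr
        exact norm_gradient_angle_sq_le ν hx0
      have hb3 := mul_le_mul_of_nonneg_left (hb1.trans (add_le_add_left
        (mul_le_mul_of_nonneg_left hb2 zero_le_two) _)) (sq_nonneg (halfspaceState ν x))
      refine hb3.trans (le_of_eq ?_)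
      change _ = 2 * (Real.exp (-N * Real.log ‖x‖) * (f' (Real.log ‖x‖) ^ 2 *
          (angle ν x ^ 2 * h (angle ν x) ^ 2))) + 8 * ‖ν‖ ^ 2 * (Real.exp (-N * Real.log ‖x‖) *
          (f (Real.log ‖x‖) ^ 2 * (angle ν x ^ 2 * h' (angle ν x) ^ 2)))
      linear_combination (2 * f' (Real.log ‖x‖) ^ 2 * h (angle ν x) ^ 2 +
        8 * ‖ν‖ ^ 2 * f (Real.log ‖x‖) ^ 2 * h' (angle ν x) ^ 2) *
          halfspaceState_sq_mul (ν := ν) (x := x)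
    · simp only [hu.eq_zero_of_notMem hx, hu.gradient_eq_zero_of_notMem hx]
      simp only [zero_smul, sub_zero, norm_zero, ne_eq, OfNat.ofNat_ne_zero, not_false_eq_true,
        zero_pow]
      positivity
  rw [integral_add (hi₁.const_mul 2) (hi₂.const_mul _), integral_const_mul, integral_const_mul,
    hΦ₁, hΦ₂, hid, hdivi, hden] at hnum
  rw [hden]
  have hBA' : 8 * ‖ν‖ ^ 2 * B < ε / 2 * A := by
    have := mul_lt_mul_of_pos_left hBA (show 0 < 8 * ‖ν‖ ^ 2 by positivity)
    have e : 8 * ‖ν‖ ^ 2 * (ε / (16 * ‖ν‖ ^ 2) * A) = ε / 2 * A := by field_simp; norm_num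
    linarith
  have t1 : 8 * ‖ν‖ ^ 2 * (B * (k * I₀)) < ε / 2 * (A * (k * I₀)) := by
    have := mul_lt_mul_of_pos_right hBA' (show 0 < k * I₀ by positivity)
    linarith
  have t2 : 2 * (A * (I₁ / k)) < ε / 2 * (A * (k * I₀)) := by
    have := mul_lt_mul_of_pos_right hkε (show 0 < A * k by positivity)
    have e : 2 * I₁ / k ^ 2 * (A * k) = 2 * (A * (I₁ / k)) := by field_simp
    linarith
  linarith

/-! ### Concentration at a pole above the critical constant -/

lemma integral_comp_rescale (g : E N → ℝ) (p : E N) {δ : ℝ} (hδ : 0 < δ) :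
    ∫ y, g (δ⁻¹ • (y - p)) = δ ^ N * ∫ x, g x := by
  rw [integral_sub_right_eq_self (fun y => g (δ⁻¹ • y)) p,
    Measure.integral_comp_inv_smul_of_nonneg _ _ hδ.le]
  simp

lemma gradient_comp_rescale {Ω : Set (E N)} {u : E N → ℝ} (hu : IsTestFunction Ω u) (p y : E N)
    (δ : ℝ) : gradient (fun y => u (δ⁻¹ • (y - p))) y = δ⁻¹ • gradient u (δ⁻¹ • (y - p)) := by
  refine HasGradientAt.gradient ?_
  rw [hasGradientAt_iff_innerSL]
  have h1 : HasFDerivAt (fun y : E N => δ⁻¹ • (y - p)) (δ⁻¹ • ContinuousLinearMap.id ℝ (E N)) y :=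
    ((hasFDerivAt_id y).sub_const p).const_smul δ⁻¹
  have h2 := (hu.differentiable (δ⁻¹ • (y - p))).hasFDerivAt.comp y h1
  refine h2.congr_fderiv ?_
  ext v
  simp

/-- A test function on the tangent half-space at a boundary point, shrunk towards that point, is a
test function on the domain. -/
lemma eventually_isTestFunction_rescale {Ω : Set (E N)} {p : E N} {U : Set (E N)} {ρ : E N → ℝ}
    (hU : IsOpen U) (hp : p ∈ U) (hρ : ContDiffOn ℝ ∞ ρ U) (hρp : ρ p = 0)
    (hρΩ : ∀ x ∈ U, (x ∈ Ω ↔ 0 < ρ x)) {u : E N → ℝ}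
    (hu : IsTestFunction {x | 0 < ⟪gradient ρ p, x⟫} u) :
    ∀ᶠ δ in 𝓝[>] (0 : ℝ), IsTestFunction Ω fun y => u (δ⁻¹ • (y - p)) := by
  have hK : IsCompact (tsupport u) := hu.hasCompactSupport
  -- On the compact support the linear function ⟨∇ρ(p), x⟩ is at least some m > 0. The first order
  -- error is controlled with slope m/(2R), hence by δm/2 at p + δx, so ρ stays positive there.
  obtain ⟨m, hm, hmK⟩ := hK.exists_forall_le' (f := fun x => ⟪gradient ρ p, x⟫)
    (by fun_prop) (a := 0) fun x hx => hu.tsupport_subset hx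
  obtain ⟨R, hR0, hR⟩ := hK.isBounded.exists_pos_norm_le
  have hd : HasFDerivAt ρ (fderiv ℝ ρ p) p :=
    ((hρ.contDiffAt (hU.mem_nhds hp)).differentiableAt (by simp)).hasFDerivAt
  have hlo := (hasFDerivAt_iff_isLittleO.1 hd).def (show 0 < m / (2 * R) by positivity)
  obtain ⟨r, hr, hball⟩ := Metric.eventually_nhds_iff_ball.1 (hlo.and (hU.mem_nhds hp))
  filter_upwards [Ioo_mem_nhdsGT (show 0 < r / R by positivity)] with δ hδ
  have hδ0 : 0 < δ := hδ.1
  have hδR : δ * R < r := by rw [← lt_div_iff₀ hR0]; exact hδ.2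
  have himg : ∀ x ∈ tsupport u, p + δ • x ∈ Ω := by
    intro x hx
    have hxR : ‖δ • x‖ ≤ δ * R := by
      rw [norm_smul, Real.norm_of_nonneg hδ0.le]; gcongr; exact hR x hx
    have hb := hball (p + δ • x) (by rw [mem_ball_iff_norm]; simpa using hxR.trans_lt hδR)
    refine (hρΩ _ hb.2).2 ?_
    have h1 := hb.1
    rw [hρp, add_sub_cancel_left, sub_zero, ← inner_gradient, real_inner_smul_right,
      Real.norm_eq_abs, abs_le] at h1
    have h2 : m / (2 * R) * ‖δ • x‖ ≤ m / (2 * R) * (δ * R) := by gcongr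
    have h3 : m / (2 * R) * (δ * R) = δ * m / 2 := by field_simp
    have h4 : δ * m ≤ δ * ⟪gradient ρ p, x⟫ := by gcongr; exact hmK x hx
    have h5 : 0 < δ * m := by positivity
    linarith [h1.1]
  have hKc : IsCompact ((fun x => p + δ • x) '' tsupport u) := hK.image (by fun_prop)
  have h0 : ∀ y ∉ (fun x => p + δ • x) '' tsupport u, u (δ⁻¹ • (y - p)) = 0 := by
    intro y hy
    by_contra h
    refine hy ⟨δ⁻¹ • (y - p), subset_tsupport u h, ?_⟩
    simp [smul_smul, hδ0.ne']
  have hts : tsupport (fun y => u (δ⁻¹ • (y - p))) ⊆ (fun x => p + δ • x) '' tsupport u :=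
    closure_minimal (fun y hy => by by_contra h; exact hy (h0 y h)) hKc.isClosed
  refine ⟨hu.contDiff.comp (by fun_prop : ContDiff ℝ ∞ fun y => δ⁻¹ • (y - p)),
    HasCompactSupport.intro hKc h0, hts.trans ?_⟩
  rintro _ ⟨x, hx, rfl⟩
  exact himg x hx

/-- Above the critical constant the Hardy inequality fails, even up to an `L²` term. -/
lemma exists_hardy_supercritical (hN : 2 ≤ N) (hn : 2 ≤ n) {Ω : Set (E N)}
    (hΩ : IsSmoothBoundedDomain Ω) {a : Fin n → E N} (ha : Function.Injective a)
    (haΩ : ∀ i, a i ∈ frontier Ω) {μ : ℝ} (hμ : (N : ℝ) ^ 2 / (4 * (n : ℝ) - 4) < μ) (lam : ℝ) :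
    ∃ u : E N → ℝ, IsTestFunction Ω u ∧
      lam * (∫ x, u x ^ 2) + (∫ x, ‖gradient u x‖ ^ 2) < μ * ∫ x, V a x * u x ^ 2 := by
  have hn1 : (2 : ℝ) ≤ n := by exact_mod_cast hn
  have hne : ∀ x ∈ Ω, ∀ i, x ≠ a i := fun x hx i h =>
    notMem_of_mem_frontier hΩ.isOpen (haΩ i) (h ▸ hx)
  have hVc := continuousOn_V hne
  have hμ0 : 0 < μ := lt_of_le_of_lt (div_nonneg (by positivity) (by linarith)) hμ
  have hμ' : (N : ℝ) ^ 2 / 4 < μ * (n - 1) := by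
    rw [div_lt_iff₀ (by linarith)] at hμ
    linarith
  obtain ⟨ε, hε, hεμ⟩ : ∃ ε : ℝ, 0 < ε ∧ (N : ℝ) ^ 2 / 4 + ε < μ * (n - 1 - ε) := by
    have h : Tendsto (fun ε : ℝ => (N : ℝ) ^ 2 / 4 + ε - μ * (n - 1 - ε)) (𝓝[>] 0)
        (𝓝 ((N : ℝ) ^ 2 / 4 + 0 - μ * (n - 1 - 0))) :=
      (ContinuousAt.tendsto (by fun_prop)).mono_left nhdsWithin_le_nhds
    have h0 : (N : ℝ) ^ 2 / 4 + 0 - μ * (n - 1 - 0) < 0 := by linarith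
    obtain ⟨ε, h1, h2⟩ := ((h.eventually (gt_mem_nhds h0)).and eventually_mem_nhdsWithin).exists
    exact ⟨ε, h2, by linarith⟩
  -- Concentration at a single pole suffices, and any pole would do.
  let i₀ : Fin n := ⟨0, by omega⟩
  set p := a i₀
  obtain ⟨U, ρ, hU, hpU, hρ, hρp, hdρ, hρΩ⟩ := hΩ.smooth_boundary p (haΩ i₀)
  have hν : gradient ρ p ≠ 0 := by
    intro h
    apply hdρ
    rw [fderiv_eq_innerSL_gradient, h, map_zero]
  obtain ⟨u, hu, huopt⟩ := exists_halfspace_almost_optimal (by omega : 1 ≤ N) hν hε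
  have hVloc : ∀ᶠ δ in 𝓝[>] (0 : ℝ), ∀ y, y ≠ p → δ⁻¹ • (y - p) ∈ tsupport u →
      (n - 1 - ε) ≤ ‖y - p‖ ^ 2 * V a y := by
    have h := (tendsto_V ha i₀).eventually (lt_mem_nhds (show (n : ℝ) - 1 - ε < n - 1 by linarith))
    obtain ⟨r, hr, h⟩ := Metric.eventually_nhds_iff.1 (eventually_nhdsWithin_iff.1 h)
    obtain ⟨R, hR0, hR⟩ := hu.hasCompactSupport.isCompact.isBounded.exists_pos_norm_le
    filter_upwards [Ioo_mem_nhdsGT (show 0 < r / R by positivity)] with δ hδ y hy hyK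
    refine (h ?_ hy).le
    have h1 := hR _ hyK
    rw [norm_smul, norm_inv, Real.norm_of_nonneg hδ.1.le, inv_mul_le_iff₀ hδ.1] at h1
    rw [dist_eq_norm]
    refine h1.trans_lt ?_
    rw [← lt_div_iff₀ hR0]
    exact hδ.2
  -- Under rescaling the L² term carries an extra δ² relative to the gradient and inverse square
  -- terms, so the value of `lam` is irrelevant in the limit.
  have hsmall : ∀ᶠ δ in 𝓝[>] (0 : ℝ), δ ^ 2 * (lam * ∫ x, u x ^ 2) + (∫ x, ‖gradient u x‖ ^ 2) <
      ((N : ℝ) ^ 2 / 4 + ε) * ∫ x, (‖x‖ ^ 2)⁻¹ * u x ^ 2 := by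
    have h : Tendsto (fun δ : ℝ => δ ^ 2 * (lam * ∫ x, u x ^ 2) + (∫ x, ‖gradient u x‖ ^ 2)) (𝓝[>] 0)
        (𝓝 ((0 : ℝ) ^ 2 * (lam * ∫ x, u x ^ 2) + (∫ x, ‖gradient u x‖ ^ 2))) :=
      (ContinuousAt.tendsto (by fun_prop)).mono_left nhdsWithin_le_nhds
    refine h.eventually (gt_mem_nhds ?_)
    simpa using huopt
  obtain ⟨δ, hδ, htest, hV, hs⟩ := (eventually_mem_nhdsWithin.and
    ((eventually_isTestFunction_rescale hU hpU hρ hρp hρΩ hu).and (hVloc.and hsmall))).exists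
  have hδ : 0 < δ := hδ
  refine ⟨_, htest, ?_⟩
  have e1 : ∫ y, u (δ⁻¹ • (y - p)) ^ 2 = δ ^ N * ∫ x, u x ^ 2 :=
    integral_comp_rescale (fun x => u x ^ 2) p hδ
  have e2 : ∫ y, ‖gradient (fun y => u (δ⁻¹ • (y - p))) y‖ ^ 2 =
      δ ^ N * ((δ ^ 2)⁻¹ * ∫ x, ‖gradient u x‖ ^ 2) := by
    rw [← integral_const_mul, ← integral_comp_rescale _ p hδ]
    congr 1; ext y
    rw [gradient_comp_rescale hu, norm_smul, mul_pow, norm_inv, Real.norm_of_nonneg hδ.le, inv_pow]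
  have e3 : ∫ y, (‖y - p‖ ^ 2)⁻¹ * u (δ⁻¹ • (y - p)) ^ 2 =
      δ ^ N * ((δ ^ 2)⁻¹ * ∫ x, (‖x‖ ^ 2)⁻¹ * u x ^ 2) := by
    rw [← integral_const_mul, ← integral_comp_rescale _ p hδ]
    congr 1; ext y
    rw [norm_smul, mul_pow, norm_inv, Real.norm_of_nonneg hδ.le]
    field_simp
  have hVge : (n - 1 - ε) * ∫ y, (‖y - p‖ ^ 2)⁻¹ * u (δ⁻¹ • (y - p)) ^ 2 ≤
      ∫ y, V a y * u (δ⁻¹ • (y - p)) ^ 2 := by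
    rw [← integral_const_mul]
    have hsc : ContinuousOn (fun x => (‖x - p‖ ^ 2)⁻¹) Ω := ContinuousOn.inv₀ (by fun_prop)
      fun x hx => (norm_sub_sq_pos (hne x hx i₀)).ne'
    refine integral_mono ((htest.integrable_mul_sq hΩ.isOpen hsc).const_mul _)
      (htest.integrable_mul_sq hΩ.isOpen hVc) fun y => ?_
    by_cases hy : δ⁻¹ • (y - p) ∈ tsupport u
    · have hyp : y ≠ p := by
        rintro rfl
        have := hu.tsupport_subset hy
        simp at this
      have h1 := hV y hyp hy
      have h2 : (n - 1 - ε) * (‖y - p‖ ^ 2)⁻¹ ≤ V a y := by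
        rw [← div_eq_mul_inv, div_le_iff₀ (norm_sub_sq_pos hyp)]; linarith
      simp only [← mul_assoc]
      exact mul_le_mul_of_nonneg_right h2 (sq_nonneg _)
    · simp [hu.eq_zero hy]
  have hB : 0 ≤ ∫ x, (‖x‖ ^ 2)⁻¹ * u x ^ 2 := integral_nonneg fun x => by positivity
  rw [e3] at hVge
  rw [e1, e2]
  have hμV := mul_le_mul_of_nonneg_left hVge hμ0.le
  refine lt_of_lt_of_le ?_ hμV
  have hs' : δ ^ 2 * (lam * ∫ x, u x ^ 2) + (∫ x, ‖gradient u x‖ ^ 2) <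
      μ * (n - 1 - ε) * ∫ x, (‖x‖ ^ 2)⁻¹ * u x ^ 2 := hs.trans_le (by gcongr)
  have := mul_lt_mul_of_pos_left hs' (show 0 < δ ^ N * (δ ^ 2)⁻¹ by positivity)
  have e4 : lam * (δ ^ N * ∫ x, u x ^ 2) + δ ^ N * ((δ ^ 2)⁻¹ * ∫ x, ‖gradient u x‖ ^ 2) =
      δ ^ N * (δ ^ 2)⁻¹ * (δ ^ 2 * (lam * ∫ x, u x ^ 2) + ∫ x, ‖gradient u x‖ ^ 2) := by
    field_simp
  rw [e4]
  linarith

/-! ### Convergence in L² -/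

section LebesgueSpace

variable {α F : Type*} [MeasurableSpace α] {ν : Measure α} [NormedAddCommGroup F]

lemma lintegral_ofReal_norm_sq (f : α → F) :
    ∫⁻ x, ENNReal.ofReal (‖f x‖ ^ 2) ∂ν = eLpNorm f 2 ν ^ 2 := by
  have h := eLpNorm_nnreal_pow_eq_lintegral (f := f) (μ := ν) (p := 2) two_ne_zero
  simp only [NNReal.coe_ofNat, ENNReal.rpow_ofNat, ENNReal.coe_ofNat] at h
  rw [h]
  refine lintegral_congr fun x => ?_
  rw [ENNReal.ofReal_pow (norm_nonneg _), ofReal_norm]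

lemma lintegral_ofReal_sq (f : α → ℝ) :
    ∫⁻ x, ENNReal.ofReal (f x ^ 2) ∂ν = eLpNorm f 2 ν ^ 2 := by
  rw [← lintegral_ofReal_norm_sq]
  simp

lemma tendsto_eLpNorm_of_tendsto_sub {f : ℕ → α → F} {g : α → F}
    (hf : ∀ k, AEStronglyMeasurable (f k) ν) (hg : MemLp g 2 ν)
    (h : Tendsto (fun k => eLpNorm (fun x => f k x - g x) 2 ν) atTop (𝓝 0)) :
    Tendsto (fun k => eLpNorm (f k) 2 ν) atTop (𝓝 (eLpNorm g 2 ν)) := by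
  have h1 : Tendsto (fun k => eLpNorm g 2 ν - eLpNorm (fun x => f k x - g x) 2 ν) atTop
      (𝓝 (eLpNorm g 2 ν)) := by
    simpa using ENNReal.Tendsto.sub (tendsto_const_nhds (x := eLpNorm g 2 ν)) h
      (Or.inl hg.eLpNorm_ne_top)
  have h2 : Tendsto (fun k => eLpNorm g 2 ν + eLpNorm (fun x => f k x - g x) 2 ν) atTop
      (𝓝 (eLpNorm g 2 ν)) := by
    simpa using (tendsto_const_nhds (x := eLpNorm g 2 ν)).add h
  refine tendsto_of_tendsto_of_tendsto_of_le_of_le h1 h2 (fun k => ?_) fun k => ?_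
  · rw [tsub_le_iff_right]
    have := eLpNorm_sub_le (hf k) ((hf k).sub hg.1) (p := 2) one_le_two
    rwa [sub_sub_cancel] at this
  · have := eLpNorm_add_le hg.1 ((hf k).sub hg.1) (p := 2) one_le_two
    rwa [add_sub_cancel] at this

/-- Fatou's lemma for weighted squares of an `L²`-convergent sequence. -/
lemma lintegral_mul_sq_le_of_tendsto {f : ℕ → α → ℝ} {g : α → ℝ}
    (hf : ∀ k, AEStronglyMeasurable (f k) ν) (hg : AEStronglyMeasurable g ν)
    (h : Tendsto (fun k => eLpNorm (fun x => f k x - g x) 2 ν) atTop (𝓝 0))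
    {w : α → ℝ} (hw : AEMeasurable w ν) {b : ℕ → ℝ≥0∞} {c : ℝ≥0∞}
    (hb : ∀ᶠ k in atTop, ∫⁻ x, ENNReal.ofReal (w x * f k x ^ 2) ∂ν ≤ b k)
    (hbc : Tendsto b atTop (𝓝 c)) :
    ∫⁻ x, ENNReal.ofReal (w x * g x ^ 2) ∂ν ≤ c := by
  obtain ⟨s, hs, hae⟩ := (tendstoInMeasure_of_tendsto_eLpNorm two_ne_zero hf hg
    (by exact h)).exists_seq_tendsto_ae
  calc ∫⁻ x, ENNReal.ofReal (w x * g x ^ 2) ∂ν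
      = ∫⁻ x, liminf (fun k => ENNReal.ofReal (w x * f (s k) x ^ 2)) atTop ∂ν := by
        refine lintegral_congr_ae ?_
        filter_upwards [hae] with x hx
        exact (ENNReal.tendsto_ofReal ((hx.pow 2).const_mul (w x))).liminf_eq.symm
    _ ≤ liminf (fun k => ∫⁻ x, ENNReal.ofReal (w x * f (s k) x ^ 2) ∂ν) atTop :=
        lintegral_liminf_le' fun k => (hw.mul ((hf _).aemeasurable.pow_const 2)).ennreal_ofReal
    _ ≤ liminf (fun k => b (s k)) atTop :=
        liminf_le_liminf (hs.tendsto_atTop.eventually hb)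
    _ = c := (hbc.comp hs.tendsto_atTop).liminf_eq

lemma exists_limit_of_cauchy [CompleteSpace F] {f : ℕ → α → F} (hf : ∀ k, MemLp (f k) 2 ν)
    (h : Tendsto (fun p : ℕ × ℕ => eLpNorm (fun x => f p.1 x - f p.2 x) 2 ν) atTop (𝓝 0)) :
    ∃ g, MemLp g 2 ν ∧ Tendsto (fun k => eLpNorm (fun x => f k x - g x) 2 ν) atTop (𝓝 0) := by
  have hc : CauchySeq fun k => (hf k).toLp (f k) := by
    rw [Lp.cauchySeq_Lp_iff_cauchySeq_eLpNorm]
    refine h.congr fun p => eLpNorm_congr_ae ?_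
    filter_upwards [(hf p.1).coeFn_toLp, (hf p.2).coeFn_toLp] with x h1 h2
    simp [h1, h2]
  obtain ⟨g, hg⟩ := cauchySeq_tendsto_of_complete hc
  refine ⟨g, Lp.memLp g, ?_⟩
  rw [Lp.tendsto_Lp_iff_tendsto_eLpNorm'] at hg
  refine hg.congr fun k => eLpNorm_congr_ae ?_
  filter_upwards [(hf k).coeFn_toLp] with x h1
  simp [h1]

/-- Hölder makes the products converge in L¹; in this way the identity defining the weak gradient
passes to limits. -/
lemma tendsto_integral_smul_left [NormedSpace ℝ F] {f : ℕ → α → ℝ} {g : α → ℝ} {X : α → F}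
    (hf : ∀ k, MemLp (f k) 2 ν) (hg : MemLp g 2 ν) (hX : MemLp X 2 ν)
    (h : Tendsto (fun k => eLpNorm (fun x => f k x - g x) 2 ν) atTop (𝓝 0)) :
    Tendsto (fun k => ∫ x, f k x • X x ∂ν) atTop (𝓝 (∫ x, g x • X x ∂ν)) := by
  refine tendsto_integral_of_L1' (fun x => g x • X x) (hg.1.smul hX.1)
    (Eventually.of_forall fun k => memLp_one_iff_integrable.1 (hX.smul (hf k))) ?_
  have h1 : Tendsto (fun k => eLpNorm (fun x => f k x - g x) 2 ν * eLpNorm X 2 ν) atTop (𝓝 0) := by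
    simpa using ENNReal.Tendsto.mul_const h (Or.inr hX.eLpNorm_ne_top)
  refine tendsto_of_tendsto_of_tendsto_of_le_of_le tendsto_const_nhds h1 (fun k => zero_le)
    fun k => ?_
  have h2 := eLpNorm_smul_le_mul_eLpNorm (p := 2) (q := 2) (r := 1) hX.1 ((hf k).1.sub hg.1)
  refine le_trans (le_of_eq (congrArg (fun z => eLpNorm z 1 ν) ?_)) h2
  ext x
  simp [sub_smul]

lemma tendsto_integral_smul_right [NormedSpace ℝ F] {f : α → ℝ} {X : ℕ → α → F} {Y : α → F}
    (hf : MemLp f 2 ν) (hX : ∀ k, MemLp (X k) 2 ν) (hY : MemLp Y 2 ν)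
    (h : Tendsto (fun k => eLpNorm (fun x => X k x - Y x) 2 ν) atTop (𝓝 0)) :
    Tendsto (fun k => ∫ x, f x • X k x ∂ν) atTop (𝓝 (∫ x, f x • Y x ∂ν)) := by
  refine tendsto_integral_of_L1' (fun x => f x • Y x) (hf.1.smul hY.1)
    (Eventually.of_forall fun k => memLp_one_iff_integrable.1 ((hX k).smul hf)) ?_
  have h1 : Tendsto (fun k => eLpNorm f 2 ν * eLpNorm (fun x => X k x - Y x) 2 ν) atTop (𝓝 0) := by
    simpa using ENNReal.Tendsto.const_mul h (Or.inr hf.eLpNorm_ne_top)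
  refine tendsto_of_tendsto_of_tendsto_of_le_of_le tendsto_const_nhds h1 (fun k => zero_le)
    fun k => ?_
  have h2 := eLpNorm_smul_le_mul_eLpNorm (p := 2) (q := 2) (r := 1) ((hX k).1.sub hY.1) hf.1
  refine le_trans (le_of_eq (congrArg (fun z => eLpNorm z 1 ν) ?_)) h2
  ext x
  simp [smul_sub]

end LebesgueSpace

/-! ### From test functions to H¹₀ -/

section TestFunction

variable {Ω : Set (E N)} {u : E N → ℝ} {G : E N → E N}

lemma IsTestFunction.memLp (hu : IsTestFunction Ω u) : MemLp u 2 (volume.restrict Ω) :=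
  (hu.contDiff.continuous.memLp_of_hasCompactSupport hu.hasCompactSupport).restrict Ω

lemma IsTestFunction.memLp_gradient (hu : IsTestFunction Ω u) :
    MemLp (gradient u) 2 (volume.restrict Ω) :=
  (hu.continuous_gradient.memLp_of_hasCompactSupport hu.hasCompactSupport_gradient).restrict Ω

lemma IsTestFunction.lintegral_mul_sq (hΩ : IsOpen Ω) (hu : IsTestFunction Ω u) {w : E N → ℝ}
    (hw : ContinuousOn w Ω) (hw0 : ∀ x ∈ Ω, 0 ≤ w x) :
    ∫⁻ x in Ω, ENNReal.ofReal (w x * u x ^ 2) = ENNReal.ofReal (∫ x, w x * u x ^ 2) := by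
  rw [← hu.setIntegral_mul_sq, ofReal_integral_eq_lintegral_ofReal
    (hu.integrable_mul_sq hΩ hw).restrict]
  exact ae_restrict_of_forall_mem hΩ.measurableSet fun x hx => mul_nonneg (hw0 x hx) (sq_nonneg _)

lemma IsTestFunction.lintegral_sq (hu : IsTestFunction Ω u) :
    ∫⁻ x in Ω, ENNReal.ofReal (u x ^ 2) = ENNReal.ofReal (∫ x, u x ^ 2) := by
  rw [← hu.setIntegral_sq, ofReal_integral_eq_lintegral_ofReal hu.integrable_sq.restrict]
  exact Eventually.of_forall fun x => sq_nonneg _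

lemma IsTestFunction.lintegral_norm_gradient_sq (hu : IsTestFunction Ω u) :
    ∫⁻ x in Ω, ENNReal.ofReal (‖gradient u x‖ ^ 2) = ENNReal.ofReal (∫ x, ‖gradient u x‖ ^ 2) := by
  rw [← hu.setIntegral_norm_gradient_sq,
    ofReal_integral_eq_lintegral_ofReal hu.integrable_norm_gradient_sq.restrict]
  exact Eventually.of_forall fun x => by positivity

/-- Pairing with a fixed vector v reduces the claim to ∫∂_v(uφ) = 0. -/
lemma IsTestFunction.hasWeakGradient (hu : IsTestFunction Ω u) :
    HasWeakGradient Ω u (gradient u) := by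
  intro φ hφ
  have e1 : ∫ x in Ω, u x • gradient φ x = ∫ x, u x • gradient φ x :=
    setIntegral_eq_integral_of_forall_compl_eq_zero fun x hx => by simp [hu.eq_zero_of_notMem hx]
  have e2 : ∫ x in Ω, φ x • gradient u x = ∫ x, φ x • gradient u x :=
    setIntegral_eq_integral_of_forall_compl_eq_zero fun x hx => by simp [hφ.eq_zero_of_notMem hx]
  rw [e1, e2]
  have hcu := hu.contDiff.continuous
  have hcφ := hφ.contDiff.continuous
  have hgu := hu.continuous_gradient
  have hgφ := hφ.continuous_gradient
  have hi1 : Integrable fun x => u x • gradient φ x :=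
    Continuous.integrable_of_hasCompactSupport (by fun_prop) hu.hasCompactSupport.smul_right
  have hi2 : Integrable fun x => φ x • gradient u x :=
    Continuous.integrable_of_hasCompactSupport (by fun_prop) hφ.hasCompactSupport.smul_right
  refine ext_inner_left ℝ fun v => ?_
  rw [inner_neg_right, ← integral_inner hi1, ← integral_inner hi2, ← add_eq_zero_iff_eq_neg,
    ← integral_add (hi1.const_inner v) (hi2.const_inner v)]
  rw [← integral_fderiv_apply_eq_zero (f := fun x => u x * φ x)
    ((hu.contDiff.mul hφ.contDiff).of_le (by simp)) hu.hasCompactSupport.mul_right v]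
  refine integral_congr_ae (Eventually.of_forall fun x => ?_)
  have hd : fderiv ℝ (fun x => u x * φ x) x = u x • fderiv ℝ φ x + φ x • fderiv ℝ u x :=
    fderiv_fun_mul (hu.differentiable x) (hφ.differentiable x)
  simp [hd, real_inner_smul_right]

lemma IsTestFunction.memH10 (hu : IsTestFunction Ω u) : MemH10 Ω u (gradient u) :=
  ⟨hu.memLp, hu.memLp_gradient, hu.hasWeakGradient, fun _ => u, fun _ => hu, by simp, by simp⟩

/-- The limit of a sequence of test functions that converges with its gradients in `L²`. -/
lemma memH10_of_tendsto {φ : ℕ → E N → ℝ} (hφ : ∀ k, IsTestFunction Ω (φ k))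
    (hu : MemLp u 2 (volume.restrict Ω)) (hG : MemLp G 2 (volume.restrict Ω))
    (h0 : Tendsto (fun k => eLpNorm (fun x => φ k x - u x) 2 (volume.restrict Ω)) atTop (𝓝 0))
    (h1 : Tendsto (fun k => eLpNorm (fun x => gradient (φ k) x - G x) 2 (volume.restrict Ω))
      atTop (𝓝 0)) : MemH10 Ω u G := by
  refine ⟨hu, hG, fun χ hχ => ?_, φ, hφ, h0, h1⟩
  have t1 := tendsto_integral_smul_left (fun k => (hφ k).memLp) hu hχ.memLp_gradient h0
  have t2 := (tendsto_integral_smul_right hχ.memLp (fun k => (hφ k).memLp_gradient) hG h1).neg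
  refine tendsto_nhds_unique t1 (t2.congr fun k => ?_)
  exact ((hφ k).hasWeakGradient χ hχ).symm

/-- Weighted inequalities pass from test functions to `H¹₀`. -/
lemma MemH10.lintegral_mul_sq_le (hΩ : IsOpen Ω) (hu : MemH10 Ω u G) {w : E N → ℝ}
    (hw : ContinuousOn w Ω) (hw0 : ∀ x ∈ Ω, 0 ≤ w x) {c : ℝ} (hc : 0 ≤ c)
    (h : ∀ φ : E N → ℝ, IsTestFunction Ω φ →
      ∫ x, w x * φ x ^ 2 ≤ c * (∫ x, φ x ^ 2) + ∫ x, ‖gradient φ x‖ ^ 2) :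
    ∫⁻ x in Ω, ENNReal.ofReal (w x * u x ^ 2) ≤
      ENNReal.ofReal c * (∫⁻ x in Ω, ENNReal.ofReal (u x ^ 2)) +
        ∫⁻ x in Ω, ENNReal.ofReal (‖G x‖ ^ 2) := by
  obtain ⟨φ, hφ, h0, h1⟩ := hu.approx
  rw [lintegral_ofReal_sq, lintegral_ofReal_norm_sq]
  have t0 := tendsto_eLpNorm_of_tendsto_sub (fun k => (hφ k).memLp.1) hu.memLp h0
  have t1 := tendsto_eLpNorm_of_tendsto_sub (fun k => (hφ k).memLp_gradient.1) hu.memLp_grad h1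
  -- Fatou on the weighted side, convergence of norms on the other; finiteness of the weighted
  -- integral is a consequence, not an assumption.
  refine lintegral_mul_sq_le_of_tendsto (fun k => (hφ k).memLp.1) hu.memLp.1 h0
    (hw.aemeasurable hΩ.measurableSet)
    (b := fun k => ENNReal.ofReal c * eLpNorm (φ k) 2 (volume.restrict Ω) ^ 2 +
      eLpNorm (gradient (φ k)) 2 (volume.restrict Ω) ^ 2)
    (Eventually.of_forall fun k => ?_) ?_
  · rw [(hφ k).lintegral_mul_sq hΩ hw hw0, ← lintegral_ofReal_sq, ← lintegral_ofReal_norm_sq,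
      (hφ k).lintegral_sq, (hφ k).lintegral_norm_gradient_sq, ← ENNReal.ofReal_mul hc,
      ← ENNReal.ofReal_add (mul_nonneg hc (integral_nonneg fun x => sq_nonneg _))
        (integral_nonneg fun x => by positivity)]
    exact ENNReal.ofReal_le_ofReal (h _ (hφ k))
  · exact (ENNReal.Tendsto.const_mul (ENNReal.Tendsto.pow t0) (Or.inr ENNReal.ofReal_ne_top)).add
      (ENNReal.Tendsto.pow t1)

/-- Keeps the denominator of the quotient away from 0, where division in [0, ∞] follows a
convention; it also shows that the Hardy remainder does not vanish at a minimizer. -/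
lemma lintegral_mul_sq_ne_zero (hΩ : IsOpen Ω) (hu : AEStronglyMeasurable u (volume.restrict Ω))
    (hu0 : ¬ (u =ᵐ[volume.restrict Ω] 0)) {w : E N → ℝ} (hw : ContinuousOn w Ω)
    (hw0 : ∀ x ∈ Ω, 0 < w x) : ∫⁻ x in Ω, ENNReal.ofReal (w x * u x ^ 2) ≠ 0 := by
  intro h
  rw [lintegral_eq_zero_iff' (by exact
    ((hw.aemeasurable hΩ.measurableSet).mul (hu.aemeasurable.pow_const 2)).ennreal_ofReal)] at h
  apply hu0
  filter_upwards [h, ae_restrict_mem hΩ.measurableSet] with x hx hxΩ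
  simp only [Pi.zero_apply, ENNReal.ofReal_eq_zero] at hx
  by_contra h'
  have : 0 < u x ^ 2 := sq_pos_of_ne_zero h'
  exact absurd hx (not_le.2 (mul_pos (hw0 x hxΩ) this))

lemma MemH10.lintegral_sq_ne_top (hu : MemH10 Ω u G) :
    ∫⁻ x in Ω, ENNReal.ofReal (u x ^ 2) ≠ ⊤ := by
  rw [lintegral_ofReal_sq]
  exact ENNReal.pow_ne_top hu.memLp.eLpNorm_ne_top

lemma MemH10.lintegral_norm_sq_ne_top (hu : MemH10 Ω u G) :
    ∫⁻ x in Ω, ENNReal.ofReal (‖G x‖ ^ 2) ≠ ⊤ := by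
  rw [lintegral_ofReal_norm_sq]
  exact ENNReal.pow_ne_top hu.memLp_grad.eLpNorm_ne_top

end TestFunction

/-! ### The Hardy constant and its minimizers -/

lemma hardyQuotient_of_isTestFunction {Ω : Set (E N)} (hΩ : IsOpen Ω) {a : Fin n → E N}
    (hne : ∀ x ∈ Ω, ∀ i, x ≠ a i) {u : E N → ℝ} (hu : IsTestFunction Ω u) :
    hardyQuotient Ω a u (gradient u) =
      ENNReal.ofReal (∫ x, ‖gradient u x‖ ^ 2) / ENNReal.ofReal (∫ x, V a x * u x ^ 2) := by
  rw [hardyQuotient, hu.lintegral_norm_gradient_sq,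
    hu.lintegral_mul_sq hΩ (continuousOn_V hne) fun x _ => V_nonneg a x]

lemma IsTestFunction.admissible {Ω : Set (E N)} {a : Fin n → E N} {u : E N → ℝ}
    (hu : IsTestFunction Ω u) (h : 0 < ∫ x, V a x * u x ^ 2) : Admissible Ω u (gradient u) := by
  refine ⟨hu.memH10, fun h0 => h.ne' ?_⟩
  rw [← hu.setIntegral_mul_sq]
  refine (integral_congr_ae ?_).trans (integral_zero _ _)
  filter_upwards [h0] with x hx
  simp [hx]

lemma hardyConst_le_quotient {Ω : Set (E N)} {a : Fin n → E N} {u : E N → ℝ} {G : E N → E N}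
    (h : Admissible Ω u G) : hardyConst Ω a ≤ hardyQuotient Ω a u G :=
  iInf_le_of_le u (iInf_le_of_le G (iInf_le_of_le h le_rfl))

lemma hardyConst_mul_le {Ω : Set (E N)} (hΩ : IsOpen Ω) {a : Fin n → E N}
    (hne : ∀ x ∈ Ω, ∀ i, x ≠ a i) {u : E N → ℝ} (hu : IsTestFunction Ω u) :
    (hardyConst Ω a).toReal * ∫ x, V a x * u x ^ 2 ≤ ∫ x, ‖gradient u x‖ ^ 2 := by
  have hV0 : 0 ≤ ∫ x, V a x * u x ^ 2 :=
    integral_nonneg fun x => mul_nonneg (V_nonneg a x) (sq_nonneg _)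
  have hG0 : 0 ≤ ∫ x, ‖gradient u x‖ ^ 2 := integral_nonneg fun x => by positivity
  rcases hV0.eq_or_lt with h | h
  · rw [← h, mul_zero]; exact hG0
  · have h1 := hardyConst_le_quotient (a := a) (hu.admissible h)
    rw [hardyQuotient_of_isTestFunction hΩ hne hu, ← ENNReal.ofReal_div_of_pos h] at h1
    have h2 := ENNReal.toReal_mono ENNReal.ofReal_ne_top h1
    rw [ENNReal.toReal_ofReal (by positivity), le_div_iff₀ h] at h2
    exact h2

/-- By `exists_hardy_supercritical` with `lam` = 0, every μ above the critical value bounds the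
quotient of some test function; then μ decreases to that value. -/
lemma hardyConst_le (hN : 2 ≤ N) (hn : 2 ≤ n) {Ω : Set (E N)} (hΩ : IsSmoothBoundedDomain Ω)
    {a : Fin n → E N} (ha : Function.Injective a) (haΩ : ∀ i, a i ∈ frontier Ω) :
    hardyConst Ω a ≤ ENNReal.ofReal ((N : ℝ) ^ 2 / (4 * (n : ℝ) - 4)) := by
  have hne : ∀ x ∈ Ω, ∀ i, x ≠ a i := fun x hx i h =>
    notMem_of_mem_frontier hΩ.isOpen (haΩ i) (h ▸ hx)
  have hn1 : (2 : ℝ) ≤ n := by exact_mod_cast hn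
  set τ := (N : ℝ) ^ 2 / (4 * (n : ℝ) - 4)
  have hτ : 0 ≤ τ := div_nonneg (by positivity) (by linarith)
  have key : ∀ μ, τ < μ → hardyConst Ω a ≤ ENNReal.ofReal μ := by
    intro μ hμ
    obtain ⟨u, hu, hlt⟩ := exists_hardy_supercritical hN hn hΩ ha haΩ hμ 0
    rw [zero_mul, zero_add] at hlt
    have hG0 : 0 ≤ ∫ x, ‖gradient u x‖ ^ 2 := integral_nonneg fun x => by positivity
    have hμ0 : 0 < μ := hτ.trans_lt hμ
    have hV : 0 < ∫ x, V a x * u x ^ 2 := by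
      by_contra! h
      nlinarith
    refine (hardyConst_le_quotient (hu.admissible hV)).trans ?_
    rw [hardyQuotient_of_isTestFunction hΩ.isOpen hne hu, ← ENNReal.ofReal_div_of_pos hV]
    refine ENNReal.ofReal_le_ofReal ?_
    rw [div_le_iff₀ hV]
    exact hlt.le
  have ht : Tendsto ENNReal.ofReal (𝓝[>] τ) (𝓝 (ENNReal.ofReal τ)) :=
    ENNReal.continuous_ofReal.continuousAt.tendsto.mono_left nhdsWithin_le_nhds
  refine ge_of_tendsto ht ?_
  filter_upwards [eventually_mem_nhdsWithin] with μ hμ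
  exact key μ hμ

/-- The quotient can be brought close to its infimum by a normalized test function. -/
lemma exists_isTestFunction_lt {Ω : Set (E N)} (hn : 2 ≤ n) (hΩ : IsOpen Ω) {a : Fin n → E N}
    (ha : Function.Injective a) (hne : ∀ x ∈ Ω, ∀ i, x ≠ a i) (hfin : hardyConst Ω a ≠ ⊤)
    {ε : ℝ} (hε : 0 < ε) :
    ∃ u : E N → ℝ, IsTestFunction Ω u ∧ ∫ x, V a x * u x ^ 2 = 1 ∧
      ∫ x, ‖gradient u x‖ ^ 2 < (hardyConst Ω a).toReal + ε := by
  have hVc := continuousOn_V hne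
  set m := (hardyConst Ω a).toReal
  have hm0 : 0 ≤ m := ENNReal.toReal_nonneg
  obtain ⟨u, hu, hlt⟩ : ∃ u : E N → ℝ, IsTestFunction Ω u ∧
      ∫ x, ‖gradient u x‖ ^ 2 < (m + ε) * ∫ x, V a x * u x ^ 2 := by
    -- Otherwise (m + ε)∫Vφ² ≤ ∫|∇φ|² for all test functions; by Fatou this extends to H¹₀ and
    -- contradicts m being the infimum.
    by_contra! hcon
    have hlt : hardyConst Ω a < ENNReal.ofReal (m + ε) := by
      rw [← ENNReal.ofReal_toReal hfin]
      exact (ENNReal.ofReal_lt_ofReal_iff (by positivity)).2 (by linarith)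
    simp only [hardyConst, iInf_lt_iff] at hlt
    obtain ⟨u, G, hadm, hq⟩ := hlt
    have hD0 := lintegral_mul_sq_ne_zero hΩ hadm.1.memLp.1 hadm.2 hVc fun x hx => V_pos hn ha (hne x hx)
    rw [hardyQuotient, ENNReal.div_lt_iff (Or.inl hD0) (Or.inr hadm.1.lintegral_norm_sq_ne_top)] at hq
    have h := hadm.1.lintegral_mul_sq_le hΩ (w := fun x => (m + ε) * V a x)
      (continuousOn_const.mul hVc) (fun x _ => mul_nonneg (by positivity) (V_nonneg a x)) le_rfl
      fun φ hφ => by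
        simp only [mul_assoc, integral_const_mul, zero_mul, zero_add]
        exact hcon φ hφ
    have e : ∫⁻ x in Ω, ENNReal.ofReal ((m + ε) * V a x * u x ^ 2) =
        ENNReal.ofReal (m + ε) * ∫⁻ x in Ω, ENNReal.ofReal (V a x * u x ^ 2) := by
      rw [← lintegral_const_mul' _ _ ENNReal.ofReal_ne_top]
      refine lintegral_congr fun x => ?_
      rw [← ENNReal.ofReal_mul (by positivity), mul_assoc]
    rw [e, ENNReal.ofReal_zero, zero_mul, zero_add] at h
    exact absurd hq (not_lt.2 h)
  have hG0 : 0 ≤ ∫ x, ‖gradient u x‖ ^ 2 := integral_nonneg fun x => by positivity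
  have hV : 0 < ∫ x, V a x * u x ^ 2 := by
    by_contra! h
    nlinarith
  set D := ∫ x, V a x * u x ^ 2
  have hc : ((Real.sqrt D)⁻¹) ^ 2 = D⁻¹ := by rw [inv_pow, Real.sq_sqrt hV.le]
  refine ⟨_, hu.const_mul (Real.sqrt D)⁻¹, ?_, ?_⟩
  · have e : ∀ x, V a x * ((Real.sqrt D)⁻¹ * u x) ^ 2 = D⁻¹ * (V a x * u x ^ 2) := by
      intro x; rw [mul_pow, hc]; ring
    simp only [e]
    rw [integral_const_mul]
    exact inv_mul_cancel₀ hV.ne'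
  · have e : ∀ x, ‖gradient (fun x => (Real.sqrt D)⁻¹ * u x) x‖ ^ 2 = D⁻¹ * ‖gradient u x‖ ^ 2 := by
      intro x
      rw [hu.gradient_const_mul, norm_smul, mul_pow, Real.norm_eq_abs, sq_abs, hc]
    simp only [e]
    rw [integral_const_mul, inv_mul_lt_iff₀ hV, mul_comm]
    exact hlt

/-- The energy gap `∫ |∇u|² - m ∫ V u²` of a difference. -/
lemma energy_sub_le {Ω : Set (E N)} (hΩ : IsOpen Ω) {a : Fin n → E N}
    (hne : ∀ x ∈ Ω, ∀ i, x ≠ a i) {m : ℝ}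
    (hm : ∀ u : E N → ℝ, IsTestFunction Ω u →
      m * ∫ x, V a x * u x ^ 2 ≤ ∫ x, ‖gradient u x‖ ^ 2)
    {u v : E N → ℝ} (hu : IsTestFunction Ω u) (hv : IsTestFunction Ω v) :
    (∫ x, ‖gradient (fun x => u x - v x) x‖ ^ 2) - m * ∫ x, V a x * (u x - v x) ^ 2 ≤
      2 * ((∫ x, ‖gradient u x‖ ^ 2) - m * ∫ x, V a x * u x ^ 2) +
      2 * ((∫ x, ‖gradient v x‖ ^ 2) - m * ∫ x, V a x * v x ^ 2) := by
  have hVc := continuousOn_V hne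
  -- Parallelogram law for the form E(u) = ∫|∇u|² - m∫Vu²; E(u + v) can be dropped because it is
  -- nonnegative by `hm`.
  have h := hm _ (hu.add hv)
  have e1 : (∫ x, ‖gradient (fun x => u x - v x) x‖ ^ 2) +
      (∫ x, ‖gradient (fun x => u x + v x) x‖ ^ 2) =
      2 * (∫ x, ‖gradient u x‖ ^ 2) + 2 * ∫ x, ‖gradient v x‖ ^ 2 := by
    rw [← integral_add (hu.sub hv).integrable_norm_gradient_sq (hu.add hv).integrable_norm_gradient_sq,
      ← integral_const_mul, ← integral_const_mul, ← integral_add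
      (hu.integrable_norm_gradient_sq.const_mul 2) (hv.integrable_norm_gradient_sq.const_mul 2)]
    congr 1; ext x
    rw [hu.gradient_sub hv, hu.gradient_add hv]
    have := parallelogram_law_with_norm ℝ (gradient u x) (gradient v x)
    linarith
  have e2 : (∫ x, V a x * (u x - v x) ^ 2) + (∫ x, V a x * (u x + v x) ^ 2) =
      2 * (∫ x, V a x * u x ^ 2) + 2 * ∫ x, V a x * v x ^ 2 := by
    rw [← integral_add ((hu.sub hv).integrable_mul_sq hΩ hVc) ((hu.add hv).integrable_mul_sq hΩ hVc),
      ← integral_const_mul, ← integral_const_mul, ← integral_add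
      ((hu.integrable_mul_sq hΩ hVc).const_mul 2) ((hv.integrable_mul_sq hΩ hVc).const_mul 2)]
    congr 1; ext x
    ring
  have e3 : m * (∫ x, V a x * (u x - v x) ^ 2) + m * (∫ x, V a x * (u x + v x) ^ 2) =
      m * (2 * (∫ x, V a x * u x ^ 2) + 2 * ∫ x, V a x * v x ^ 2) := by
    rw [← e2]; ring
  linarith

lemma tendsto_eLpNorm_of_tendsto_lintegral {α F ι : Type*} [MeasurableSpace α] {ν : Measure α}
    [NormedAddCommGroup F] {l : Filter ι} {f : ι → α → F}
    (h : Tendsto (fun k => ∫⁻ x, ENNReal.ofReal (‖f k x‖ ^ 2) ∂ν) l (𝓝 0)) :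
    Tendsto (fun k => eLpNorm (f k) 2 ν) l (𝓝 0) := by
  simp only [lintegral_ofReal_norm_sq] at h
  have h2 := h.ennrpow_const (1 / 2 : ℝ)
  rw [ENNReal.zero_rpow_of_pos (by norm_num)] at h2
  refine h2.congr fun k => ?_
  rw [← ENNReal.rpow_natCast, ← ENNReal.rpow_mul]
  norm_num

/-- Below the critical constant the Hardy constant is attained. -/
lemma exists_minimizer (hN : 2 ≤ N) (hn : 2 ≤ n) {Ω : Set (E N)} (hΩ : IsSmoothBoundedDomain Ω)
    {a : Fin n → E N} (ha : Function.Injective a) (haΩ : ∀ i, a i ∈ frontier Ω)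
    (hlt : hardyConst Ω a < ENNReal.ofReal ((N : ℝ) ^ 2 / (4 * (n : ℝ) - 4))) :
    ∃ (u : E N → ℝ) (G : E N → E N), Admissible Ω u G ∧
      hardyQuotient Ω a u G = hardyConst Ω a := by
  have hO := hΩ.isOpen
  have hne : ∀ x ∈ Ω, ∀ i, x ≠ a i := fun x hx i h =>
    notMem_of_mem_frontier hΩ.isOpen (haΩ i) (h ▸ hx)
  have hVc := continuousOn_V hne
  have hfin : hardyConst Ω a ≠ ⊤ := hlt.ne_top
  set m := (hardyConst Ω a).toReal with hm
  have hm0 : 0 ≤ m := ENNReal.toReal_nonneg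
  have hmC : hardyConst Ω a = ENNReal.ofReal m := (ENNReal.ofReal_toReal hfin).symm
  have hmτ : m < (N : ℝ) ^ 2 / (4 * (n : ℝ) - 4) := by
    rw [hmC] at hlt
    exact (ENNReal.ofReal_lt_ofReal_iff_of_nonneg hm0).1 hlt
  -- The gap between m and μ is the source of compactness.
  obtain ⟨μ, hμm, hμτ⟩ := exists_between hmτ
  obtain ⟨c, hc0, hc⟩ := exists_hardy_subcritical hn hΩ ha haΩ hμτ
  have hQ := fun (u : E N → ℝ) (hu : IsTestFunction Ω u) => hardyConst_mul_le hO hne hu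
  choose φ hφ hφV hφG using fun k : ℕ => exists_isTestFunction_lt hn hO ha hne hfin
    (show (0 : ℝ) < 1 / ((k : ℝ) + 1) by positivity)
  obtain ⟨R, hR0, hR⟩ := hΩ.isBounded.exists_pos_norm_le
  have hφG1 : ∀ k, ∫ x, ‖gradient (φ k) x‖ ^ 2 ≤ m + 1 := by
    intro k
    refine (hφG k).le.trans ?_
    have : 1 / ((k : ℝ) + 1) ≤ 1 := by
      rw [div_le_one (by positivity)]; linarith [(Nat.cast_nonneg k : (0 : ℝ) ≤ k)]
    linarith
  obtain ⟨s, hs, hcau⟩ := exists_subseq_cauchy hΩ.isBounded hφ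
    (A := max (m + 1) (R ^ 2 * (m + 1)))
    (fun k => (poincare hN hR0 hR (hφ k)).trans
      ((mul_le_mul_of_nonneg_left (hφG1 k) (by positivity)).trans (le_max_right _ _)))
    (fun k => (hφG1 k).trans (le_max_left _ _))
  set ψ : ℕ → E N → ℝ := fun k => φ (s k)
  have hψ : ∀ k, IsTestFunction Ω (ψ k) := fun k => hφ (s k)
  have hψV : ∀ k, ∫ x, V a x * ψ k x ^ 2 = 1 := fun k => hφV (s k)
  have hεt : Tendsto (fun k : ℕ => 1 / (((s k : ℕ) : ℝ) + 1)) atTop (𝓝 0) :=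
    tendsto_one_div_add_atTop_nhds_zero_nat.comp hs.tendsto_atTop
  have hψG : ∀ k, ∫ x, ‖gradient (ψ k) x‖ ^ 2 < m + 1 / (((s k : ℕ) : ℝ) + 1) := fun k => hφG (s k)
  -- the three squared distances along the sequence
  let d : ℕ × ℕ → ℝ := fun p => ∫ x, (ψ p.1 x - ψ p.2 x) ^ 2
  let dV : ℕ × ℕ → ℝ := fun p => ∫ x, V a x * (ψ p.1 x - ψ p.2 x) ^ 2
  let dG : ℕ × ℕ → ℝ := fun p => ∫ x, ‖gradient (fun x => ψ p.1 x - ψ p.2 x) x‖ ^ 2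
  have hd0 : ∀ p, 0 ≤ d p := fun p => integral_nonneg fun x => sq_nonneg _
  have hdV0 : ∀ p, 0 ≤ dV p := fun p =>
    integral_nonneg fun x => mul_nonneg (V_nonneg a x) (sq_nonneg _)
  have hdG0 : ∀ p, 0 ≤ dG p := fun p => integral_nonneg fun x => by positivity
  have hd : Tendsto d atTop (𝓝 0) := by
    rw [Metric.tendsto_nhds]
    intro ε hε
    filter_upwards [hcau ε hε] with p hp
    rw [Real.dist_eq, sub_zero, abs_of_nonneg (hd0 p)]
    exact hp
  let e : ℕ × ℕ → ℝ := fun p => 2 * (1 / (((s p.1 : ℕ) : ℝ) + 1)) + 2 * (1 / (((s p.2 : ℕ) : ℝ) + 1))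
  have he : Tendsto e atTop (𝓝 0) := by
    rw [← prod_atTop_atTop_eq]
    simpa [e] using ((hεt.comp tendsto_fst).const_mul 2).add ((hεt.comp tendsto_snd).const_mul 2)
  -- Since ∫Vψ² = 1 along the sequence, the energy gap of `ψ k` is below 1/(s k + 1).
  have hgap : ∀ p, dG p - m * dV p ≤ e p := by
    intro p
    have h := energy_sub_le hO hne hQ (hψ p.1) (hψ p.2)
    rw [hψV, hψV] at h
    have h1 := hψG p.1
    have h2 := hψG p.2
    simp only [e]
    change dG p - m * dV p ≤ _ at h
    linarith
  -- From μ dV ≤ c d + dG and dG ≤ m dV + e the term m dV is absorbed because m < μ. The L² Cauchy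
  -- property thus carries over to the weight V, and then to the gradients.
  have hVle : ∀ p, dV p ≤ (μ - m)⁻¹ * (c * d p + e p) := by
    intro p
    rw [← div_eq_inv_mul, le_div_iff₀ (sub_pos.2 hμm)]
    have h := hc _ ((hψ p.1).sub (hψ p.2))
    change μ * dV p ≤ c * d p + dG p at h
    have := hgap p
    linarith
  have hdV : Tendsto dV atTop (𝓝 0) := by
    refine squeeze_zero hdV0 hVle ?_
    simpa using ((hd.const_mul c).add he).const_mul (μ - m)⁻¹
  have hdG : Tendsto dG atTop (𝓝 0) := by
    refine squeeze_zero hdG0 (fun p => (by linarith [hgap p] : dG p ≤ e p + m * dV p)) ?_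
    simpa using he.add (hdV.const_mul m)
  have hEd : Tendsto (fun p : ℕ × ℕ => eLpNorm (fun x => ψ p.1 x - ψ p.2 x) 2 (volume.restrict Ω))
      atTop (𝓝 0) := by
    refine tendsto_eLpNorm_of_tendsto_lintegral ?_
    have h := ENNReal.tendsto_ofReal hd
    rw [ENNReal.ofReal_zero] at h
    refine h.congr fun p => ?_
    simp only [Real.norm_eq_abs, sq_abs]
    exact ((hψ p.1).sub (hψ p.2)).lintegral_sq.symm
  have hEG : Tendsto (fun p : ℕ × ℕ => eLpNorm (fun x => gradient (ψ p.1) x - gradient (ψ p.2) x) 2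
      (volume.restrict Ω)) atTop (𝓝 0) := by
    refine tendsto_eLpNorm_of_tendsto_lintegral ?_
    have h := ENNReal.tendsto_ofReal hdG
    rw [ENNReal.ofReal_zero] at h
    refine h.congr fun p => ?_
    rw [← ((hψ p.1).sub (hψ p.2)).lintegral_norm_gradient_sq]
    simp only [(hψ p.1).gradient_sub (hψ p.2)]
  obtain ⟨u, hu, hul⟩ := exists_limit_of_cauchy (fun k => (hψ k).memLp) hEd
  obtain ⟨G, hG, hGl⟩ := exists_limit_of_cauchy (fun k => (hψ k).memLp_gradient) hEG
  have hmem := memH10_of_tendsto hψ hu hG hul hGl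
  -- the energy of the limit
  have hGle : ∫⁻ x in Ω, ENNReal.ofReal (‖G x‖ ^ 2) ≤ ENNReal.ofReal m := by
    rw [lintegral_ofReal_norm_sq]
    have t := ENNReal.Tendsto.pow (n := 2)
      (tendsto_eLpNorm_of_tendsto_sub (fun k => (hψ k).memLp_gradient.1) hG hGl)
    have t2 : Tendsto (fun k : ℕ => ENNReal.ofReal (m + 1 / (((s k : ℕ) : ℝ) + 1))) atTop
        (𝓝 (ENNReal.ofReal m)) := by
      refine ENNReal.tendsto_ofReal ?_
      simpa using hεt.const_add m
    refine le_of_tendsto_of_tendsto' t t2 fun k => ?_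
    rw [← lintegral_ofReal_norm_sq, (hψ k).lintegral_norm_gradient_sq]
    exact ENNReal.ofReal_le_ofReal (hψG k).le
  -- the weighted mass of the limit
  have hVdist : Tendsto (fun k => ∫⁻ x in Ω, ENNReal.ofReal (V a x * (ψ k x - u x) ^ 2)) atTop
      (𝓝 0) := by
    rw [ENNReal.tendsto_nhds_zero]
    intro ε hε
    have h := ENNReal.tendsto_ofReal hdV
    rw [ENNReal.ofReal_zero, ← prod_atTop_atTop_eq] at h
    -- For fixed k, Fatou is applied as l → ∞ to the bound on the weighted distance of `ψ k` and `ψ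
    -- l`.
    filter_upwards [((ENNReal.tendsto_nhds_zero.1 h) ε hε).curry] with k hk
    refine lintegral_mul_sq_le_of_tendsto (f := fun l x => ψ k x - ψ l x) (b := fun _ => ε)
      (fun l => (hψ k).memLp.1.sub (hψ l).memLp.1) ((hψ k).memLp.1.sub hu.1) ?_
      (hVc.aemeasurable hO.measurableSet) ?_ tendsto_const_nhds
    · refine hul.congr fun l => ?_
      rw [← eLpNorm_neg]
      congr 1; ext x
      simp
    · filter_upwards [hk] with l hl
      rw [((hψ k).sub (hψ l)).lintegral_mul_sq hO hVc fun x _ => V_nonneg a x]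
      exact hl
  set D := ∫⁻ x in Ω, ENNReal.ofReal (V a x * u x ^ 2) with hDdef
  have hD1 : 1 ≤ D := by
    -- No weighted mass is lost: 1 = ∫Vψ_k² ≤ (1 + t)D + (1 + t⁻¹)∫V(ψ_k - u)², where the last term
    -- vanishes as k → ∞; afterwards t → 0.
    have hstep : ∀ t : ℝ, 0 < t → 1 ≤ ENNReal.ofReal (1 + t) * D := by
      intro t ht
      have hlim : Tendsto (fun k => ENNReal.ofReal (1 + t) * D + ENNReal.ofReal (1 + t⁻¹) *
          ∫⁻ x in Ω, ENNReal.ofReal (V a x * (ψ k x - u x) ^ 2)) atTop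
          (𝓝 (ENNReal.ofReal (1 + t) * D)) := by
        simpa using (ENNReal.Tendsto.const_mul hVdist (Or.inr ENNReal.ofReal_ne_top)).const_add
          (ENNReal.ofReal (1 + t) * D)
      refine ge_of_tendsto' hlim fun k => ?_
      have h1 : ∫⁻ x in Ω, ENNReal.ofReal (V a x * ψ k x ^ 2) = 1 := by
        rw [(hψ k).lintegral_mul_sq hO hVc fun x _ => V_nonneg a x, hψV, ENNReal.ofReal_one]
      have hmeas : AEMeasurable (fun x => ENNReal.ofReal (V a x * u x ^ 2)) (volume.restrict Ω) :=
        ((measurable_V a).aemeasurable.mul (hu.1.aemeasurable.pow_const 2)).ennreal_ofReal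
      rw [← h1, hDdef, ← lintegral_const_mul' _ _ ENNReal.ofReal_ne_top,
        ← lintegral_const_mul' _ _ ENNReal.ofReal_ne_top,
        ← lintegral_add_left' (hmeas.const_mul _)]
      refine lintegral_mono fun x => ?_
      have hV0 := V_nonneg a x
      rw [← ENNReal.ofReal_mul (by positivity), ← ENNReal.ofReal_mul (by positivity),
        ← ENNReal.ofReal_add (by positivity) (by positivity)]
      refine ENNReal.ofReal_le_ofReal ?_
      have h2 := norm_add_sq_le_of_pos ht (u x) (ψ k x - u x)
      simp only [add_sub_cancel, Real.norm_eq_abs, sq_abs] at h2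
      have h3 := mul_le_mul_of_nonneg_left h2 hV0
      linarith
    by_contra! hD
    have hDt : D ≠ ⊤ := hD.ne_top
    have hDr : D.toReal < 1 := by
      have := (ENNReal.toReal_lt_toReal hDt ENNReal.one_ne_top).2 hD
      simpa using this
    have hlim : Tendsto (fun t : ℝ => (1 + t) * D.toReal) (𝓝[>] 0) (𝓝 ((1 + 0) * D.toReal)) :=
      (ContinuousAt.tendsto (by fun_prop)).mono_left nhdsWithin_le_nhds
    have h1 : 1 ≤ (1 + 0) * D.toReal := by
      refine ge_of_tendsto hlim ?_
      filter_upwards [eventually_mem_nhdsWithin] with t ht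
      have ht : 0 < t := ht
      have := ENNReal.toReal_mono (ENNReal.mul_ne_top ENNReal.ofReal_ne_top hDt) (hstep t ht)
      rwa [ENNReal.toReal_one, ENNReal.toReal_mul, ENNReal.toReal_ofReal (by positivity)] at this
    linarith
  have hadm : Admissible Ω u G := by
    refine ⟨hmem, fun h0 => ?_⟩
    have : D = 0 := by
      rw [hDdef]
      refine (lintegral_congr_ae ?_).trans lintegral_zero
      filter_upwards [h0] with x hx
      simp [hx]
    rw [this] at hD1
    exact absurd hD1 (by simp)
  refine ⟨u, G, hadm, le_antisymm ?_ (hardyConst_le_quotient hadm)⟩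
  rw [hmC, hardyQuotient]
  calc _ ≤ ENNReal.ofReal m / 1 := ENNReal.div_le_div hGle hD1
    _ = _ := div_one _

/-- If the constant lies below the critical value it is attained, and the positive remainder at the
minimizer makes the multipolar inequality strict. Otherwise it suffices that (N - 2)²/n² < N²/(4n -
4), which follows from (N - 2)² < N² and 4n - 4 ≤ n². -/
lemma lt_hardyConst (hN : 2 ≤ N) (hn : 2 ≤ n) {Ω : Set (E N)} (hΩ : IsSmoothBoundedDomain Ω)
    {a : Fin n → E N} (ha : Function.Injective a) (haΩ : ∀ i, a i ∈ frontier Ω) :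
    ENNReal.ofReal (((N : ℝ) - 2) ^ 2 / (n : ℝ) ^ 2) < hardyConst Ω a := by
  have hO := hΩ.isOpen
  have hne : ∀ x ∈ Ω, ∀ i, x ≠ a i := fun x hx i h =>
    notMem_of_mem_frontier hΩ.isOpen (haΩ i) (h ▸ hx)
  have hVc := continuousOn_V hne
  have hN2 : (2 : ℝ) ≤ N := by exact_mod_cast hN
  have hn2 : (2 : ℝ) ≤ n := by exact_mod_cast hn
  have hn4 : (0 : ℝ) < 4 * n - 4 := by linarith
  have hτ : 0 < (N : ℝ) ^ 2 / (4 * (n : ℝ) - 4) := by positivity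
  by_cases hlt : hardyConst Ω a < ENNReal.ofReal ((N : ℝ) ^ 2 / (4 * (n : ℝ) - 4))
  · obtain ⟨u, G, hadm, hq⟩ := exists_minimizer hN hn hΩ ha haΩ hlt
    rw [← hq]
    obtain ⟨w, hwc, hw0, hw⟩ := exists_multipolar_hardy_remainder hN hn hO hΩ.isBounded
      (a := a) fun i => notMem_of_mem_frontier hO (haΩ i)
    set β := ((N : ℝ) - 2) ^ 2 / (n : ℝ) ^ 2
    have hβ : 0 ≤ β := by positivity
    have h := hadm.1.lintegral_mul_sq_le hO (w := fun x => β * V a x + w x)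
      ((continuousOn_const.mul hVc).add hwc)
      (fun x hx => add_nonneg (mul_nonneg hβ (V_nonneg a x)) (hw0 x hx).le) le_rfl fun φ hφ => by
        have e : ∀ x, (β * V a x + w x) * φ x ^ 2 = β * (V a x * φ x ^ 2) + w x * φ x ^ 2 :=
          fun x => by ring
        simp only [e]
        rw [integral_add ((hφ.integrable_mul_sq hO hVc).const_mul β) (hφ.integrable_mul_sq hO hwc),
          integral_const_mul, zero_mul, zero_add]
        exact hw φ hφ
    rw [ENNReal.ofReal_zero, zero_mul, zero_add] at h
    have hmu : AEMeasurable (fun x => u x ^ 2) (volume.restrict Ω) :=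
      hadm.1.memLp.1.aemeasurable.pow_const 2
    have hmeas : AEMeasurable (fun x => ENNReal.ofReal (V a x * u x ^ 2)) (volume.restrict Ω) :=
      ((measurable_V a).aemeasurable.mul hmu).ennreal_ofReal
    have e : ∫⁻ x in Ω, ENNReal.ofReal ((β * V a x + w x) * u x ^ 2) =
        ENNReal.ofReal β * (∫⁻ x in Ω, ENNReal.ofReal (V a x * u x ^ 2)) +
          ∫⁻ x in Ω, ENNReal.ofReal (w x * u x ^ 2) := by
      rw [← lintegral_const_mul' _ _ ENNReal.ofReal_ne_top,
        ← lintegral_add_left' (hmeas.const_mul _)]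
      refine setLIntegral_congr_fun hO.measurableSet fun x hx => ?_
      have h1 := V_nonneg a x
      have h2 := (hw0 x hx).le
      rw [← ENNReal.ofReal_mul hβ, ← ENNReal.ofReal_add (by positivity) (by positivity)]
      congr 1
      ring
    rw [e] at h
    have hpos := lintegral_mul_sq_ne_zero hO hadm.1.memLp.1 hadm.2 hwc hw0
    -- An infinite denominator would make the quotient 0 in [0, ∞]. The subcritical inequality,
    -- extended to H¹₀, excludes it; the strict gain from the remainder also needs this finiteness.
    have hDfin : ∫⁻ x in Ω, ENNReal.ofReal (V a x * u x ^ 2) ≠ ⊤ := by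
      set τ := (N : ℝ) ^ 2 / (4 * (n : ℝ) - 4)
      obtain ⟨c, hc0, hc⟩ := exists_hardy_subcritical hn hΩ ha haΩ (half_lt_self hτ)
      have h1 := hadm.1.lintegral_mul_sq_le hO (w := fun x => τ / 2 * V a x)
        (continuousOn_const.mul hVc) (fun x _ => mul_nonneg (by positivity) (V_nonneg a x)) hc0
        fun φ hφ => by
          simp only [mul_assoc, integral_const_mul]
          exact hc φ hφ
      have e2 : ∫⁻ x in Ω, ENNReal.ofReal (τ / 2 * V a x * u x ^ 2) =
          ENNReal.ofReal (τ / 2) * ∫⁻ x in Ω, ENNReal.ofReal (V a x * u x ^ 2) := by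
        rw [← lintegral_const_mul' _ _ ENNReal.ofReal_ne_top]
        refine lintegral_congr fun x => ?_
        rw [← ENNReal.ofReal_mul (by positivity), mul_assoc]
      rw [e2] at h1
      intro htop
      rw [htop, ENNReal.mul_top (by simpa using hτ), top_le_iff] at h1
      exact ENNReal.add_ne_top.2 ⟨ENNReal.mul_ne_top ENNReal.ofReal_ne_top
        hadm.1.lintegral_sq_ne_top, hadm.1.lintegral_norm_sq_ne_top⟩ h1
    rw [hardyQuotient, ENNReal.lt_div_iff_mul_lt (Or.inr ENNReal.ofReal_ne_top) (Or.inl hDfin)]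
    refine lt_of_lt_of_le ?_ h
    exact ENNReal.lt_add_right (ENNReal.mul_ne_top ENNReal.ofReal_ne_top hDfin) hpos
  · refine lt_of_lt_of_le ?_ (not_lt.1 hlt)
    rw [ENNReal.ofReal_lt_ofReal_iff hτ, div_lt_div_iff₀ (by positivity) hn4]
    have h1 : ((N : ℝ) - 2) ^ 2 < (N : ℝ) ^ 2 := by nlinarith
    have h2 : 4 * (n : ℝ) - 4 ≤ (n : ℝ) ^ 2 := by nlinarith [sq_nonneg ((n : ℝ) - 2)]
    calc ((N : ℝ) - 2) ^ 2 * (4 * n - 4) < (N : ℝ) ^ 2 * (4 * n - 4) := by gcongr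
      _ ≤ (N : ℝ) ^ 2 * n ^ 2 := by gcongr

end MultipolarHardy

end

theorem theorem4 (N n : ℕ) (hN : 2 ≤ N) (hn : 2 ≤ n)
    (Ω : Set (MultipolarHardy.E N)) (hΩ : MultipolarHardy.IsSmoothBoundedDomain Ω)
    (a : Fin n → MultipolarHardy.E N) (ha : Function.Injective a)
    (haΩ : ∀ i, a i ∈ frontier Ω) :
    (ENNReal.ofReal (((N : ℝ) - 2) ^ 2 / (n : ℝ) ^ 2) < MultipolarHardy.hardyConst Ω a ∧
      MultipolarHardy.hardyConst Ω a ≤ ENNReal.ofReal ((N : ℝ) ^ 2 / (4 * (n : ℝ) - 4))) ∧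
    (∀ μ : ℝ, μ < (N : ℝ) ^ 2 / (4 * (n : ℝ) - 4) →
      ∃ c : ℝ, ∀ u : MultipolarHardy.E N → ℝ, MultipolarHardy.IsTestFunction Ω u →
        μ * (∫ x in Ω, MultipolarHardy.V a x * u x ^ 2) ≤
          c * (∫ x in Ω, u x ^ 2) + (∫ x in Ω, ‖gradient u x‖ ^ 2)) ∧
    (∀ μ : ℝ, (N : ℝ) ^ 2 / (4 * (n : ℝ) - 4) < μ → ∀ lam : ℝ,
      ∃ u : MultipolarHardy.E N → ℝ, MultipolarHardy.IsTestFunction Ω u ∧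
        lam * (∫ x in Ω, u x ^ 2) + (∫ x in Ω, ‖gradient u x‖ ^ 2) <
          μ * (∫ x in Ω, MultipolarHardy.V a x * u x ^ 2)) ∧
    (MultipolarHardy.hardyConst Ω a < ENNReal.ofReal ((N : ℝ) ^ 2 / (4 * (n : ℝ) - 4)) →
      ∃ (u : MultipolarHardy.E N → ℝ) (G : MultipolarHardy.E N → MultipolarHardy.E N),
        MultipolarHardy.Admissible Ω u G ∧
        MultipolarHardy.hardyQuotient Ω a u G = MultipolarHardy.hardyConst Ω a) := by
  refine ⟨⟨MultipolarHardy.lt_hardyConst hN hn hΩ ha haΩ,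
    MultipolarHardy.hardyConst_le hN hn hΩ ha haΩ⟩, fun μ hμ => ?_, fun μ hμ lam => ?_,
    MultipolarHardy.exists_minimizer hN hn hΩ ha haΩ⟩
  · obtain ⟨c, -, hc⟩ := MultipolarHardy.exists_hardy_subcritical hn hΩ ha haΩ hμ
    refine ⟨c, fun u hu => ?_⟩
    rw [hu.setIntegral_mul_sq, hu.setIntegral_sq, hu.setIntegral_norm_gradient_sq]
    exact hc u hu
  · obtain ⟨u, hu, h⟩ := MultipolarHardy.exists_hardy_supercritical hN hn hΩ ha haΩ hμ lam
    refine ⟨u, hu, ?_⟩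
    rwa [hu.setIntegral_mul_sq, hu.setIntegral_sq, hu.setIntegral_norm_gradient_sq]
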